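/- Let $M$ be a smooth $N$-dimensional manifold (Hausdorff, second countable), let $\omega^{ij}(u)$ be an arbitrary, possibly degenerate, smooth Poisson structure on $M$, and let $T_{ijk}(u)$ be an arbitrary smooth closed 3-form on $M$. Let $\Omega M$ be the loop space of smooth maps $\gamma:S^1=\mathbb R/\mathbb Z\to M$, $\gamma(x)=\{u^i(x)\}$, and call $V\subseteq\Omega M$ open if it is open along every smooth finite-dimensional family of loops. A functional $I:V\to\mathbb R$ is said to have a smooth variational derivative $\delta I/\delta u$ if $\delta I/\delta u(x)$ is, for every loop in $V$, a covector field along the loop, depends smoothly on $x$ and on the parameters along every smooth finite-dimensional family of loops in $V$, and satisfies $dI=\int_{S^1}\frac{\delta I}{\delta u^i(x)}\,\delta u^i(x)\,dx$ along all such families. A matrix operator $A^{ij}(u,u_x)$ is a Poisson structure on a subset $U\subseteq\Omega M$ if for every open $V\subseteq U$ the bracket $$\{I,J\}=\int_{S^1}\frac{\delta I}{\delta u^i(x)}\,A^{ij}(u,u_x)\,\frac{\delta J}{\delta u^j(x)}\,dx$$ of functionals on $V$ with smooth variational derivatives is again a functional with a smooth variational derivative, is skew-symmetric, and satisfies the Jacobi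 identity. For $\varepsilon\in\mathbb R$ put $$A^{ij}(\varepsilon,u,u_x)=B^i_s(\varepsilon,u,u_x)\,\omega^{sj}(u),\qquad B^i_s(\varepsilon,u,u_x)\bigl(\delta^s_j+\varepsilon\,\omega^{sp}(u)\,T_{pjk}(u)\,u^k_x\bigr)=\delta^i_j ,$$ wherever the matrix in parentheses is invertible, and let $\mathcal U_\varepsilon\subseteq\Omega M$ be the set of loops along which it is invertible at every $x\in S^1$. Then: 1. For every $\varepsilon\in\mathbb R$ the set $\mathcal U_\varepsilon$ is open and $A^{ij}(\varepsilon,u,u_x)$ is a Poisson structure on $\mathcal U_\varepsilon$. Every loop belongs to $\mathcal U_\varepsilon$ for all sufficiently small $|\varepsilon|$. 2. There are matrix operators $A_n^{ij}(u,u_x)$, $n\ge 0$, such that for every point $u$ and tangent vector $u_x$ at $u$, and for all sufficiently small $|\varepsilon|$ (depending on $u,u_x$), the matrix $\delta^s_j+\varepsilon\,\omega^{sp}T_{pjk}u^k_x$ is invertible and $$A^{ij}(\varepsilon,u,u_x)=\sum_{n\ge 0}\varepsilon^nA_n^{ij}(u,u_x)=\omega^{ij}(u)-\varepsilon\,\omega^{is}(u)\,T_{srk}(u)\,\omega^{rj}(u)\,u^k_x+\cdots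 .$$ 3. The formal series $\sum_{n\ge0}\varepsilon^nA_n^{ij}$ is a graded $\varepsilon$-deformation of $\omega$: $A_0^{ij}=\omega^{ij}$; for every $n$ the entries of $A_n^{ij}(u,u_x)$ are homogeneous polynomials of degree $n$ in $u_x$ depending smoothly on $u$; and, for functionals with smooth variational derivatives on any open subset of $\Omega M$, each bracket $\{I,J\}_n$ defined by $A_n^{ij}$ is again a functional with a smooth variational derivative, and the formal bracket $\sum_n\varepsilon^n\{I,J\}_n$ is skew-symmetric and satisfies the Jacobi identity in every order of $\varepsilon$. -/

import Mathlib

open Filter Topology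
open scoped Manifold ContDiff

namespace LoopPoisson

noncomputable section

/-- The space of coordinates `(u¹, …, uᴺ)`. -/
abbrev Coord (N : ℕ) : Type := EuclideanSpace ℝ (Fin N)

/-- The tangent space at `p` of an `N`-dimensional manifold. -/
abbrev Tan (N : ℕ) {M : Type*} [TopologicalSpace M] [ChartedSpace (Coord N) M] (p : M) : Type :=
  TangentSpace (𝓡 N) p

/-- The cotangent space at `p`. -/
abbrev Cotan (N : ℕ) {M : Type*} [TopologicalSpace M] [ChartedSpace (Coord N) M] (p : M) : Type :=
  Module.Dual ℝ (Tan N p)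

/-! ### Local coordinates -/

section Coordinates

variable {N : ℕ} {M : Type*} [TopologicalSpace M] [ChartedSpace (Coord N) M]

/-- The differential at `p` of the chart around `c`: it sends a tangent vector to its components
in these local coordinates. -/
def coframe (c p : M) : Tan N p →L[ℝ] Coord N :=
  mfderiv (𝓡 N) 𝓘(ℝ, Coord N) (chartAt (Coord N) c) p

/-- The inverse of the differential of the chart around `c` at a point `p` of its domain: it sends
components in these local coordinates to the tangent vector with these components. -/
def frame (c p : M) : Coord N →L[ℝ] Tan N p :=
  (coframe c p).inverse

/-- The covector at `p` with components `a` in the chart around `c`. -/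
def coordCovector (c p : M) (a : Module.Dual ℝ (Coord N)) : Cotan N p :=
  a ∘ₗ (coframe (N := N) c p).toLinearMap

end Coordinates

/-! ### Poisson structures and closed 3-forms on a manifold -/

section Tensors

/-- Contravariant 2-tensor fields, `ω₀ p α` being the vector `ω^{ij}(p) α_j`. -/
abbrev TwoTensor (N : ℕ) (M : Type*) [TopologicalSpace M] [ChartedSpace (Coord N) M] : Type _ :=
  ∀ p : M, Cotan N p →ₗ[ℝ] Tan N p

/-- Fields of alternating trilinear forms. -/
abbrev ThreeForm (N : ℕ) (M : Type*) [TopologicalSpace M] [ChartedSpace (Coord N) M] : Type _ :=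
  ∀ p : M, (Tan N p) [⋀^Fin 3]→L[ℝ] ℝ

variable {N : ℕ} {M : Type*} [TopologicalSpace M] [ChartedSpace (Coord N) M]

/-- The vector `ω^{ij} a_j` at the point with coordinates `y`, in components. -/
def TwoTensor.inChart (ω₀ : TwoTensor N M) (c : M) (a : Module.Dual ℝ (Coord N)) (y : Coord N) :
    Coord N :=
  let p := (chartAt (Coord N) c).symm y
  coframe c p (ω₀ p (coordCovector c p a))

/-- `ω` is a (smooth) Poisson structure on `M`: it is skew-symmetric, and in local coordinates its
components are smooth and satisfy the Jacobi identity
`∂_s ω^{ij} ω^{sk} + ∂_s ω^{jk} ω^{si} + ∂_s ω^{ki} ω^{sj} = 0`. -/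
structure IsPoissonStructure (ω₀ : TwoTensor N M) : Prop where
  skew : ∀ (p : M) (α β : Cotan N p), α (ω₀ p β) = -β (ω₀ p α)
  smooth : ∀ (c : M) (a : Module.Dual ℝ (Coord N)),
    ContDiffOn ℝ ∞ (ω₀.inChart c a) (chartAt (Coord N) c).target
  jacobi : ∀ (c : M) (a b d : Module.Dual ℝ (Coord N)), ∀ y ∈ (chartAt (Coord N) c).target,
    fderiv ℝ (fun z => a (ω₀.inChart c b z)) y (ω₀.inChart c d y)
      + fderiv ℝ (fun z => b (ω₀.inChart c d z)) y (ω₀.inChart c a y)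
      + fderiv ℝ (fun z => d (ω₀.inChart c a z)) y (ω₀.inChart c b y) = 0

/-- The 3-form in the local coordinates given by the chart around `c`. -/
def ThreeForm.inChart (T : ThreeForm N M) (c : M) (y : Coord N) : (Coord N) [⋀^Fin 3]→L[ℝ] ℝ :=
  let p := (chartAt (Coord N) c).symm y
  (T p).compContinuousLinearMap (frame c p)

/-- `T` is a smooth closed differential 3-form. -/
structure IsClosedThreeForm (T : ThreeForm N M) : Prop where
  smooth : ∀ c : M, ContDiffOn ℝ ∞ (T.inChart c) (chartAt (Coord N) c).target
  closed : ∀ c : M, ∀ y ∈ (chartAt (Coord N) c).target, extDeriv (T.inChart c) y = 0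

end Tensors

/-! ### The loop space and its functionals -/

section Loops

/-- The loop space: smooth parametrized maps from the circle `ℝ / ℤ` to `M`. -/
structure Loop (N : ℕ) (M : Type*) [TopologicalSpace M] [ChartedSpace (Coord N) M] where
  toFun : UnitAddCircle → M
  smooth : ContMDiff 𝓘(ℝ, ℝ) (𝓡 N) ∞ (fun x : ℝ => toFun (x : UnitAddCircle))

instance (N : ℕ) (M : Type*) [TopologicalSpace M] [ChartedSpace (Coord N) M] :
    CoeFun (Loop N M) (fun _ => UnitAddCircle → M) := ⟨Loop.toFun⟩

/-- Fields that assign to every loop `γ` a covector field along `γ`. -/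
abbrev CovectorField (N : ℕ) (M : Type*) [TopologicalSpace M] [ChartedSpace (Coord N) M] :
    Type _ :=
  ∀ (γ : Loop N M) (x : UnitAddCircle), Cotan N (γ x)

/-- Matrix operators `P^{ij}(u, u_x)`: `P p v α` is the vector `P^{ij}(p, v) α_j`. -/
abbrev MatrixOperator (N : ℕ) (M : Type*) [TopologicalSpace M] [ChartedSpace (Coord N) M] :
    Type _ :=
  ∀ p : M, Tan N p → (Cotan N p →ₗ[ℝ] Tan N p)

variable {N : ℕ} {M : Type*} [TopologicalSpace M] [ChartedSpace (Coord N) M]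

/-- The velocity `u_x` of a loop. -/
def Loop.velocity (γ : Loop N M) (x : ℝ) : Tan N (γ x) :=
  mfderiv 𝓘(ℝ, ℝ) (𝓡 N) (fun y : ℝ => γ (y : UnitAddCircle)) x (1 : ℝ)

/-- `Γ` is, over the open set `W` of parameters, a smooth finite-dimensional family of loops that
belong to `V`. The values of `Γ` outside `W` play no role. -/
structure IsSmoothFamily (V : Set (Loop N M)) {k : ℕ} (W : Set (Fin k → ℝ))
    (Γ : (Fin k → ℝ) → Loop N M) : Prop where
  isOpen : IsOpen W
  mem : ∀ t ∈ W, Γ t ∈ V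
  smooth : ContMDiffOn 𝓘(ℝ, (Fin k → ℝ) × ℝ) (𝓡 N) ∞
    (fun q : (Fin k → ℝ) × ℝ => Γ q.1 (q.2 : UnitAddCircle)) (W ×ˢ Set.univ)

/-- Open subsets of the loop space, for the final topology of all smooth finite-dimensional
families of loops. -/
def IsLoopOpen (V : Set (Loop N M)) : Prop :=
  ∀ (k : ℕ) (W : Set (Fin k → ℝ)) (Γ : (Fin k → ℝ) → Loop N M),
    IsSmoothFamily Set.univ W Γ → IsOpen {t ∈ W | Γ t ∈ V}

/-- The functional `F` is smooth on `V` with variational derivative `f = δF / δu`: along every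
smooth family `Γ` of loops in `V` the components of `f` in local coordinates are smooth in the
parameter and `x`, and `dF = ∫ f_i δu^i dx`. -/
structure HasVariationalDeriv (V : Set (Loop N M)) (F : Loop N M → ℝ) (f : CovectorField N M) :
    Prop where
  smooth : ∀ (k : ℕ) (W : Set (Fin k → ℝ)) (Γ : (Fin k → ℝ) → Loop N M), IsSmoothFamily V W Γ →
    ∀ (c : M) (w : Coord N), ContDiffOn ℝ ∞
      (fun q : (Fin k → ℝ) × ℝ => f (Γ q.1) q.2 (frame c (Γ q.1 q.2) w))
      {q | q.1 ∈ W ∧ Γ q.1 q.2 ∈ (chartAt (Coord N) c).source}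
  deriv : ∀ (k : ℕ) (W : Set (Fin k → ℝ)) (Γ : (Fin k → ℝ) → Loop N M), IsSmoothFamily V W Γ →
    ∀ t ∈ W, ∀ s : Fin k → ℝ,
      HasDerivAt (fun τ : ℝ => F (Γ (t + τ • s)))
        (∫ x in (0 : ℝ)..1,
          f (Γ t) x (mfderiv 𝓘(ℝ, Fin k → ℝ) (𝓡 N) (fun t' => Γ t' (x : UnitAddCircle)) t s)) 0

/-- The bracket `∫ f_i P^{ij}(u, u_x) g_j dx`; with `f = δI / δu` and `g = δJ / δu` it is the
bracket `{I, J}` of the functionals `I` and `J` defined by the matrix operator `P`. -/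
def bracket (P : MatrixOperator N M) (f g : CovectorField N M) (γ : Loop N M) : ℝ :=
  ∫ x in (0 : ℝ)..1, f γ x (P (γ x) (γ.velocity x) (g γ x))

/-- The matrix operator `P` is a Poisson structure on the subset `U` of the loop space: on the
smooth functionals with a variational derivative on any open `V ⊆ U`, the bracket takes values in
such functionals, is skew-symmetric, and satisfies the Jacobi identity. -/
structure IsLoopPoisson (U : Set (Loop N M)) (P : MatrixOperator N M) : Prop where
  skew : ∀ V ⊆ U, IsLoopOpen V → ∀ (I J : Loop N M → ℝ) (dI dJ : CovectorField N M),
    HasVariationalDeriv V I dI → HasVariationalDeriv V J dJ →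
    ∀ γ ∈ V, bracket P dI dJ γ = -bracket P dJ dI γ
  closed : ∀ V ⊆ U, IsLoopOpen V → ∀ (I J : Loop N M → ℝ) (dI dJ : CovectorField N M),
    HasVariationalDeriv V I dI → HasVariationalDeriv V J dJ →
    ∃ dIJ : CovectorField N M, HasVariationalDeriv V (bracket P dI dJ) dIJ
  jacobi : ∀ V ⊆ U, IsLoopOpen V →
    ∀ (I J K : Loop N M → ℝ) (dI dJ dK dIJ dJK dKI : CovectorField N M),
    HasVariationalDeriv V I dI → HasVariationalDeriv V J dJ → HasVariationalDeriv V K dK →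
    HasVariationalDeriv V (bracket P dI dJ) dIJ →
    HasVariationalDeriv V (bracket P dJ dK) dJK →
    HasVariationalDeriv V (bracket P dK dI) dKI →
    ∀ γ ∈ V, bracket P dIJ dK γ + bracket P dJK dI γ + bracket P dKI dJ γ = 0

/-- The formal power series `∑ εⁿ Pₙ` of matrix operators is a Poisson structure on the loop space:
its bracket `{I, J} = ∑ εⁿ {I, J}ₙ` is skew-symmetric and satisfies the Jacobi identity in every
order of `ε`. -/
structure IsFormalLoopPoisson (P : ℕ → MatrixOperator N M) : Prop where
  skew : ∀ V, IsLoopOpen V → ∀ (I J : Loop N M → ℝ) (dI dJ : CovectorField N M),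
    HasVariationalDeriv V I dI → HasVariationalDeriv V J dJ →
    ∀ n, ∀ γ ∈ V, bracket (P n) dI dJ γ = -bracket (P n) dJ dI γ
  closed : ∀ V, IsLoopOpen V → ∀ (I J : Loop N M → ℝ) (dI dJ : CovectorField N M),
    HasVariationalDeriv V I dI → HasVariationalDeriv V J dJ →
    ∀ n, ∃ dIJ : CovectorField N M, HasVariationalDeriv V (bracket (P n) dI dJ) dIJ
  jacobi : ∀ V, IsLoopOpen V → ∀ (I J K : Loop N M → ℝ) (dI dJ dK : CovectorField N M)
    (dIJ dJK dKI : ℕ → CovectorField N M),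
    HasVariationalDeriv V I dI → HasVariationalDeriv V J dJ → HasVariationalDeriv V K dK →
    (∀ m, HasVariationalDeriv V (bracket (P m) dI dJ) (dIJ m)) →
    (∀ m, HasVariationalDeriv V (bracket (P m) dJ dK) (dJK m)) →
    (∀ m, HasVariationalDeriv V (bracket (P m) dK dI) (dKI m)) →
    ∀ n, ∀ γ ∈ V, ∑ m ∈ Finset.HasAntidiagonal.antidiagonal n,
      (bracket (P m.1) (dIJ m.2) dK γ + bracket (P m.1) (dJK m.2) dI γ
        + bracket (P m.1) (dKI m.2) dJ γ) = 0

/-- The formal series `∑ εⁿ Pₙ` is a graded `ε`-deformation of `ω`: it starts with `ω`, the entries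
of `Pₙ(u, u_x)` are homogeneous polynomials of degree `n` in `u_x` that depend smoothly on `u`, and
it is a Poisson structure. -/
structure IsGradedDeformation (ω₀ : TwoTensor N M) (P : ℕ → MatrixOperator N M) : Prop where
  zero : ∀ (p : M) (v : Tan N p), P 0 p v = ω₀ p
  homogeneous : ∀ (n : ℕ) (p : M) (α β : Cotan N p),
    ∃ L : MultilinearMap ℝ (fun _ : Fin n => Tan N p) ℝ, ∀ v, α (P n p v β) = L (fun _ => v)
  smooth : ∀ (n : ℕ) (c : M) (a : Module.Dual ℝ (Coord N)), ContDiffOn ℝ ∞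
    (fun q : Coord N × Coord N =>
      let p := (chartAt (Coord N) c).symm q.1
      coframe c p (P n p (frame c p q.2) (coordCovector c p a)))
    ((chartAt (Coord N) c).target ×ˢ Set.univ)
  poisson : IsFormalLoopPoisson P

end Loops

/-! ### The deformation of a Poisson structure by a 3-form -/

section Deformation

variable {N : ℕ} {M : Type*} [TopologicalSpace M] [ChartedSpace (Coord N) M]

/-- The matrix `T_{pjk} v^k`: it sends a vector `ξ` to the covector `T_{pjk} ξ^j v^k`. -/
def contract (T : ThreeForm N M) (p : M) (v : Tan N p) : Tan N p →ₗ[ℝ] Cotan N p :=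
  LinearMap.mk₂ ℝ (fun ξ η => T p ![η, ξ, v])
    (fun ξ ξ' η => by
      have h (z : Tan N p) : ![η, z, v] = Function.update ![η, 0, v] 1 z := by
        ext i; fin_cases i <;> rfl
      rw [h (ξ + ξ'), h ξ, h ξ', (T p).map_update_add])
    (fun r ξ η => by
      have h (z : Tan N p) : ![η, z, v] = Function.update ![η, 0, v] 1 z := by
        ext i; fin_cases i <;> rfl
      rw [h (r • ξ), h ξ, (T p).map_update_smul])
    (fun ξ η η' => by
      have h (z : Tan N p) : ![z, ξ, v] = Function.update ![0, ξ, v] 0 z := by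
        ext i; fin_cases i <;> rfl
      rw [h (η + η'), h η, h η', (T p).map_update_add])
    (fun r ξ η => by
      have h (z : Tan N p) : ![z, ξ, v] = Function.update ![0, ξ, v] 0 z := by
        ext i; fin_cases i <;> rfl
      rw [h (r • η), h η, (T p).map_update_smul])

/-- The matrix `M^s_j = δ^s_j + ε ω^{sp} T_{pjk} v^k`. -/
def deformationMatrix (ω₀ : TwoTensor N M) (T : ThreeForm N M) (ε : ℝ) (p : M) (v : Tan N p) :
    Module.End ℝ (Tan N p) :=
  1 + ε • (ω₀ p ∘ₗ contract T p v)

/-- The operator `A^{ij} = B^i_s ω^{sj}`, where `B` is the inverse of the matrix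
`δ^s_j + ε ω^{sp} T_{pjk} u^k_x` wherever the latter is invertible. -/
def deformedOperator (ω₀ : TwoTensor N M) (T : ThreeForm N M) (ε : ℝ) : MatrixOperator N M :=
  fun p v => Ring.inverse (deformationMatrix ω₀ T ε p v) ∘ₗ ω₀ p

/-- The loops on which the operator `A` is defined: the matrix `δ^s_j + ε ω^{sp} T_{pjk} u^k_x` is
invertible at every point of the loop. -/
def deformationDomain (ω₀ : TwoTensor N M) (T : ThreeForm N M) (ε : ℝ) : Set (Loop N M) :=
  {γ | ∀ x : ℝ, IsUnit (deformationMatrix ω₀ T ε (γ x) (γ.velocity x))}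

end Deformation

end

end LoopPoisson

/-!
The variational derivative of `{I, J}` comes from extending a family of loops by extra parameters
whose derivatives are the vector fields `A δI/δu` and `A δJ/δu`. Along the extended family the
second variations of `I` and `J` are symmetric, and integrating the derivative with respect to
`u_x` by parts over the circle leaves a term linear in the variation of the loop alone.

For the Jacobi identity at a loop `γ`, choose a family through `γ` whose parameter derivatives at
`γ` are the three vector fields `X_j = A f_j`, where the `f_j` are the variational derivatives of
the functionals. Then `{{I, J}, K}` is the derivative of `{I, J}` along `X_K`, the second variations
cancel in the cyclic sum, and what remains is the cyclic sum of `∫ f_j (DA[X_{j+2}] f_{j+1}) dx`.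
As `X_j` solves `X_j + ε ω T(·, X_j, u_x) = ω f_j`, that is `X_j = ω (f_j - ε T(·, X_j, u_x))`, the
integrand is, up to sign, the Jacobi expression of `ω` on the covectors `f_j - ε T(·, X_j, u_x)`,
which vanishes, plus `ε` times the cyclic sum of the derivatives of `T(·, ·, u_x)`. Because
`dT = 0`, the latter is the total derivative `∂_x T(X_0, X_1, X_2)`, whose integral over the circle
is zero. The coefficients `A_n = ω (-T ω)^n` satisfy the same identity order by order in `ε`.
-/

namespace LoopPoisson

noncomputable section

section Circle

theorem exists_mem_Icc_coe_eq (z : UnitAddCircle) :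
    ∃ x ∈ Set.Icc (0 : ℝ) 1, (x : UnitAddCircle) = z := by
  have hz : z ∈ ((↑) : ℝ → UnitAddCircle) '' Set.Icc 0 (0 + 1) := by
    rw [AddCircle.coe_image_Icc_eq]; trivial
  simpa using hz

theorem exists_open_tube {X : Type*} [TopologicalSpace X] {G : Set (X × ℝ)} (hG : IsOpen G)
    {K : Set UnitAddCircle} (hK : IsClosed K) {a : X}
    (h : ∀ x : ℝ, (x : UnitAddCircle) ∈ K → (a, x) ∈ G) :
    ∃ u : Set X, IsOpen u ∧ a ∈ u ∧
      ∀ e ∈ u, ∀ z ∈ K, ∃ x : ℝ, (x : UnitAddCircle) = z ∧ (e, x) ∈ G := by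
  have hcompact : IsCompact (Set.Icc (0 : ℝ) 1 ∩ (fun x : ℝ => (x : UnitAddCircle)) ⁻¹' K) :=
    isCompact_Icc.inter_right (hK.preimage (AddCircle.continuous_mk' 1))
  obtain ⟨u, v, hu, -, hau, hv, huv⟩ := generalized_tube_lemma isCompact_singleton hcompact hG
    (by rintro ⟨e, x⟩ ⟨rfl, hx⟩; exact h x hx.2)
  refine ⟨u, hu, hau rfl, fun e he z hz => ?_⟩
  obtain ⟨x, hx, rfl⟩ := exists_mem_Icc_coe_eq z
  exact ⟨x, rfl, huv ⟨he, hv ⟨hx, hz⟩⟩⟩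

theorem contDiff_toCircle : ContDiff ℝ ∞
    (fun x : ℝ => (AddCircle.toCircle (x : UnitAddCircle) : ℂ)) := by
  simp only [AddCircle.toCircle_apply_mk, Circle.coe_exp]
  exact Complex.contDiff_exp.comp
    ((Complex.ofRealCLM.contDiff.comp (contDiff_const.mul contDiff_id)).mul contDiff_const)

theorem isEmbedding_toCircle :
    IsEmbedding (fun z : UnitAddCircle => (AddCircle.toCircle z : ℂ)) := by
  refine Topology.IsEmbedding.subtypeVal.comp ?_
  rw [show AddCircle.toCircle (T := (1 : ℝ)) = AddCircle.homeomorphCircle one_ne_zero from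
    funext fun z => (AddCircle.homeomorphCircle_apply one_ne_zero z).symm]
  exact (AddCircle.homeomorphCircle one_ne_zero).isEmbedding

theorem exists_smooth_partition_circle {ι : Type*} (U : ι → Set UnitAddCircle)
    (hU : ∀ i, IsOpen (U i)) (hcover : ⋃ i, U i = Set.univ) :
    ∃ (s : Finset ι) (χ : ι → UnitAddCircle → ℝ),
      (∀ i, ContDiff ℝ ∞ fun x : ℝ => χ i (x : UnitAddCircle)) ∧ (∀ i, tsupport (χ i) ⊆ U i) ∧
      (∀ i z, 0 ≤ χ i z) ∧ ∀ z, ∑ i ∈ s, χ i z = 1 := by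
  set j : UnitAddCircle → ℂ := fun z => (AddCircle.toCircle z : ℂ)
  have hj : Continuous j := isEmbedding_toCircle.continuous
  choose O hO hOU using fun i => isEmbedding_toCircle.isInducing.isOpen_iff.mp (hU i)
  have hrange : IsCompact (Set.range j) := isCompact_range hj
  obtain ⟨ρ, hρ⟩ := SmoothPartitionOfUnity.exists_isSubordinate 𝓘(ℝ, ℂ) hrange.isClosed O hO (by
    rintro _ ⟨z, rfl⟩
    obtain ⟨i, hi⟩ := Set.mem_iUnion.mp (hcover.symm ▸ Set.mem_univ z)
    rw [← hOU i] at hi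
    exact Set.mem_iUnion.mpr ⟨i, hi⟩)
  have hfinite := ρ.locallyFinite.finite_nonempty_inter_compact hrange
  refine ⟨hfinite.toFinset, fun i z => ρ i (j z), fun i => ?_, fun i => ?_, fun i z => ?_,
    fun z => ?_⟩
  · exact (contMDiff_iff_contDiff.mp (ρ i).contMDiff).comp contDiff_toCircle
  · refine (tsupport_comp_subset_preimage (ρ i) hj).trans ?_
    rw [← hOU i]
    exact Set.preimage_mono (hρ i)
  · exact ρ.nonneg i (j z)
  · rw [← ρ.sum_eq_one ⟨z, rfl⟩, finsum_eq_sum_of_support_subset]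
    intro i hi
    exact hfinite.mem_toFinset.mpr ⟨j z, hi, z, rfl⟩

theorem exists_smooth_bump_circle {U : Set UnitAddCircle} (hU : IsOpen U) {z₀ : UnitAddCircle}
    (hz₀ : z₀ ∈ U) :
    ∃ χ : UnitAddCircle → ℝ, ContDiff ℝ ∞ (fun x : ℝ => χ (x : UnitAddCircle)) ∧
      tsupport χ ⊆ U ∧ (∀ z, 0 ≤ χ z) ∧ χ z₀ ≠ 0 := by
  obtain ⟨s, χ, hχ, hsupp, hnonneg, hsum⟩ := exists_smooth_partition_circle
    (fun i : Bool => cond i U {z₀}ᶜ) (by rintro (_ | _); exacts [isOpen_compl_singleton, hU])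
    (by
      refine Set.eq_univ_of_forall fun z => Set.mem_iUnion.mpr ?_
      by_cases hz : z = z₀
      exacts [⟨true, hz ▸ hz₀⟩, ⟨false, hz⟩])
  refine ⟨χ true, hχ true, hsupp true, hnonneg true, fun h => ?_⟩
  have hfalse : χ false z₀ = 0 := image_eq_zero_of_notMem_tsupport fun hz => hsupp false hz rfl
  have hzero : ∑ i ∈ s, χ i z₀ = 0 := Finset.sum_eq_zero fun i _ => by cases i <;> assumption
  exact zero_ne_one (hzero.symm.trans (hsum z₀))

theorem contDiffAt_of_mem_tsupport_circle {E F : Type*} [NormedAddCommGroup E] [NormedSpace ℝ E]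
    [NormedAddCommGroup F] [NormedSpace ℝ F] {χ : UnitAddCircle → ℝ}
    (hχ : ContDiff ℝ ∞ fun x : ℝ => χ (x : UnitAddCircle)) {k : E × ℝ → F} {q : E × ℝ}
    (hk : (q.2 : UnitAddCircle) ∈ tsupport χ → ContDiffAt ℝ ∞ k q) :
    ContDiffAt ℝ ∞ (fun q : E × ℝ => χ (q.2 : UnitAddCircle) • k q) q := by
  by_cases hq : (q.2 : UnitAddCircle) ∈ tsupport χ
  · exact (hχ.contDiffAt.comp q contDiffAt_snd).smul (hk hq)
  · refine contDiffAt_const (c := (0 : F)) |>.congr_of_eventuallyEq ?_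
    have hcoe : Continuous fun q : E × ℝ => (q.2 : UnitAddCircle) :=
      (AddCircle.continuous_mk' 1).comp continuous_snd
    filter_upwards [((isClosed_tsupport χ).isOpen_compl.preimage hcoe).mem_nhds hq] with q' hq'
    rw [image_eq_zero_of_notMem_tsupport hq', zero_smul]

end Circle

section Charts

variable {N : ℕ} {M : Type*} [TopologicalSpace M] [ChartedSpace (Coord N) M]
  [IsManifold (𝓡 N) ∞ M]

theorem exists_coframe_equiv {c p : M} (hp : p ∈ (chartAt (Coord N) c).source) :
    ∃ e : Tan N p ≃L[ℝ] Coord N, coframe (N := N) c p = e ∧ frame (N := N) c p = e.symm := by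
  have : IsManifold (𝓡 N) 1 M := .of_le (n := ∞) (by simp)
  refine ⟨(mdifferentiable_chart (I := 𝓡 N) c).mfderiv hp, rfl, ?_⟩
  exact ContinuousLinearMap.inverse_equiv ((mdifferentiable_chart (I := 𝓡 N) c).mfderiv hp)

theorem coframe_frame {c p : M} (hp : p ∈ (chartAt (Coord N) c).source) (w : Coord N) :
    coframe c p (frame c p w) = w := by
  obtain ⟨e, h, h'⟩ := exists_coframe_equiv (N := N) hp
  rw [h, h']; exact e.apply_symm_apply w

theorem frame_coframe {c p : M} (hp : p ∈ (chartAt (Coord N) c).source) (v : Tan N p) :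
    frame c p (coframe c p v) = v := by
  obtain ⟨e, h, h'⟩ := exists_coframe_equiv (N := N) hp
  rw [h, h']; exact e.symm_apply_apply v

theorem coframe_injective {c p : M} (hp : p ∈ (chartAt (Coord N) c).source) {v w : Tan N p}
    (h : coframe c p v = coframe c p w) : v = w := by
  rw [← frame_coframe hp v, h, frame_coframe hp w]

theorem coframe_mfderiv {F : Type*} [NormedAddCommGroup F] [NormedSpace ℝ F] {u : F → M} {e : F}
    (c : M) (hu : MDifferentiableAt 𝓘(ℝ, F) (𝓡 N) u e) (he : u e ∈ (chartAt (Coord N) c).source)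
    (v : F) :
    coframe c (u e) (mfderiv 𝓘(ℝ, F) (𝓡 N) u e v)
      = fderiv ℝ (fun z => chartAt (Coord N) c (u z)) e v := by
  have : IsManifold (𝓡 N) 1 M := .of_le (n := ∞) (by simp)
  have hc : MDifferentiableAt (𝓡 N) 𝓘(ℝ, Coord N) (chartAt (Coord N) c) (u e) :=
    mdifferentiableAt_atlas (chart_mem_atlas _ c) he
  have hchain := mfderiv_comp e hc hu
  rw [mfderiv_eq_fderiv] at hchain
  exact (DFunLike.congr_fun hchain v).symm

end Charts

section Families

variable {N : ℕ} {M : Type*} [TopologicalSpace M] [ChartedSpace (Coord N) M]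
variable {E : Type*} [NormedAddCommGroup E] [NormedSpace ℝ E]

/-- `Θ` is a smooth family of loops over the open set `W` of parameters; as opposed to
`IsSmoothFamily`, the parameters may lie in any normed space, and the loops are not constrained. -/
structure IsFamily (W : Set E) (Θ : E → Loop N M) : Prop where
  isOpen : IsOpen W
  smooth : ContMDiffOn 𝓘(ℝ, E × ℝ) (𝓡 N) ∞
    (fun q : E × ℝ => Θ q.1 (q.2 : UnitAddCircle)) (W ×ˢ Set.univ)

/-- The parameters `(e, x)` at which a family of loops takes values in the chart around `c`. -/
def chartDom (W : Set E) (Θ : E → Loop N M) (c : M) : Set (E × ℝ) :=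
  {q | q.1 ∈ W ∧ Θ q.1 (q.2 : UnitAddCircle) ∈ (chartAt (Coord N) c).source}

/-- A family of loops in the coordinates of the chart around `c`. -/
def inCoord (Θ : E → Loop N M) (c : M) (q : E × ℝ) : Coord N :=
  chartAt (Coord N) c (Θ q.1 (q.2 : UnitAddCircle))

theorem IsFamily.isOpen_prod {W : Set E} {Θ : E → Loop N M} (h : IsFamily W Θ) :
    IsOpen (W ×ˢ (Set.univ : Set ℝ)) := h.isOpen.prod isOpen_univ

theorem IsFamily.isOpen_chartDom {W : Set E} {Θ : E → Loop N M} (h : IsFamily W Θ) (c : M) :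
    IsOpen (chartDom W Θ c) := by
  convert h.smooth.continuousOn.isOpen_inter_preimage h.isOpen_prod
    (chartAt (Coord N) c).open_source using 1
  ext q; simp [chartDom]

theorem IsFamily.contMDiffAt {W : Set E} {Θ : E → Loop N M} (h : IsFamily W Θ) {q : E × ℝ}
    (hq : q.1 ∈ W) : ContMDiffAt 𝓘(ℝ, E × ℝ) (𝓡 N) ∞
      (fun q : E × ℝ => Θ q.1 (q.2 : UnitAddCircle)) q :=
  h.smooth.contMDiffAt (h.isOpen_prod.mem_nhds ⟨hq, trivial⟩)

theorem IsFamily.mdifferentiableAt_apply {W : Set E} {Θ : E → Loop N M} (h : IsFamily W Θ) {e : E}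
    (he : e ∈ W) (x : ℝ) :
    MDifferentiableAt 𝓘(ℝ, E) (𝓡 N) (fun e => Θ e (x : UnitAddCircle)) e := by
  have hslice : ContMDiffAt 𝓘(ℝ, E) 𝓘(ℝ, E × ℝ) ∞ (fun e : E => (e, x)) e := by
    rw [contMDiffAt_iff_contDiffAt]
    fun_prop
  exact (ContMDiffAt.comp (x := e) (g := fun q : E × ℝ => Θ q.1 (q.2 : UnitAddCircle))
    (f := fun e : E => (e, x)) (h.contMDiffAt he) hslice).mdifferentiableAt (by simp)

theorem IsFamily.mono {W W' : Set E} {Θ : E → Loop N M} (h : IsFamily W Θ) (hW : IsOpen W')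
    (hs : W' ⊆ W) : IsFamily W' Θ :=
  ⟨hW, h.smooth.mono (Set.prod_mono hs subset_rfl)⟩

theorem IsFamily.comp {F : Type*} [NormedAddCommGroup F] [NormedSpace ℝ F]
    {W : Set E} {Θ : E → Loop N M} (h : IsFamily W Θ) {W' : Set F} (hW : IsOpen W') {L : F → E}
    (hL : ContDiff ℝ ∞ L) (hs : Set.MapsTo L W' W) : IsFamily W' (Θ ∘ L) := by
  refine ⟨hW, ?_⟩
  have hreparam : ContMDiff 𝓘(ℝ, F × ℝ) 𝓘(ℝ, E × ℝ) ∞ (fun q : F × ℝ => (L q.1, q.2)) := by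
    rw [contMDiff_iff_contDiff]
    fun_prop
  exact h.smooth.comp hreparam.contMDiffOn (fun q hq => ⟨hs hq.1, trivial⟩)

theorem isFamily_const (γ : Loop N M) : IsFamily (Set.univ : Set E) (fun _ => γ) := by
  refine ⟨isOpen_univ, ?_⟩
  have hsnd : ContMDiff 𝓘(ℝ, E × ℝ) 𝓘(ℝ, ℝ) ∞ (fun q : E × ℝ => q.2) := by
    rw [contMDiff_iff_contDiff]
    fun_prop
  exact (γ.smooth.comp hsnd).contMDiffOn

theorem isSmoothFamily_iff {V : Set (Loop N M)} {k : ℕ} {W : Set (Fin k → ℝ)}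
    {Γ : (Fin k → ℝ) → Loop N M} : IsSmoothFamily V W Γ ↔ IsFamily W Γ ∧ ∀ t ∈ W, Γ t ∈ V :=
  ⟨fun h => ⟨⟨h.isOpen, h.smooth⟩, h.mem⟩, fun h => ⟨h.1.isOpen, h.2, h.1.smooth⟩⟩

variable [IsManifold (𝓡 N) ∞ M]

theorem IsFamily.contDiffAt_inCoord {W : Set E} {Θ : E → Loop N M} (h : IsFamily W Θ) {c : M}
    {q : E × ℝ} (hq : q ∈ chartDom W Θ c) : ContDiffAt ℝ ∞ (inCoord Θ c) q := by
  rw [← contMDiffAt_iff_contDiffAt]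
  exact (contMDiffOn_chart.contMDiffAt
    ((chartAt (Coord N) c).open_source.mem_nhds hq.2)).comp q (h.contMDiffAt hq.1)

theorem IsFamily.coframe_velocity {W : Set E} {Θ : E → Loop N M} (h : IsFamily W Θ) {c : M}
    {q : E × ℝ} (hq : q ∈ chartDom W Θ c) :
    coframe c (Θ q.1 (q.2 : UnitAddCircle)) ((Θ q.1).velocity q.2)
      = fderiv ℝ (inCoord Θ c) q (0, 1) := by
  rw [Loop.velocity, coframe_mfderiv c ((Θ q.1).smooth.mdifferentiable (by simp) q.2) hq.2]
  have hcoord := ((h.contDiffAt_inCoord hq).differentiableAt (by simp)).hasFDerivAt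
  have hslice : HasFDerivAt (fun y : ℝ => (q.1, y)) (ContinuousLinearMap.inr ℝ E ℝ) q.2 :=
    hasFDerivAt_prodMk_right q.1 q.2
  exact congrArg (fun L : ℝ →L[ℝ] Coord N => L 1) (hcoord.comp q.2 hslice).fderiv

theorem IsFamily.coframe_mfderiv_param {W : Set E} {Θ : E → Loop N M} (h : IsFamily W Θ) {c : M}
    {q : E × ℝ} (hq : q ∈ chartDom W Θ c) (v : E) :
    coframe c (Θ q.1 (q.2 : UnitAddCircle))
        (mfderiv 𝓘(ℝ, E) (𝓡 N) (fun e => Θ e (q.2 : UnitAddCircle)) q.1 v)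
      = fderiv ℝ (inCoord Θ c) q (v, 0) := by
  rw [coframe_mfderiv (u := fun e => Θ e (q.2 : UnitAddCircle)) c
    (h.mdifferentiableAt_apply hq.1 q.2) hq.2]
  have hcoord := ((h.contDiffAt_inCoord hq).differentiableAt (by simp)).hasFDerivAt
  have hslice : HasFDerivAt (fun y : E => (y, q.2)) (ContinuousLinearMap.inl ℝ E ℝ) q.1 :=
    hasFDerivAt_prodMk_left q.1 q.2
  exact congrArg (fun L : E →L[ℝ] Coord N => L v) (hcoord.comp q.1 hslice).fderiv

end Families

section Velocity

variable {N : ℕ} {M : Type*} [TopologicalSpace M] [ChartedSpace (Coord N) M]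

/-- The velocity as a field over the circle, read off from a choice of a lift to `ℝ`, on which it
does not depend. -/
def Loop.vel (γ : Loop N M) (z : UnitAddCircle) : Tan N (γ z) :=
  (γ.velocity (Function.surjInv QuotientAddGroup.mk_surjective z) : Coord N)

theorem Loop.velocity_eq_fderiv (γ : Loop N M) (x : ℝ) :
    (γ.velocity x : Coord N) = fderiv ℝ
      (fun y : ℝ => extChartAt (𝓡 N) (γ (x : UnitAddCircle)) (γ (y : UnitAddCircle))) x 1 := by
  have h : MDifferentiableAt 𝓘(ℝ, ℝ) (𝓡 N) (fun y : ℝ => γ (y : UnitAddCircle)) x :=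
    γ.smooth.mdifferentiable (by simp) x
  refine (congrArg (fun L : ℝ →L[ℝ] Coord N => L 1) h.mfderiv).trans ?_
  simp only [writtenInExtChartAt, mfld_simps, fderivWithin_univ]
  rfl

theorem Loop.velocity_eq_of_coe_eq (γ : Loop N M) {x y : ℝ}
    (h : (x : UnitAddCircle) = (y : UnitAddCircle)) :
    (γ.velocity x : Coord N) = (γ.velocity y : Coord N) := by
  rw [γ.velocity_eq_fderiv x, γ.velocity_eq_fderiv y, h]
  have hx : x = y + (x - y) := by ring
  have hp (z : ℝ) : ((z + (x - y) : ℝ) : UnitAddCircle) = (z : UnitAddCircle) := by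
    rw [AddCircle.coe_add, AddCircle.coe_sub, h, sub_self, add_zero]
  conv_lhs => rw [hx]
  rw [← fderiv_comp_add_right]
  simp only [hp]
  rfl

theorem Loop.vel_coe (γ : Loop N M) (x : ℝ) : γ.vel (x : UnitAddCircle) = γ.velocity x :=
  γ.velocity_eq_of_coe_eq
    (Function.surjInv_eq QuotientAddGroup.mk_surjective (x : UnitAddCircle))

end Velocity

section ChartShifts

variable {N : ℕ} {M : Type*} [TopologicalSpace M] [ChartedSpace (Coord N) M]
variable {E : Type*}

theorem Loop.ext {γ γ' : Loop N M} (h : ∀ z, γ z = γ' z) : γ = γ' := by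
  cases γ; cases γ'
  congr
  exact funext h

theorem Loop.continuous (γ : Loop N M) : Continuous γ.toFun :=
  (QuotientAddGroup.isOpenQuotientMap_mk
    (N := AddSubgroup.zmultiples (1 : ℝ))).isQuotientMap.continuous_iff.mpr γ.smooth.continuous

/-- The loop `γ'` arises from `γ` by adding `b` to the coordinates in the chart around `c` over the
subset `K` of the circle, and agrees with `γ` elsewhere. -/
structure IsChartShift (c : M) (K : Set UnitAddCircle) (b : UnitAddCircle → Coord N)
    (γ γ' : Loop N M) : Prop where
  eq_of_notMem : ∀ z ∉ K, γ' z = γ z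
  mem_source : ∀ z ∈ K, γ z ∈ (chartAt (Coord N) c).source
  shifted_mem_source : ∀ z ∈ K, γ' z ∈ (chartAt (Coord N) c).source
  chart_eq : ∀ z ∈ K, chartAt (Coord N) c (γ' z) = chartAt (Coord N) c (γ z) + b z

theorem IsChartShift.unique {c : M} {K : Set UnitAddCircle} {b : UnitAddCircle → Coord N}
    {γ γ₁ γ₂ : Loop N M} (h₁ : IsChartShift c K b γ γ₁) (h₂ : IsChartShift c K b γ γ₂) :
    γ₁ = γ₂ := by
  refine Loop.ext fun z => ?_
  by_cases hz : z ∈ K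
  · exact (chartAt (Coord N) c).injOn (h₁.shifted_mem_source z hz) (h₂.shifted_mem_source z hz)
      ((h₁.chart_eq z hz).trans (h₂.chart_eq z hz).symm)
  · rw [h₁.eq_of_notMem z hz, h₂.eq_of_notMem z hz]

open Classical in
/-- The pointwise prescription that adds `B` over `K` to a family of loops, in the coordinates of
the chart around `c`. -/
def shiftMap (c : M) (K : Set UnitAddCircle) (B : E → UnitAddCircle → Coord N)
    (Γ : E → Loop N M) (e : E) (z : UnitAddCircle) : M :=
  if z ∈ K then (chartAt (Coord N) c).symm (chartAt (Coord N) c (Γ e z) + B e z) else Γ e z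

theorem shiftMap_of_mem {c : M} {K : Set UnitAddCircle} {B : E → UnitAddCircle → Coord N}
    {Γ : E → Loop N M} {e : E} {z : UnitAddCircle} (hz : z ∈ K) :
    shiftMap c K B Γ e z =
      (chartAt (Coord N) c).symm (chartAt (Coord N) c (Γ e z) + B e z) := if_pos hz

theorem shiftMap_of_notMem {c : M} {K : Set UnitAddCircle} {B : E → UnitAddCircle → Coord N}
    {Γ : E → Loop N M} {e : E} {z : UnitAddCircle} (hz : z ∉ K) :
    shiftMap c K B Γ e z = Γ e z := if_neg hz

theorem shiftMap_eq_of_eq_zero {c : M} {K : Set UnitAddCircle} {B : E → UnitAddCircle → Coord N}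
    {Γ : E → Loop N M} {e : E} {z : UnitAddCircle}
    (hz : z ∈ K → Γ e z ∈ (chartAt (Coord N) c).source) (hB : B e z = 0) :
    shiftMap c K B Γ e z = Γ e z := by
  by_cases hK : z ∈ K
  · rw [shiftMap_of_mem hK, hB, add_zero, (chartAt (Coord N) c).left_inv (hz hK)]
  · exact shiftMap_of_notMem hK

variable [NormedAddCommGroup E] [NormedSpace ℝ E]

open Classical in
theorem exists_isFamily_of_contMDiffOn {W : Set E} (hW : IsOpen W) {F : E → UnitAddCircle → M}
    (hF : ContMDiffOn 𝓘(ℝ, E × ℝ) (𝓡 N) ∞ (fun q : E × ℝ => F q.1 (q.2 : UnitAddCircle))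
      (W ×ˢ Set.univ)) (Γ : E → Loop N M) :
    ∃ Θ : E → Loop N M, IsFamily W Θ ∧ (∀ e ∈ W, ∀ z, Θ e z = F e z) ∧ ∀ e ∉ W, Θ e = Γ e := by
  have hloop : ∀ e ∈ W, ContMDiff 𝓘(ℝ, ℝ) (𝓡 N) ∞ (fun x : ℝ => F e (x : UnitAddCircle)) := by
    intro e he
    have hslice : ContMDiff 𝓘(ℝ, ℝ) 𝓘(ℝ, E × ℝ) ∞ (fun x : ℝ => (e, x)) := by
      rw [contMDiff_iff_contDiff]
      fun_prop
    rw [← contMDiffOn_univ] at hslice ⊢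
    exact hF.comp hslice fun x _ => ⟨he, trivial⟩
  let Θ : E → Loop N M := fun e => if he : e ∈ W then ⟨F e, hloop e he⟩ else Γ e
  have hΘ : ∀ e ∈ W, ∀ z, Θ e z = F e z := fun e he z => by simp only [Θ, dif_pos he]
  exact ⟨Θ, ⟨hW, hF.congr fun q hq => hΘ q.1 hq.1 _⟩, hΘ, fun e he => dif_neg he⟩

variable [IsManifold (𝓡 N) ∞ M]

theorem IsFamily.contMDiffAt_shiftMap {W : Set E} {Γ : E → Loop N M} (h : IsFamily W Γ) {c : M}
    {K : Set UnitAddCircle} (hK : IsClosed K) {B : E → UnitAddCircle → Coord N}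
    (hB : ContDiffOn ℝ ∞ (fun q : E × ℝ => B q.1 (q.2 : UnitAddCircle)) (W ×ˢ Set.univ))
    (hBK : ∀ e ∈ W, ∀ z ∉ K, B e z = 0) {e : E} (he : e ∈ W) {x : ℝ}
    (hx : (x : UnitAddCircle) ∈ K → Γ e x ∈ (chartAt (Coord N) c).source ∧
      chartAt (Coord N) c (Γ e x) + B e x ∈ (chartAt (Coord N) c).target) :
    ContMDiffAt 𝓘(ℝ, E × ℝ) (𝓡 N) ∞
      (fun q : E × ℝ => shiftMap c K B Γ q.1 (q.2 : UnitAddCircle)) (e, x) := by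
  by_cases hxK : (x : UnitAddCircle) ∈ K
  · obtain ⟨hsource, htarget⟩ := hx hxK
    have hcoord : ContDiffAt ℝ ∞
        (fun q : E × ℝ => inCoord Γ c q + B q.1 (q.2 : UnitAddCircle)) (e, x) :=
      (h.contDiffAt_inCoord ⟨he, hsource⟩).add
        (hB.contDiffAt (h.isOpen_prod.mem_nhds ⟨he, trivial⟩))
    rw [← contMDiffAt_iff_contDiffAt] at hcoord
    have hsymm : ContMDiffAt 𝓘(ℝ, Coord N) (𝓡 N) ∞ (chartAt (Coord N) c).symm
        (inCoord Γ c (e, x) + B e (x : UnitAddCircle)) :=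
      contMDiffOn_chart_symm.contMDiffAt
        ((chartAt (Coord N) c).open_target.mem_nhds htarget)
    refine (hsymm.comp (e, x) hcoord).congr_of_eventuallyEq ?_
    filter_upwards [(h.isOpen_chartDom c).mem_nhds (⟨he, hsource⟩ : (e, x) ∈ chartDom W Γ c)]
      with q hq
    by_cases hqK : (q.2 : UnitAddCircle) ∈ K
    · exact shiftMap_of_mem hqK
    · simp only [shiftMap_of_notMem hqK, Function.comp, hBK q.1 hq.1 _ hqK, add_zero, inCoord]
      exact ((chartAt (Coord N) c).left_inv hq.2).symm
  · refine (h.contMDiffAt (q := (e, x)) he).congr_of_eventuallyEq ?_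
    have hcoe : Continuous fun q : E × ℝ => (q.2 : UnitAddCircle) :=
      (AddCircle.continuous_mk' 1).comp continuous_snd
    filter_upwards [(hK.isOpen_compl.preimage hcoe).mem_nhds hxK] with q hq
    exact shiftMap_of_notMem hq

theorem IsFamily.exists_open_shift_mem_target {W : Set E} {Γ : E → Loop N M} (h : IsFamily W Γ)
    {e₀ : E} (he₀ : e₀ ∈ W) (c : M) {K : Set UnitAddCircle} (hK : IsClosed K)
    (hKc : ∀ z ∈ K, Γ e₀ z ∈ (chartAt (Coord N) c).source) {B : E → UnitAddCircle → Coord N}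
    (hB : ContDiffOn ℝ ∞ (fun q : E × ℝ => B q.1 (q.2 : UnitAddCircle)) (W ×ˢ Set.univ))
    (hB₀ : B e₀ = 0) :
    ∃ u : Set E, IsOpen u ∧ e₀ ∈ u ∧ ∀ e ∈ u, ∀ z ∈ K, Γ e z ∈ (chartAt (Coord N) c).source ∧
      chartAt (Coord N) c (Γ e z) + B e z ∈ (chartAt (Coord N) c).target := by
  have hcoord : ContinuousOn (fun q : E × ℝ => inCoord Γ c q + B q.1 (q.2 : UnitAddCircle))
      (chartDom W Γ c) := by
    refine ContinuousOn.add (fun q hq => ?_) (hB.continuousOn.mono fun q hq => ⟨hq.1, trivial⟩)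
    exact (h.contDiffAt_inCoord hq).continuousAt.continuousWithinAt
  obtain ⟨u, hu, heu, hmem⟩ := exists_open_tube (hcoord.isOpen_inter_preimage
    (h.isOpen_chartDom c) (chartAt (Coord N) c).open_target) hK (a := e₀) (fun x hx => by
      refine ⟨⟨he₀, hKc _ hx⟩, ?_⟩
      simp only [Set.mem_preimage, hB₀, Pi.zero_apply, add_zero]
      exact (chartAt (Coord N) c).map_source (hKc _ hx))
  refine ⟨u, hu, heu, fun e he z hz => ?_⟩
  obtain ⟨x, rfl, hx⟩ := hmem e he z hz
  exact ⟨hx.1.2, hx.2⟩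

theorem IsFamily.exists_chartShift {W : Set E} {Γ : E → Loop N M} (h : IsFamily W Γ) {e₀ : E}
    (he₀ : e₀ ∈ W) (c : M) {K : Set UnitAddCircle} (hK : IsClosed K)
    (hKc : ∀ z ∈ K, Γ e₀ z ∈ (chartAt (Coord N) c).source) {B : E → UnitAddCircle → Coord N}
    (hB : ContDiffOn ℝ ∞ (fun q : E × ℝ => B q.1 (q.2 : UnitAddCircle)) (W ×ˢ Set.univ))
    (hB₀ : B e₀ = 0) (hBK : ∀ e ∈ W, ∀ z ∉ K, B e z = 0) :
    ∃ (W' : Set E) (Γ' : E → Loop N M), W' ⊆ W ∧ e₀ ∈ W' ∧ IsFamily W' Γ' ∧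
      (∀ e, B e = 0 → Γ' e = Γ e) ∧ ∀ e ∈ W', IsChartShift c K (B e) (Γ e) (Γ' e) := by
  obtain ⟨u, hu, heu, hmem⟩ := h.exists_open_shift_mem_target he₀ c hK hKc hB hB₀
  obtain ⟨Γ', hΓ', hshift, hoff⟩ := exists_isFamily_of_contMDiffOn (hu.inter h.isOpen)
    (F := shiftMap c K B Γ) (fun q hq => (h.contMDiffAt_shiftMap hK hB hBK hq.1.2
      (hmem q.1 hq.1.1 _)).contMDiffWithinAt) Γ
  refine ⟨u ∩ W, Γ', Set.inter_subset_right, ⟨heu, he₀⟩, hΓ', fun e hBe => ?_, fun e he => ?_⟩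
  · by_cases he : e ∈ u ∩ W
    · refine Loop.ext fun z => ?_
      rw [hshift e he, shiftMap_eq_of_eq_zero (fun hz => (hmem e he.1 z hz).1) (by rw [hBe]; rfl)]
    · exact hoff e he
  · have hval : ∀ z ∈ K, Γ' e z =
        (chartAt (Coord N) c).symm (chartAt (Coord N) c (Γ e z) + B e z) := fun z hz => by
      rw [hshift e he, shiftMap_of_mem hz]
    refine ⟨fun z hz => ?_, fun z hz => (hmem e he.1 z hz).1, fun z hz => ?_, fun z hz => ?_⟩
    · rw [hshift e he, shiftMap_of_notMem hz]
    · rw [hval z hz]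
      exact (chartAt (Coord N) c).map_target (hmem e he.1 z hz).2
    · rw [hval z hz]
      exact (chartAt (Coord N) c).right_inv (hmem e he.1 z hz).2

end ChartShifts

section Variations

variable {N : ℕ} {M : Type*} [TopologicalSpace M] [ChartedSpace (Coord N) M]
variable {E : Type*} [NormedAddCommGroup E] [NormedSpace ℝ E]

/-- The family of loops `Θ` passes through `γ` at `e`, and its derivative there in the direction `v`
is the vector field `X` along `γ`. The derivative is compared with `X` in every chart, so that the
tangent spaces at the points of `Θ e` and of `γ` need not be identified. -/
def HasVariation (Θ : E → Loop N M) (e v : E) (γ : Loop N M)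
    (X : ∀ z : UnitAddCircle, Tan N (γ z)) : Prop :=
  Θ e = γ ∧ ∀ (x : ℝ) (c : M), γ x ∈ (chartAt (Coord N) c).source →
    fderiv ℝ (inCoord Θ c) (e, x) (v, 0) = coframe c (γ x) (X x)

variable [IsManifold (𝓡 N) ∞ M]

theorem IsFamily.hasDerivAt_inCoord {W : Set E} {Θ : E → Loop N M} (h : IsFamily W Θ) {c : M}
    {e : E} {x : ℝ} (hq : (e, x) ∈ chartDom W Θ c) (v : E) :
    HasDerivAt (fun σ : ℝ => inCoord Θ c (e + σ • v, x))
      (fderiv ℝ (inCoord Θ c) (e, x) (v, 0)) 0 := by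
  have hfderiv := ((h.contDiffAt_inCoord hq).differentiableAt (by simp)).hasFDerivAt
  have hline : HasDerivAt (fun σ : ℝ => (e + σ • v, x)) ((1 : ℝ) • v, (0 : ℝ)) 0 :=
    HasDerivAt.prodMk (((hasDerivAt_id (0 : ℝ)).smul_const v).const_add e) (hasDerivAt_const 0 x)
  rw [one_smul] at hline
  exact HasFDerivAt.comp_hasDerivAt_of_eq (0 : ℝ) hfderiv hline (by simp)

theorem IsFamily.hasVariation_of_forall_exists {W : Set E} {Θ : E → Loop N M} (h : IsFamily W Θ)
    {e v : E} (he : e ∈ W) {γ : Loop N M} (hγ : Θ e = γ) {X : ∀ z : UnitAddCircle, Tan N (γ z)}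
    (hX : ∀ x : ℝ, ∃ c : M, γ x ∈ (chartAt (Coord N) c).source ∧
      fderiv ℝ (inCoord Θ c) (e, x) (v, 0) = coframe c (γ x) (X x)) :
    HasVariation Θ e v γ X := by
  subst hγ
  refine ⟨rfl, fun x c hc => ?_⟩
  obtain ⟨c', hc', hX'⟩ := hX x
  have hq' : (e, x) ∈ chartDom W Θ c' := ⟨he, hc'⟩
  have hq : (e, x) ∈ chartDom W Θ c := ⟨he, hc⟩
  rw [← h.coframe_mfderiv_param hq'] at hX'
  rw [← h.coframe_mfderiv_param hq, coframe_injective hc' hX']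

theorem IsFamily.hasVariation_of_const_line {W : Set E} {Θ : E → Loop N M} (h : IsFamily W Θ)
    {e v : E} (he : e ∈ W) (hv : ∀ σ : ℝ, Θ (e + σ • v) = Θ e) :
    HasVariation Θ e v (Θ e) fun _ => 0 := by
  refine ⟨rfl, fun x c hc => ?_⟩
  have hderiv := h.hasDerivAt_inCoord ⟨he, hc⟩ v
  simp only [inCoord, hv] at hderiv
  rw [map_zero]
  exact hderiv.unique (hasDerivAt_const _ _)

theorem HasVariation.chartShift {W W' : Set E} {Θ Θ' : E → Loop N M} (hΘ : IsFamily W Θ)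
    (hΘ' : IsFamily W' Θ') {c : M} {K : Set UnitAddCircle} {B : E → UnitAddCircle → Coord N}
    (hshift : ∀ e ∈ W', IsChartShift c K (B e) (Θ e) (Θ' e)) {e v : E} (he : e ∈ W)
    (he' : e ∈ W') {γ : Loop N M} {X Y : ∀ z : UnitAddCircle, Tan N (γ z)}
    (hX : HasVariation Θ e v γ X) (hγ : Θ' e = γ)
    (hB : ∀ x : ℝ, (x : UnitAddCircle) ∈ K →
      HasDerivAt (fun σ : ℝ => B (e + σ • v) x) (coframe c (γ x) (Y x)) 0)
    (hY : ∀ x : ℝ, (x : UnitAddCircle) ∉ K → Y x = 0) :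
    HasVariation Θ' e v γ fun z => X z + Y z := by
  have hline : ∀ᶠ σ : ℝ in 𝓝 0, e + σ • v ∈ W' := by
    have hcont : Continuous fun σ : ℝ => e + σ • v := by fun_prop
    exact hcont.continuousAt.eventually (hΘ'.isOpen.mem_nhds (by simpa using he'))
  have hΘe : Θ e = γ := hX.1
  refine hΘ'.hasVariation_of_forall_exists he' hγ fun x => ?_
  by_cases hx : (x : UnitAddCircle) ∈ K
  · have hsource := (hshift e he').mem_source x hx
    have hsource' := (hshift e he').shifted_mem_source x hx
    refine ⟨c, hγ ▸ hsource', ?_⟩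
    have hadd : HasDerivAt (fun σ : ℝ => inCoord Θ' c (e + σ • v, x)) _ 0 :=
      ((hΘ.hasDerivAt_inCoord ⟨he, hsource⟩ v).add (hB x hx)).congr_of_eventuallyEq
        (hline.mono fun σ hσ => (hshift _ hσ).chart_eq x hx)
    rw [(hΘ'.hasDerivAt_inCoord ⟨he', hsource'⟩ v).unique hadd, hX.2 x c (hΘe ▸ hsource),
      map_add]
  · have hsource : γ x ∈ (chartAt (Coord N) (γ x)).source := mem_chart_source _ _
    refine ⟨γ x, hsource, ?_⟩
    have hsame : HasDerivAt (fun σ : ℝ => inCoord Θ' (γ x) (e + σ • v, x)) _ 0 :=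
      (hΘ.hasDerivAt_inCoord ⟨he, by rw [hΘe]; exact hsource⟩ v).congr_of_eventuallyEq
        (hline.mono fun σ hσ => by simp only [inCoord, (hshift _ hσ).eq_of_notMem x hx])
    rw [(hΘ'.hasDerivAt_inCoord ⟨he', hγ ▸ hsource⟩ v).unique hsame, hX.2 x _ hsource, hY x hx,
      add_zero]

end Variations

section Extension

variable {N : ℕ} {M : Type*} [TopologicalSpace M] [ChartedSpace (Coord N) M]
variable {E : Type*} [NormedAddCommGroup E] [NormedSpace ℝ E] {ι : Type*} [Fintype ι]

theorem contDiffOn_cutoff_sum {W : Set E} {Γ : E → Loop N M} (h : IsFamily W Γ) {c : M}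
    {χ : UnitAddCircle → ℝ} (hχ : ContDiff ℝ ∞ fun x : ℝ => χ x)
    {X : ι → ∀ (e : E) (z : UnitAddCircle), Tan N (Γ e z)}
    (hX : ∀ i, ContDiffOn ℝ ∞ (fun q : E × ℝ =>
      coframe c (Γ q.1 (q.2 : UnitAddCircle)) (X i q.1 (q.2 : UnitAddCircle))) (chartDom W Γ c))
    {S : Set (E × (ι → ℝ))}
    (hS : ∀ p ∈ S, p.1 ∈ W ∧ ∀ z ∈ tsupport χ, Γ p.1 z ∈ (chartAt (Coord N) c).source) :
    ContDiffOn ℝ ∞ (fun q : (E × (ι → ℝ)) × ℝ =>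
      χ q.2 • ∑ i, q.1.2 i • coframe c (Γ q.1.1 q.2) (X i q.1.1 q.2)) (S ×ˢ Set.univ) := by
  rintro ⟨⟨e, t⟩, x⟩ ⟨hp, -⟩
  refine (contDiffAt_of_mem_tsupport_circle hχ fun hx => ?_).contDiffWithinAt
  refine ContDiffAt.sum fun i _ => ContDiffAt.smul (f := fun q : (E × (ι → ℝ)) × ℝ => q.1.2 i)
    (by fun_prop) ?_
  have hXi := (hX i).contDiffAt ((h.isOpen_chartDom c).mem_nhds
    (⟨(hS _ hp).1, (hS _ hp).2 x hx⟩ : (e, x) ∈ chartDom W Γ c))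
  exact hXi.comp (((e, t), x) : (E × (ι → ℝ)) × ℝ)
    (f := fun q : (E × (ι → ℝ)) × ℝ => (q.1.1, q.2)) (by fun_prop)

variable [DecidableEq ι]

/-- `Θ` extends the family of loops `Γ`, near the parameter `e₀`, by one more parameter for each of
the vector fields `Y i` along the loops `Γ e`: the derivative of `Θ` in the direction of the `i`-th
new parameter is `Y i`. -/
structure IsExtension (W : Set E) (Γ : E → Loop N M) (e₀ : E)
    (Y : ι → ∀ (e : E) (z : UnitAddCircle), Tan N (Γ e z)) (W' : Set (E × (ι → ℝ)))
    (Θ : E × (ι → ℝ) → Loop N M) : Prop where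
  isFamily : IsFamily W' Θ
  mem : (e₀, 0) ∈ W'
  fst_mem : ∀ p ∈ W', p.1 ∈ W
  apply_zero : ∀ e, Θ (e, 0) = Γ e
  hasVariation : ∀ e, (e, 0) ∈ W' → ∀ i,
    HasVariation Θ (e, 0) (0, Pi.single i 1) (Γ e) (Y i e)

variable [IsManifold (𝓡 N) ∞ M]

theorem IsFamily.isExtension_zero {W : Set E} {Γ : E → Loop N M} (h : IsFamily W Γ) {e₀ : E}
    (he₀ : e₀ ∈ W) :
    IsExtension W Γ e₀ (fun (_ : ι) _ _ => 0) (Prod.fst ⁻¹' W) (Γ ∘ Prod.fst) := by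
  have hfst : IsFamily (Prod.fst ⁻¹' W) (Γ ∘ (Prod.fst : E × (ι → ℝ) → E)) :=
    h.comp (h.isOpen.preimage continuous_fst) contDiff_fst fun _ hp => hp
  refine ⟨hfst, he₀, fun p hp => hp, fun e => rfl, fun e he i => ?_⟩
  exact hfst.hasVariation_of_const_line he fun σ => by
    simp only [Function.comp_apply, Prod.smul_mk, smul_zero, Prod.mk_add_mk, add_zero]

theorem IsExtension.exists_add_cutoff {W : Set E} {Γ : E → Loop N M} (h : IsFamily W Γ) {e₀ : E}
    {Y : ι → ∀ (e : E) (z : UnitAddCircle), Tan N (Γ e z)} {W₁ : Set (E × (ι → ℝ))}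
    {Θ : E × (ι → ℝ) → Loop N M} (hΘ : IsExtension W Γ e₀ Y W₁ Θ) (c : M)
    {χ : UnitAddCircle → ℝ} (hχ : ContDiff ℝ ∞ fun x : ℝ => χ x)
    (hχc : ∀ z ∈ tsupport χ, Γ e₀ z ∈ (chartAt (Coord N) c).source)
    (X : ι → ∀ (e : E) (z : UnitAddCircle), Tan N (Γ e z))
    (hX : ∀ i, ContDiffOn ℝ ∞ (fun q : E × ℝ =>
      coframe c (Γ q.1 (q.2 : UnitAddCircle)) (X i q.1 (q.2 : UnitAddCircle)))
      (chartDom W Γ c)) :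
    ∃ (W₂ : Set (E × (ι → ℝ))) (Θ' : E × (ι → ℝ) → Loop N M),
      IsExtension W Γ e₀ (fun i e z => Y i e z + χ z • X i e z) W₂ Θ' := by
  obtain ⟨u, hu, heu, hmem⟩ := exists_open_tube (h.isOpen_chartDom c) (isClosed_tsupport χ)
    (a := e₀) fun x hx => ⟨hΘ.fst_mem _ hΘ.mem, hχc x hx⟩
  have hsource : ∀ e ∈ u, ∀ z ∈ tsupport χ, Γ e z ∈ (chartAt (Coord N) c).source := by
    intro e he z hz
    obtain ⟨x, rfl, hx⟩ := hmem e he z hz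
    exact hx.2
  let B : E × (ι → ℝ) → UnitAddCircle → Coord N := fun p z =>
    χ z • ∑ i, p.2 i • coframe c (Γ p.1 z) (X i p.1 z)
  have hBzero : ∀ e, B (e, 0) = 0 := fun e => by ext1 z; simp [B]
  have hΘu := hΘ.isFamily.mono (hΘ.isFamily.isOpen.inter (hu.preimage continuous_fst))
    Set.inter_subset_left
  obtain ⟨W₂, Θ', hW₂, hmem₂, hΘ', hrestrict, hshift⟩ := hΘu.exists_chartShift (e₀ := (e₀, 0))
    ⟨hΘ.mem, heu⟩ c (isClosed_tsupport χ) (by rw [hΘ.apply_zero]; exact hχc) (B := B)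
    (contDiffOn_cutoff_sum h hχ hX fun p hp => ⟨hΘ.fst_mem p hp.1, hsource p.1 hp.2⟩)
    (hBzero e₀) (fun p _ z hz => by simp only [B, image_eq_zero_of_notMem_tsupport hz, zero_smul])
  have hΘ'zero : ∀ e, Θ' (e, 0) = Γ e := fun e => by
    rw [hrestrict (e, 0) (hBzero e), hΘ.apply_zero]
  refine ⟨W₂, Θ', hΘ', hmem₂, fun p hp => hΘ.fst_mem p (hW₂ hp).1, hΘ'zero, fun e he i => ?_⟩
  refine HasVariation.chartShift hΘu hΘ' hshift (hW₂ he) he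
    (hΘ.hasVariation e (hW₂ he).1 i) (hΘ'zero e) (fun x _ => ?_) (fun x hx => ?_)
  · have hsmul := (hasDerivAt_id (0 : ℝ)).smul_const
      (coframe c (Γ e x) (χ x • X i e x))
    rw [one_smul] at hsmul
    refine hsmul.congr_of_eventuallyEq (Eventually.of_forall fun σ => ?_)
    simp only [B, Prod.smul_mk, smul_zero, Prod.mk_add_mk, add_zero, zero_add, id, map_smul]
    rw [Finset.sum_eq_single i (fun i' _ hi' => by simp [hi']) (by simp), smul_comm σ]
    simp only [Pi.smul_apply, Pi.single_eq_same, smul_eq_mul, mul_one]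
  · rw [image_eq_zero_of_notMem_tsupport hx, zero_smul]

theorem IsFamily.exists_extension {W : Set E} {Γ : E → Loop N M} (h : IsFamily W Γ) {e₀ : E}
    (he₀ : e₀ ∈ W) (X : ι → ∀ (e : E) (z : UnitAddCircle), Tan N (Γ e z))
    (hX : ∀ (i : ι) (c : M), ContDiffOn ℝ ∞ (fun q : E × ℝ =>
      coframe c (Γ q.1 (q.2 : UnitAddCircle)) (X i q.1 (q.2 : UnitAddCircle))) (chartDom W Γ c)) :
    ∃ (W' : Set (E × (ι → ℝ))) (Θ : E × (ι → ℝ) → Loop N M), IsExtension W Γ e₀ X W' Θ := by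
  classical
  obtain ⟨s, χ, hχ, hsupp, -, hsum⟩ := exists_smooth_partition_circle
    (fun c : M => (Γ e₀).toFun ⁻¹' (chartAt (Coord N) c).source)
    (fun c => (chartAt (Coord N) c).open_source.preimage (Γ e₀).continuous)
    (Set.eq_univ_of_forall fun z => Set.mem_iUnion.mpr ⟨Γ e₀ z, mem_chart_source _ _⟩)
  have hpartial : ∀ s : Finset M, ∃ (W' : Set (E × (ι → ℝ))) (Θ : E × (ι → ℝ) → Loop N M),
      IsExtension W Γ e₀ (fun i e z => (∑ c ∈ s, χ c z) • X i e z) W' Θ := by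
    intro s
    induction s using Finset.induction_on with
    | empty =>
      simp only [Finset.sum_empty, zero_smul]
      exact ⟨_, _, h.isExtension_zero he₀⟩
    | insert c s hc ih =>
      obtain ⟨W₁, Θ, hΘ⟩ := ih
      simp only [Finset.sum_insert hc, add_smul, add_comm (χ c _ • _)]
      exact hΘ.exists_add_cutoff h c (hχ c) (fun z hz => hsupp c hz) X fun i => hX i c
  obtain ⟨W', Θ, hΘ⟩ := hpartial s
  simp only [hsum, one_smul] at hΘ
  exact ⟨W', Θ, hΘ⟩

end Extension

section ParametricIntegral

variable {E : Type*}

theorem continuous_slice {F : Type*} [TopologicalSpace E] [TopologicalSpace F] {b : E × ℝ → F}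
    {e : E} (hb : ∀ x, ContinuousAt b (e, x)) : Continuous fun x : ℝ => b (e, x) :=
  continuous_iff_continuousAt.mpr fun x =>
    (hb x).comp (f := fun x : ℝ => (e, x)) (by fun_prop)

variable [NormedAddCommGroup E] [NormedSpace ℝ E]

theorem continuous_fderiv_slice {W : Set E} {b : E × ℝ → ℝ}
    (hb : ∀ q : E × ℝ, q.1 ∈ W → ContDiffAt ℝ ∞ b q) {e : E} (he : e ∈ W) (w : E × ℝ) :
    Continuous fun x : ℝ => fderiv ℝ b (e, x) w :=
  continuous_slice (b := fun q => fderiv ℝ b q w) fun x =>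
    (((hb (e, x) he).fderiv_right (m := 0) (by simp)).continuousAt).clm_apply continuousAt_const

theorem integral_fderiv_circle_eq_zero {W : Set E} {b : E × ℝ → ℝ}
    (hb : ∀ q : E × ℝ, q.1 ∈ W → ContDiffAt ℝ ∞ b q) {e : E} (he : e ∈ W)
    (hperiodic : b (e, 1) = b (e, 0)) : ∫ x in (0 : ℝ)..1, fderiv ℝ b (e, x) (0, 1) = 0 := by
  rw [intervalIntegral.integral_eq_sub_of_hasDerivAt (f := fun x => b (e, x)) (fun x _ => ?_)
    ((continuous_fderiv_slice hb he _).intervalIntegrable _ _), hperiodic, sub_self]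
  exact ((hb (e, x) he).differentiableAt (by simp)).hasFDerivAt.comp_hasDerivAt x
    ((hasDerivAt_const x e).prodMk (hasDerivAt_id x))

variable [FiniteDimensional ℝ E]

theorem exists_hasFDerivAt_integral {W : Set E} (hW : IsOpen W) {b : E × ℝ → ℝ}
    (hb : ∀ q : E × ℝ, q.1 ∈ W → ContDiffAt ℝ ∞ b q) {e : E} (he : e ∈ W) :
    ∃ L : E →L[ℝ] ℝ, HasFDerivAt (fun e => ∫ x in (0 : ℝ)..1, b (e, x)) L e ∧
      ∀ v, L v = ∫ x in (0 : ℝ)..1, fderiv ℝ b (e, x) (v, 0) := by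
  let b' : E × ℝ → E →L[ℝ] ℝ := fun q => (fderiv ℝ b q).comp (ContinuousLinearMap.inl ℝ E ℝ)
  have hb' : ∀ q : E × ℝ, q.1 ∈ W → ContinuousAt b' q := fun q hq =>
    (((hb q hq).fderiv_right (m := 0) (by simp)).continuousAt).clm_comp continuousAt_const
  obtain ⟨r, hr, hrW⟩ := Metric.nhds_basis_closedBall.mem_iff.mp (hW.mem_nhds he)
  have : ProperSpace E := FiniteDimensional.proper ℝ E
  have hcompact : IsCompact (Metric.closedBall e r ×ˢ Set.Icc (0 : ℝ) 1) :=
    (isCompact_closedBall e r).prod isCompact_Icc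
  obtain ⟨C, hC⟩ := hcompact.exists_bound_of_continuousOn
    (f := b') (fun q hq => (hb' q (hrW hq.1)).continuousWithinAt)
  have hcont : ∀ e ∈ W, Continuous fun x : ℝ => b (e, x) := fun e he =>
    continuous_slice fun x => (hb (e, x) he).continuousAt
  have hcont' : Continuous fun x : ℝ => b' (e, x) := continuous_slice fun x => hb' (e, x) he
  refine ⟨∫ x in (0 : ℝ)..1, b' (e, x), ?_, fun v => ?_⟩
  · refine intervalIntegral.hasFDerivAt_integral_of_dominated_of_fderiv_le
      (F := fun e x => b (e, x)) (F' := fun e x => b' (e, x)) (bound := fun _ => C)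
      (Metric.closedBall_mem_nhds e hr) ?_ ((hcont e he).intervalIntegrable _ _)
      hcont'.aestronglyMeasurable ?_ intervalIntegrable_const ?_
    · filter_upwards [hW.mem_nhds he] with e' he'
      exact (hcont e' he').aestronglyMeasurable
    · refine Eventually.of_forall fun x hx e' he' => hC (e', x) ⟨he', ?_⟩
      rw [Set.uIoc_of_le zero_le_one] at hx
      exact Set.Ioc_subset_Icc_self hx
    · refine Eventually.of_forall fun x _ e' he' => ?_
      exact ((hb (e', x) (hrW he')).differentiableAt (by simp)).hasFDerivAt.comp e'
        (hasFDerivAt_prodMk_left e' x)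
  · rw [ContinuousLinearMap.intervalIntegral_apply (hcont'.intervalIntegrable _ _)]
    rfl

theorem hasDerivAt_integral_line {W : Set E} (hW : IsOpen W) {b : E × ℝ → ℝ}
    (hb : ∀ q : E × ℝ, q.1 ∈ W → ContDiffAt ℝ ∞ b q) {e : E} (he : e ∈ W) (v : E) :
    HasDerivAt (fun τ : ℝ => ∫ x in (0 : ℝ)..1, b (e + τ • v, x))
      (∫ x in (0 : ℝ)..1, fderiv ℝ b (e, x) (v, 0)) 0 := by
  obtain ⟨L, hL, hLv⟩ := exists_hasFDerivAt_integral hW hb he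
  rw [← hLv v]
  exact hL.hasLineDerivAt v

end ParametricIntegral

section MixedDerivatives

theorem hasFDerivAt_of_hasDerivAt_fst_snd {G A B : ℝ × ℝ → ℝ} {a : ℝ × ℝ}
    (hA : ∀ᶠ a' in 𝓝 a, HasDerivAt (fun s => G (s, a'.2)) (A a') a'.1)
    (hB : ∀ᶠ a' in 𝓝 a, HasDerivAt (fun s => G (a'.1, s)) (B a') a'.2)
    (hA_cont : ContinuousAt A a) (hB_cont : ContinuousAt B a) :
    HasFDerivAt G
      (A a • ContinuousLinearMap.fst ℝ ℝ ℝ + B a • ContinuousLinearMap.snd ℝ ℝ ℝ) a := by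
  have hspan : Continuous (ContinuousLinearMap.toSpanSingletonCLE (𝕜 := ℝ) (E := ℝ)) :=
    ContinuousLinearEquiv.continuous _
  refine (hasStrictFDerivAt_uncurry_coprod (f := fun s t => G (s, t))
    (f₁ := fun s t => ContinuousLinearMap.toSpanSingleton ℝ (A (s, t)))
    (f₂ := fun s t => ContinuousLinearMap.toSpanSingleton ℝ (B (s, t))) (u := a)
    (hA.mono fun a' h => h.hasFDerivAt) (hB.mono fun a' h => h.hasFDerivAt)
    (hspan.continuousAt.comp (f := A) hA_cont)
    (hspan.continuousAt.comp (f := B) hB_cont)).hasFDerivAt.congr_fderiv ?_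
  ext <;> simp [Function.HasUncurry.uncurry]

theorem hasFDerivAt_comm_of_hasLineDerivAt {E : Type*} [NormedAddCommGroup E] [NormedSpace ℝ E]
    {W : Set E} (hW : IsOpen W) {G A B : E → ℝ} {v w : E}
    (hA : ∀ e ∈ W, HasLineDerivAt ℝ G (A e) e v) (hB : ∀ e ∈ W, HasLineDerivAt ℝ G (B e) e w)
    (hA_cont : ContinuousOn A W) (hB_cont : ContinuousOn B W) {e : E} (he : e ∈ W)
    {A' B' : E →L[ℝ] ℝ} (hA' : HasFDerivAt A A' e) (hB' : HasFDerivAt B B' e) :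
    A' w = B' v := by
  let plane : ℝ × ℝ → E := fun a => e + a.1 • v + a.2 • w
  have hplane : ∀ a, HasFDerivAt plane ((ContinuousLinearMap.fst ℝ ℝ ℝ).smulRight v
      + (ContinuousLinearMap.snd ℝ ℝ ℝ).smulRight w) a := fun a =>
    ((hasFDerivAt_fst.smul_const v).const_add e).add (hasFDerivAt_snd.smul_const w)
  have hzero : plane (0, 0) = e := by simp [plane]
  have hmem : ∀ a, plane a ∈ W → ∀ᶠ a' in 𝓝 a, plane a' ∈ W := fun a ha =>
    (hplane a).continuousAt.eventually (hW.mem_nhds ha)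
  have hline : ∀ {D : ℝ} {e' u : E}, HasLineDerivAt ℝ G D e' u → ∀ (t : ℝ) (p : ℝ → E),
      (∀ s, p s = e' + (s - t) • u) → HasDerivAt (fun s => G (p s)) D t := by
    intro D e' u h t p hp
    have hcomp := HasDerivAt.comp_of_eq t h ((hasDerivAt_id t).sub_const t) (by simp)
    rw [mul_one] at hcomp
    exact hcomp.congr_of_eventuallyEq (Eventually.of_forall fun s => by simp [hp])
  have hfderiv : ∀ a, plane a ∈ W → HasFDerivAt (fun a => G (plane a))
      (A (plane a) • ContinuousLinearMap.fst ℝ ℝ ℝ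
        + B (plane a) • ContinuousLinearMap.snd ℝ ℝ ℝ) a := fun a ha => by
    refine hasFDerivAt_of_hasDerivAt_fst_snd (A := A ∘ plane) (B := B ∘ plane)
      ((hmem a ha).mono fun a' ha' => hline (hA _ ha') _ _ fun s => ?_)
      ((hmem a ha).mono fun a' ha' => hline (hB _ ha') _ _ fun s => ?_)
      ((hA_cont.continuousAt (hW.mem_nhds ha)).comp (hplane a).continuousAt)
      ((hB_cont.continuousAt (hW.mem_nhds ha)).comp (hplane a).continuousAt)
    all_goals simp only [plane, sub_smul]; abel
  rw [← hzero] at hA' hB' he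
  have hsecond := ((hA'.comp (0, 0) (hplane (0, 0))).smul_const (ContinuousLinearMap.fst ℝ ℝ ℝ)).add
    ((hB'.comp (0, 0) (hplane (0, 0))).smul_const (ContinuousLinearMap.snd ℝ ℝ ℝ))
  have hsymm := second_derivative_symmetric_of_eventually_of_real
    ((hmem (0, 0) he).mono hfderiv) hsecond (0, 1) (1, 0)
  simpa using hsymm

end MixedDerivatives

section Covectors

variable {N : ℕ} {M : Type*} [TopologicalSpace M] [ChartedSpace (Coord N) M]

/-- The components of a covector field in the chart around `c`. -/
def covCoord (f : CovectorField N M) (c : M) (γ : Loop N M) (z : UnitAddCircle) :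
    Coord N →L[ℝ] ℝ :=
  LinearMap.toContinuousLinearMap (f γ z ∘ₗ (frame c (γ z)).toLinearMap : Coord N →ₗ[ℝ] ℝ)

theorem covCoord_apply (f : CovectorField N M) (c : M) (γ : Loop N M) (z : UnitAddCircle)
    (w : Coord N) : covCoord f c γ z w = f γ z (frame c (γ z) w) := rfl

theorem covCoord_coframe [IsManifold (𝓡 N) ∞ M] (f : CovectorField N M) {c : M} {γ : Loop N M}
    {z : UnitAddCircle} (hz : γ z ∈ (chartAt (Coord N) c).source) (ξ : Tan N (γ z)) :
    covCoord f c γ z (coframe c (γ z) ξ) = f γ z ξ := by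
  rw [covCoord_apply, frame_coframe hz]

variable {E : Type*} [NormedAddCommGroup E] [NormedSpace ℝ E]

/-- The pairing of a covector field with the derivative of a family of loops in the direction `v`,
the integrand of `dF` along the family if the covector field is `δF / δu`. -/
def pairing (f : CovectorField N M) (Θ : E → Loop N M) (v : E) (q : E × ℝ) : ℝ :=
  f (Θ q.1) (q.2 : UnitAddCircle)
    (mfderiv 𝓘(ℝ, E) (𝓡 N) (fun e => Θ e (q.2 : UnitAddCircle)) q.1 v)

variable {V : Set (Loop N M)} {F : Loop N M → ℝ} {f : CovectorField N M}
  {W : Set E} {Θ : E → Loop N M}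

theorem pairing_comp {E' : Type*} [NormedAddCommGroup E'] [NormedSpace ℝ E']
    (f : CovectorField N M) (h : IsFamily W Θ) (L : E' →L[ℝ] E) (v e : E') (he : L e ∈ W) (x : ℝ) :
    pairing f (Θ ∘ L) v (e, x) = pairing f Θ (L v) (L e, x) := by
  have hL : MDifferentiableAt 𝓘(ℝ, E') 𝓘(ℝ, E) L e := L.differentiableAt.mdifferentiableAt
  have hcomp := mfderiv_comp_apply e (h.mdifferentiableAt_apply he x) hL v
  rw [mfderiv_eq_fderiv, L.fderiv] at hcomp
  exact congrArg (f (Θ (L e)) (x : UnitAddCircle)) hcomp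

theorem pairing_eventuallyEq [IsManifold (𝓡 N) ∞ M] (f : CovectorField N M) (h : IsFamily W Θ)
    {c : M} {q : E × ℝ} (hq : q ∈ chartDom W Θ c) (v : E) :
    pairing f Θ v =ᶠ[𝓝 q] fun q => covCoord f c (Θ q.1) (q.2 : UnitAddCircle)
      (fderiv ℝ (inCoord Θ c) q (v, 0)) := by
  filter_upwards [(h.isOpen_chartDom c).mem_nhds hq] with q' hq'
  rw [← h.coframe_mfderiv_param hq', covCoord_coframe f hq'.2]
  rfl

variable [FiniteDimensional ℝ E]

theorem HasVariationalDeriv.contDiffAt_covCoord (hF : HasVariationalDeriv V F f)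
    (h : IsFamily W Θ) (hV : ∀ e ∈ W, Θ e ∈ V) {c : M} {q : E × ℝ} (hq : q ∈ chartDom W Θ c) :
    ContDiffAt ℝ ∞ (fun q : E × ℝ => covCoord f c (Θ q.1) (q.2 : UnitAddCircle)) q := by
  let L : (Fin (Module.finrank ℝ E) → ℝ) ≃L[ℝ] E := ContinuousLinearEquiv.ofFinrankEq (by simp)
  have hfamily : IsSmoothFamily V (L ⁻¹' W) (Θ ∘ L) := isSmoothFamily_iff.mpr
    ⟨h.comp (h.isOpen.preimage L.continuous) L.contDiff (fun _ ht => ht), fun t ht => hV _ ht⟩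
  suffices ContDiffOn ℝ ∞ (fun q : E × ℝ => covCoord f c (Θ q.1) (q.2 : UnitAddCircle))
      (chartDom W Θ c) from this.contDiffAt ((h.isOpen_chartDom c).mem_nhds hq)
  rw [contDiffOn_clm_apply]
  intro w
  have hLsymm : ContDiff ℝ ∞ (fun q : E × ℝ => (L.symm q.1, q.2)) := by
    have := L.symm.contDiff (n := ∞)
    fun_prop
  have hpullback := (hF.smooth _ _ _ hfamily c w).comp hLsymm.contDiffOn (s := chartDom W Θ c) (by
    rintro q ⟨hq1, hq2⟩
    simpa using And.intro hq1 hq2)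
  refine hpullback.congr fun q _ => ?_
  have : L (L.symm q.1) = q.1 := L.apply_symm_apply _
  simp only [Function.comp]
  rw [this]
  rfl

theorem HasVariationalDeriv.hasDerivAt_family (hF : HasVariationalDeriv V F f)
    (h : IsFamily W Θ) (hV : ∀ e ∈ W, Θ e ∈ V) {e : E} (he : e ∈ W) (v : E) :
    HasDerivAt (fun τ : ℝ => F (Θ (e + τ • v))) (∫ x in (0 : ℝ)..1, pairing f Θ v (e, x)) 0 := by
  let L : (Fin (Module.finrank ℝ E) → ℝ) ≃L[ℝ] E := ContinuousLinearEquiv.ofFinrankEq (by simp)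
  have hfamily : IsSmoothFamily V (L ⁻¹' W) (Θ ∘ L) := isSmoothFamily_iff.mpr
    ⟨h.comp (h.isOpen.preimage L.continuous) L.contDiff (fun _ ht => ht), fun t ht => hV _ ht⟩
  have hpairing : ∀ x : ℝ, pairing f (Θ ∘ L) (L.symm v) (L.symm e, x) = pairing f Θ v (e, x) :=
    fun x => (pairing_comp f h L.toContinuousLinearMap (L.symm v) (L.symm e)
      (by simpa using he) x).trans (by simp)
  have hderiv : HasDerivAt (fun τ : ℝ => F (Θ (L (L.symm e + τ • L.symm v))))
      (∫ x in (0 : ℝ)..1, pairing f (Θ ∘ L) (L.symm v) (L.symm e, x)) 0 :=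
    hF.deriv _ _ _ hfamily (L.symm e) (by simpa using he) (L.symm v)
  simpa only [hpairing, map_add, map_smul, L.apply_symm_apply] using hderiv

variable [IsManifold (𝓡 N) ∞ M]

theorem HasVariationalDeriv.contDiffAt_pairing (hF : HasVariationalDeriv V F f)
    (h : IsFamily W Θ) (hV : ∀ e ∈ W, Θ e ∈ V) (v : E) (q : E × ℝ) (hq : q.1 ∈ W) :
    ContDiffAt ℝ ∞ (pairing f Θ v) q := by
  have hc : q ∈ chartDom W Θ (Θ q.1 (q.2 : UnitAddCircle)) := ⟨hq, mem_chart_source _ _⟩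
  refine ContDiffAt.congr_of_eventuallyEq ?_ (pairing_eventuallyEq f h hc v)
  exact (hF.contDiffAt_covCoord h hV hc).clm_apply
    (((h.contDiffAt_inCoord hc).fderiv_right (m := ∞) (by simp)).clm_apply contDiffAt_const)

theorem HasVariationalDeriv.second_variation_symm (hF : HasVariationalDeriv V F f)
    (h : IsFamily W Θ) (hV : ∀ e ∈ W, Θ e ∈ V) {e : E} (he : e ∈ W) (v w : E) :
    ∫ x in (0 : ℝ)..1, fderiv ℝ (pairing f Θ v) (e, x) (w, 0)
      = ∫ x in (0 : ℝ)..1, fderiv ℝ (pairing f Θ w) (e, x) (v, 0) := by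
  have hfderiv := fun (u : E) (e : E) (he : e ∈ W) => exists_hasFDerivAt_integral h.isOpen
    (fun q hq => hF.contDiffAt_pairing h hV u q hq) he
  have hcont : ∀ u, ContinuousOn (fun e => ∫ x in (0 : ℝ)..1, pairing f Θ u (e, x)) W :=
    fun u e he => (hfderiv u e he).choose_spec.1.continuousAt.continuousWithinAt
  obtain ⟨Lv, hLv, hLv_apply⟩ := hfderiv v e he
  obtain ⟨Lw, hLw, hLw_apply⟩ := hfderiv w e he
  rw [← hLv_apply, ← hLw_apply]
  exact hasFDerivAt_comm_of_hasLineDerivAt (G := F ∘ Θ) h.isOpen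
    (fun e he => hF.hasDerivAt_family h hV he v) (fun e he => hF.hasDerivAt_family h hV he w)
    (hcont v) (hcont w) he hLv hLw

end Covectors

section LocalIdentity

variable {G C F F' : Type*} [NormedAddCommGroup G] [NormedSpace ℝ G] [NormedAddCommGroup C]
  [NormedSpace ℝ C] [NormedAddCommGroup F] [NormedSpace ℝ F] [NormedAddCommGroup F']
  [NormedSpace ℝ F'] {q : G}

theorem fderiv_clm_apply_apply {A : G → F →L[ℝ] F'} {u : G → F} (hA : DifferentiableAt ℝ A q)
    (hu : DifferentiableAt ℝ u q) (w : G) :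
    fderiv ℝ (fun q => A q (u q)) q w = fderiv ℝ A q w (u q) + A q (fderiv ℝ u q w) := by
  rw [fderiv_clm_apply hA hu]
  simp [add_comm]

theorem hasDerivAt_line {u : G → F} (hu : DifferentiableAt ℝ u q) (w : G) :
    HasDerivAt (fun σ : ℝ => u (q + σ • w)) (fderiv ℝ u q w) 0 :=
  hu.hasFDerivAt.hasLineDerivAt w

theorem contDiffAt_fderiv_apply {U : G → F} (hU : ContDiffAt ℝ ∞ U q) (a : G) :
    ContDiffAt ℝ ∞ (fun q => fderiv ℝ U q a) q :=
  (hU.fderiv_right (m := ∞) (by simp)).clm_apply contDiffAt_const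

theorem fderiv_fderiv_comm {U : G → F} (hU : ContDiffAt ℝ ∞ U q) (a b : G) :
    fderiv ℝ (fun q => fderiv ℝ U q a) q b = fderiv ℝ (fun q => fderiv ℝ U q b) q a := by
  have hU' : DifferentiableAt ℝ (fderiv ℝ U) q :=
    (hU.fderiv_right (m := ∞) (by simp)).differentiableAt (by simp)
  have hsecond : ∀ a b, fderiv ℝ (fun q => fderiv ℝ U q a) q b = fderiv ℝ (fderiv ℝ U) q b a :=
    fun a b => by simp [fderiv_clm_apply_apply hU' (differentiableAt_const a)]
  have hsymm : IsSymmSndFDerivAt ℝ U q := hU.isSymmSndFDerivAt (by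
    simp only [minSmoothness_of_isRCLikeNormedField]
    exact WithTop.coe_le_coe.2 (le_top : (2 : ℕ∞) ≤ ⊤))
  rw [hsecond, hsecond, hsymm.eq]

/-- The one-jet of `U` in the direction `ξ`. -/
def jet (U : G → C) (ξ : G) (q : G) : C × C := (U q, fderiv ℝ U q ξ)

theorem contDiffAt_jet {U : G → C} (hU : ContDiffAt ℝ ∞ U q) (ξ : G) :
    ContDiffAt ℝ ∞ (jet U ξ) q :=
  hU.prodMk (contDiffAt_fderiv_apply hU ξ)

theorem fderiv_jet {U : G → C} (hU : ContDiffAt ℝ ∞ U q) (ξ w : G) :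
    fderiv ℝ (jet U ξ) q w = (fderiv ℝ U q w, fderiv ℝ (fun q => fderiv ℝ U q w) q ξ) := by
  have hfst := (hU.differentiableAt (by simp)).hasFDerivAt
  have hsnd := ((contDiffAt_fderiv_apply hU ξ).differentiableAt (by simp)).hasFDerivAt
  rw [show jet U ξ = fun q => (U q, fderiv ℝ U q ξ) from rfl, (hfst.prodMk hsnd).fderiv,
    ← fderiv_fderiv_comm hU]
  rfl

/-- The covector `w ↦ f_i (∂P^{ij} / ∂v^k) g_j w^k`, where `P'` is the derivative of `P(u, v)`. -/
def vertForm (f : C →L[ℝ] ℝ) (P' : C × C →L[ℝ] (C →L[ℝ] ℝ) →L[ℝ] C) (g : C →L[ℝ] ℝ) : C →L[ℝ] ℝ :=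
  f.comp ((P'.flip g).comp (ContinuousLinearMap.inr ℝ C C))

theorem vertForm_apply (f : C →L[ℝ] ℝ) (P' : C × C →L[ℝ] (C →L[ℝ] ℝ) →L[ℝ] C) (g : C →L[ℝ] ℝ)
    (w : C) : vertForm f P' g w = f (P' (0, w) g) := rfl

set_option maxSynthPendingDepth 5 in
theorem contDiffAt_vertForm {f g : G → C →L[ℝ] ℝ} {P : C × C → (C →L[ℝ] ℝ) →L[ℝ] C} {j : G → C × C}
    (hf : ContDiffAt ℝ ∞ f q) (hg : ContDiffAt ℝ ∞ g q) (hj : ContDiffAt ℝ ∞ j q)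
    (hP : ContDiffAt ℝ ∞ P (j q)) :
    ContDiffAt ℝ ∞ (fun q => vertForm (f q) (fderiv ℝ P (j q)) (g q)) q := by
  have hP' : ContDiffAt ℝ ∞ (fun q => fderiv ℝ P (j q)) q :=
    (hP.fderiv_right (m := ∞) (by simp)).comp q hj
  have hflip : ContDiffAt ℝ ∞ (fun q => (fderiv ℝ P (j q)).flip) q :=
    (ContinuousLinearMap.flipₗᵢ ℝ (C × C) (C →L[ℝ] ℝ) C).contDiff.contDiffAt.comp q hP'
  exact hf.clm_comp ((hflip.clm_apply hg).clm_comp contDiffAt_const)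

/-- The right-hand side depends on `τ` only through `∂U / ∂τ`, as the integrand of a variational
derivative must. On the left, the antisymmetrized terms integrate to zero by the symmetry of
second variations, and the last term by periodicity in the direction `ξ`. -/
theorem fderiv_bracket_density {U : G → C} {f g : G → C →L[ℝ] ℝ}
    {P : C × C → (C →L[ℝ] ℝ) →L[ℝ] C} (ξ r s τ : G) (hU : ContDiffAt ℝ ∞ U q)
    (hf : ContDiffAt ℝ ∞ f q) (hg : ContDiffAt ℝ ∞ g q) (hP : ContDiffAt ℝ ∞ P (jet U ξ q))
    (hskew : ∀ a b : C →L[ℝ] ℝ, a (P (jet U ξ q) b) = -b (P (jet U ξ q) a))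
    (hr : fderiv ℝ U q r = P (jet U ξ q) (f q)) (hs : fderiv ℝ U q s = P (jet U ξ q) (g q)) :
    fderiv ℝ (fun q => f q (P (jet U ξ q) (g q))) q τ
      - (fderiv ℝ (fun q => f q (fderiv ℝ U q s)) q τ
        - fderiv ℝ (fun q => f q (fderiv ℝ U q τ)) q s)
      + (fderiv ℝ (fun q => g q (fderiv ℝ U q r)) q τ
        - fderiv ℝ (fun q => g q (fderiv ℝ U q τ)) q r)
      - fderiv ℝ (fun q => vertForm (f q) (fderiv ℝ P (jet U ξ q)) (g q) (fderiv ℝ U q τ)) q ξ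
    = fderiv ℝ f q s (fderiv ℝ U q τ) - fderiv ℝ g q r (fderiv ℝ U q τ)
      + f q (fderiv ℝ P (jet U ξ q) (fderiv ℝ U q τ, 0) (g q))
      - fderiv ℝ (fun q => vertForm (f q) (fderiv ℝ P (jet U ξ q)) (g q)) q ξ (fderiv ℝ U q τ) := by
  have hj := contDiffAt_jet hU ξ
  have hPj : ContDiffAt ℝ ∞ (fun q => P (jet U ξ q)) q := hP.comp q hj
  have hdf := hf.differentiableAt (by simp)
  have hdg := hg.differentiableAt (by simp)
  have hdPj := hPj.differentiableAt (by simp)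
  have hdU := fun a => (contDiffAt_fderiv_apply hU a).differentiableAt (by simp)
  have hchain : fderiv ℝ (fun q => P (jet U ξ q)) q τ
      = fderiv ℝ P (jet U ξ q) (fderiv ℝ (jet U ξ) q τ) :=
    congrArg (fun L => L τ)
      (fderiv_comp q (hP.differentiableAt (by simp)) (hj.differentiableAt (by simp)))
  have hsplit : ∀ a b : C, fderiv ℝ P (jet U ξ q) (a, b)
      = fderiv ℝ P (jet U ξ q) (a, 0) + fderiv ℝ P (jet U ξ q) (0, b) := fun a b => by
    rw [← map_add, Prod.mk_add_mk, add_zero, zero_add]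
  rw [fderiv_clm_apply_apply hdf (hdPj.clm_apply hdg), fderiv_clm_apply_apply hdPj hdg,
    fderiv_clm_apply_apply hdf (hdU s), fderiv_clm_apply_apply hdf (hdU τ),
    fderiv_clm_apply_apply hdg (hdU r), fderiv_clm_apply_apply hdg (hdU τ),
    fderiv_clm_apply_apply ((contDiffAt_vertForm hf hg hj hP).differentiableAt (by simp)) (hdU τ),
    hchain, fderiv_jet hU, fderiv_fderiv_comm hU s τ, fderiv_fderiv_comm hU r τ, hr, hs,
    vertForm_apply, hsplit, map_add, add_apply, map_add, hskew (f q) (fderiv ℝ g q τ)]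
  ring

end LocalIdentity

section Operators

variable {N : ℕ} {M : Type*} [TopologicalSpace M] [ChartedSpace (Coord N) M]

/-- The matrix `P^{ij}(u, u_x)` in the chart around `c`, as a function of the components of `u`
and `u_x`. -/
def opCoord (P : MatrixOperator N M) (c : M) (z : Coord N × Coord N) :
    (Coord N →L[ℝ] ℝ) →L[ℝ] Coord N :=
  let p := (chartAt (Coord N) c).symm z.1
  LinearMap.toContinuousLinearMap ((coframe c p).toLinearMap ∘ₗ P p (frame c p z.2) ∘ₗ
    (coframe (N := N) c p).toLinearMap.dualMap ∘ₗ ContinuousLinearMap.coeLM ℝ)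

/-- The domain in the chart around `c` of an operator defined for the velocities in `O`. -/
def opDom (O : ∀ p : M, Set (Tan N p)) (c : M) : Set (Coord N × Coord N) :=
  {z | z.1 ∈ (chartAt (Coord N) c).target ∧
    frame c ((chartAt (Coord N) c).symm z.1) z.2 ∈ O ((chartAt (Coord N) c).symm z.1)}

/-- Matrix operators that are smooth and skew-symmetric for velocities in the open set `O` of the
tangent bundle. -/
structure IsSmoothSkewOn (O : ∀ p : M, Set (Tan N p)) (P : MatrixOperator N M) : Prop where
  skew : ∀ (p : M), ∀ v ∈ O p, ∀ α β : Cotan N p, α (P p v β) = -β (P p v α)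
  isOpen : ∀ c : M, IsOpen (opDom O c)
  smooth : ∀ c : M, ContDiffOn ℝ ∞ (opCoord P c) (opDom O c)

/-- The integrand of the bracket, as a function on the circle. -/
def density (P : MatrixOperator N M) (f g : CovectorField N M) (γ : Loop N M)
    (z : UnitAddCircle) : ℝ :=
  f γ z (P (γ z) (γ.vel z) (g γ z))

theorem bracket_eq_integral_density (P : MatrixOperator N M) (f g : CovectorField N M)
    (γ : Loop N M) : bracket P f g γ = ∫ x in (0 : ℝ)..1, density P f g γ (x : UnitAddCircle) := by
  simp only [bracket, density, Loop.vel_coe]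

/-- The derivative of the density of the bracket with respect to the velocity. -/
def vertDensity (P : MatrixOperator N M) (f g : CovectorField N M) (γ : Loop N M)
    (z : UnitAddCircle) (ξ : Tan N (γ z)) : ℝ :=
  deriv (fun σ : ℝ => f γ z (P (γ z) (γ.vel z + σ • ξ) (g γ z))) 0

variable [IsManifold (𝓡 N) ∞ M] {P : MatrixOperator N M} {O : ∀ p : M, Set (Tan N p)} {c p : M}

theorem opCoord_coframe (P : MatrixOperator N M) (hp : p ∈ (chartAt (Coord N) c).source)
    (v : Tan N p) (α : Cotan N p) (a : Coord N →L[ℝ] ℝ) (ha : ∀ w, a w = α (frame c p w)) :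
    opCoord P c (chartAt (Coord N) c p, coframe c p v) a = coframe c p (P p v α) := by
  have hα : coordCovector c p a.toLinearMap = α := by
    ext ξ
    change a (coframe c p ξ) = α ξ
    rw [ha, frame_coframe hp]
  change coframe c ((chartAt (Coord N) c).symm (chartAt (Coord N) c p)) (P _ (frame c _ _)
    (coordCovector c _ a.toLinearMap)) = _
  rw [(chartAt (Coord N) c).left_inv hp, frame_coframe hp, hα]

theorem mem_opDom (hp : p ∈ (chartAt (Coord N) c).source) {v : Tan N p} (hv : v ∈ O p) :
    (chartAt (Coord N) c p, coframe c p v) ∈ opDom O c := by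
  refine ⟨(chartAt (Coord N) c).map_source hp, ?_⟩
  change frame c ((chartAt (Coord N) c).symm (chartAt (Coord N) c p)) (coframe c p v) ∈ O _
  rwa [(chartAt (Coord N) c).left_inv hp, frame_coframe hp]

theorem opCoord_skew (hp : p ∈ (chartAt (Coord N) c).source) {v : Tan N p}
    (hskew : ∀ α β : Cotan N p, α (P p v β) = -β (P p v α)) (a b : Coord N →L[ℝ] ℝ) :
    a (opCoord P c (chartAt (Coord N) c p, coframe c p v) b)
      = -b (opCoord P c (chartAt (Coord N) c p, coframe c p v) a) := by
  let pullback (a : Coord N →L[ℝ] ℝ) : Cotan N p := coordCovector c p a.toLinearMap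
  have hpullback : ∀ (a : Coord N →L[ℝ] ℝ) w, a w = pullback a (frame c p w) := fun a w => by
    change a w = a (coframe c p (frame c p w))
    rw [coframe_frame hp]
  rw [opCoord_coframe P hp v _ b (hpullback b), opCoord_coframe P hp v _ a (hpullback a)]
  exact hskew (pullback a) (pullback b)

variable {γ : Loop N M} {z : UnitAddCircle}

theorem density_eq (P : MatrixOperator N M) (f g : CovectorField N M)
    (hz : γ z ∈ (chartAt (Coord N) c).source) :
    density P f g γ z = covCoord f c γ z (opCoord P c (chartAt (Coord N) c (γ z),
      coframe c (γ z) (γ.vel z)) (covCoord g c γ z)) := by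
  rw [opCoord_coframe P hz _ (g γ z) (covCoord g c γ z) (fun w => rfl), covCoord_coframe f hz]
  rfl

set_option maxSynthPendingDepth 5 in
theorem IsSmoothSkewOn.vertDensity_eq (hP : IsSmoothSkewOn O P) (f g : CovectorField N M)
    (hz : γ z ∈ (chartAt (Coord N) c).source) (hv : γ.vel z ∈ O (γ z)) (ξ : Tan N (γ z)) :
    vertDensity P f g γ z ξ = vertForm (covCoord f c γ z)
      (fderiv ℝ (opCoord P c) (chartAt (Coord N) c (γ z), coframe c (γ z) (γ.vel z)))
      (covCoord g c γ z) (coframe c (γ z) ξ) := by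
  let j : Coord N × Coord N := (chartAt (Coord N) c (γ z), coframe c (γ z) (γ.vel z))
  let w : Coord N × Coord N := (0, coframe c (γ z) ξ)
  have hcoord : ∀ σ : ℝ, f γ z (P (γ z) (γ.vel z + σ • ξ) (g γ z)) =
      covCoord f c γ z (opCoord P c (j + σ • w) (covCoord g c γ z)) := fun σ => by
    rw [← covCoord_coframe f hz, ← opCoord_coframe P hz _ (g γ z) (covCoord g c γ z) (fun w => rfl)]
    simp only [j, w, map_add, map_smul, Prod.smul_mk, smul_zero, Prod.mk_add_mk, add_zero]
  have hdiff : DifferentiableAt ℝ (opCoord P c) j :=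
    ((hP.smooth c).contDiffAt ((hP.isOpen c).mem_nhds (mem_opDom hz hv))).differentiableAt (by simp)
  have hline : HasDerivAt (fun σ : ℝ => opCoord P c (j + σ • w)) (fderiv ℝ (opCoord P c) j w) 0 :=
    hasDerivAt_line hdiff w
  have hderiv := (covCoord f c γ z).hasFDerivAt.comp_hasDerivAt (0 : ℝ)
    (hline.clm_apply (hasDerivAt_const (0 : ℝ) (covCoord g c γ z)))
  rw [vertDensity, funext hcoord, vertForm_apply]
  exact hderiv.deriv.trans (by simp [j, w])

end Operators

section CircleDerivative

variable {F : Type*} [NormedAddCommGroup F] [NormedSpace ℝ F]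

/-- The derivative of a function on the circle, computed at an arbitrary real representative. -/
def circDeriv (u : UnitAddCircle → F) (z : UnitAddCircle) : F :=
  deriv (fun y : ℝ => u (y : UnitAddCircle)) (Function.surjInv QuotientAddGroup.mk_surjective z)

theorem circDeriv_coe (u : UnitAddCircle → F) (x : ℝ) :
    circDeriv u (x : UnitAddCircle) = deriv (fun y : ℝ => u (y : UnitAddCircle)) x := by
  set y : ℝ := Function.surjInv QuotientAddGroup.mk_surjective (x : UnitAddCircle) with hy
  have hyx : (y : UnitAddCircle) = (x : UnitAddCircle) :=
    Function.surjInv_eq QuotientAddGroup.mk_surjective (x : UnitAddCircle)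
  have hshift (t : ℝ) : ((t + (y - x) : ℝ) : UnitAddCircle) = (t : UnitAddCircle) := by
    rw [AddCircle.coe_add, AddCircle.coe_sub, hyx, sub_self, add_zero]
  rw [circDeriv, ← hy, ← add_sub_cancel x y, ← deriv_comp_add_const]
  simp only [hshift]

variable {E : Type*} [NormedAddCommGroup E] [NormedSpace ℝ E] {u : E × ℝ → F} {e : E} {x : ℝ}

theorem deriv_line_fst_eq_fderiv (hu : DifferentiableAt ℝ u (e, x)) (v : E) :
    deriv (fun σ : ℝ => u (e + σ • v, x)) 0 = fderiv ℝ u (e, x) (v, 0) := by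
  simpa using (hasDerivAt_line hu (v, 0)).deriv

theorem deriv_slice_eq_fderiv (hu : DifferentiableAt ℝ u (e, x)) :
    deriv (fun y : ℝ => u (e, y)) x = fderiv ℝ u (e, x) (0, 1) :=
  (hu.hasFDerivAt.comp_hasDerivAt x ((hasDerivAt_const x e).prodMk (hasDerivAt_id x))).deriv

end CircleDerivative

section FamilyDensities

variable {N : ℕ} {M : Type*} [TopologicalSpace M] [ChartedSpace (Coord N) M]
  {E : Type*} [NormedAddCommGroup E] [NormedSpace ℝ E]

/-- The density of the bracket along a family of loops, as a function of the parameter and `x`. -/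
def famDensity (P : MatrixOperator N M) (f g : CovectorField N M) (Θ : E → Loop N M)
    (q : E × ℝ) : ℝ :=
  density P f g (Θ q.1) (q.2 : UnitAddCircle)

/-- The derivative of the density with respect to the velocity along a family of loops, in the
direction of the derivative of the family along `τ`. -/
def famVert (P : MatrixOperator N M) (f g : CovectorField N M) (Θ : E → Loop N M) (τ : E)
    (q : E × ℝ) : ℝ :=
  vertDensity P f g (Θ q.1) (q.2 : UnitAddCircle)
    (mfderiv 𝓘(ℝ, E) (𝓡 N) (fun e => Θ e (q.2 : UnitAddCircle)) q.1 τ)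

/-- The position and the velocity of a loop in the chart around `c`. -/
def loopJet (c : M) (γ : Loop N M) (z : UnitAddCircle) : Coord N × Coord N :=
  (chartAt (Coord N) c (γ z), coframe c (γ z) (γ.vel z))

variable [IsManifold (𝓡 N) ∞ M] {P : MatrixOperator N M} {O : ∀ p : M, Set (Tan N p)}
  {f g : CovectorField N M} {V : Set (Loop N M)} {W : Set E} {Θ : E → Loop N M}

theorem IsFamily.jet_inCoord (h : IsFamily W Θ) {c : M} {q : E × ℝ} (hq : q ∈ chartDom W Θ c) :
    jet (inCoord Θ c) (0, 1) q = loopJet c (Θ q.1) (q.2 : UnitAddCircle) := by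
  rw [jet, loopJet, Loop.vel_coe, h.coframe_velocity hq]
  rfl

theorem famDensity_eventuallyEq (P : MatrixOperator N M) (f g : CovectorField N M)
    (h : IsFamily W Θ) {c : M} {q : E × ℝ} (hq : q ∈ chartDom W Θ c) :
    famDensity P f g Θ =ᶠ[𝓝 q] fun q => covCoord f c (Θ q.1) (q.2 : UnitAddCircle)
      (opCoord P c (jet (inCoord Θ c) (0, 1) q) (covCoord g c (Θ q.1) (q.2 : UnitAddCircle))) := by
  filter_upwards [(h.isOpen_chartDom c).mem_nhds hq] with q' hq'
  rw [h.jet_inCoord hq', famDensity, density_eq P f g hq'.2]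
  rfl

theorem famVert_eventuallyEq (hP : IsSmoothSkewOn O P) (f g : CovectorField N M)
    (h : IsFamily W Θ) (hO : ∀ e ∈ W, ∀ z, (Θ e).vel z ∈ O (Θ e z)) (τ : E) {c : M} {q : E × ℝ}
    (hq : q ∈ chartDom W Θ c) :
    famVert P f g Θ τ =ᶠ[𝓝 q] fun q => vertForm (covCoord f c (Θ q.1) (q.2 : UnitAddCircle))
      (fderiv ℝ (opCoord P c) (jet (inCoord Θ c) (0, 1) q))
      (covCoord g c (Θ q.1) (q.2 : UnitAddCircle)) (fderiv ℝ (inCoord Θ c) q (τ, 0)) := by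
  filter_upwards [(h.isOpen_chartDom c).mem_nhds hq] with q' hq'
  rw [h.jet_inCoord hq', famVert, hP.vertDensity_eq f g hq'.2 (hO _ hq'.1 _),
    h.coframe_mfderiv_param hq']
  rfl

theorem IsSmoothSkewOn.contDiffAt_opCoord (hP : IsSmoothSkewOn O P) (h : IsFamily W Θ)
    (hO : ∀ e ∈ W, ∀ z, (Θ e).vel z ∈ O (Θ e z)) {c : M} {q : E × ℝ} (hq : q ∈ chartDom W Θ c) :
    ContDiffAt ℝ ∞ (opCoord P c) (jet (inCoord Θ c) (0, 1) q) := by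
  refine (hP.smooth c).contDiffAt ((hP.isOpen c).mem_nhds ?_)
  rw [h.jet_inCoord hq]
  exact mem_opDom hq.2 (hO _ hq.1 _)

variable [FiniteDimensional ℝ E] {I J : Loop N M → ℝ}

theorem contDiffAt_famDensity (hP : IsSmoothSkewOn O P) (hI : HasVariationalDeriv V I f)
    (hJ : HasVariationalDeriv V J g) (h : IsFamily W Θ) (hV : ∀ e ∈ W, Θ e ∈ V)
    (hO : ∀ e ∈ W, ∀ z, (Θ e).vel z ∈ O (Θ e z)) (q : E × ℝ) (hq : q.1 ∈ W) :
    ContDiffAt ℝ ∞ (famDensity P f g Θ) q := by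
  have hc : q ∈ chartDom W Θ (Θ q.1 (q.2 : UnitAddCircle)) := ⟨hq, mem_chart_source _ _⟩
  have hjet := contDiffAt_jet (h.contDiffAt_inCoord hc) (0, 1)
  refine ContDiffAt.congr_of_eventuallyEq ?_ (famDensity_eventuallyEq P f g h hc)
  exact (hI.contDiffAt_covCoord h hV hc).clm_apply
    (((hP.contDiffAt_opCoord h hO hc).comp q hjet).clm_apply (hJ.contDiffAt_covCoord h hV hc))

theorem contDiffAt_famVert (hP : IsSmoothSkewOn O P) (hI : HasVariationalDeriv V I f)
    (hJ : HasVariationalDeriv V J g) (h : IsFamily W Θ) (hV : ∀ e ∈ W, Θ e ∈ V)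
    (hO : ∀ e ∈ W, ∀ z, (Θ e).vel z ∈ O (Θ e z)) (τ : E) (q : E × ℝ) (hq : q.1 ∈ W) :
    ContDiffAt ℝ ∞ (famVert P f g Θ τ) q := by
  have hc : q ∈ chartDom W Θ (Θ q.1 (q.2 : UnitAddCircle)) := ⟨hq, mem_chart_source _ _⟩
  refine ContDiffAt.congr_of_eventuallyEq ?_ (famVert_eventuallyEq hP f g h hO τ hc)
  exact (contDiffAt_vertForm (hI.contDiffAt_covCoord h hV hc) (hJ.contDiffAt_covCoord h hV hc)
    (contDiffAt_jet (h.contDiffAt_inCoord hc) _) (hP.contDiffAt_opCoord h hO hc)).clm_apply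
    (contDiffAt_fderiv_apply (h.contDiffAt_inCoord hc) _)

theorem hasDerivAt_bracket_family (hP : IsSmoothSkewOn O P) (hI : HasVariationalDeriv V I f)
    (hJ : HasVariationalDeriv V J g) (h : IsFamily W Θ) (hV : ∀ e ∈ W, Θ e ∈ V)
    (hO : ∀ e ∈ W, ∀ z, (Θ e).vel z ∈ O (Θ e z)) {e : E} (he : e ∈ W) (τ : E) :
    HasDerivAt (fun σ : ℝ => bracket P f g (Θ (e + σ • τ)))
      (∫ x in (0 : ℝ)..1, fderiv ℝ (famDensity P f g Θ) (e, x) (τ, 0)) 0 := by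
  simp only [bracket_eq_integral_density]
  exact hasDerivAt_integral_line h.isOpen (contDiffAt_famDensity hP hI hJ h hV hO) he τ

end FamilyDensities

section Gradient

variable {N : ℕ} {M : Type*} [TopologicalSpace M] [ChartedSpace (Coord N) M]
variable {E : Type*} [NormedAddCommGroup E] [NormedSpace ℝ E]

/-- The derivative of the density of the bracket in the direction `τ`, up to terms whose integral
vanishes. -/
def defect (P : MatrixOperator N M) (f g : CovectorField N M) (Θ : E → Loop N M) (r s τ : E)
    (q : E × ℝ) : ℝ :=
  fderiv ℝ (famDensity P f g Θ) q (τ, 0)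
    - (fderiv ℝ (pairing f Θ s) q (τ, 0) - fderiv ℝ (pairing f Θ τ) q (s, 0))
    + (fderiv ℝ (pairing g Θ r) q (τ, 0) - fderiv ℝ (pairing g Θ τ) q (r, 0))
    - fderiv ℝ (famVert P f g Θ τ) q (0, 1)

/-- The components in the chart around `c` of the variational derivative of the bracket, computed
from a family of loops whose derivatives along `r` and `s` are the Hamiltonian vector fields of `f`
and `g`. -/
def gradCoord (P : MatrixOperator N M) (f g : CovectorField N M) (Θ : E → Loop N M) (r s : E)
    (c : M) (e : E) (z : UnitAddCircle) : Coord N →L[ℝ] ℝ :=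
  deriv (fun σ : ℝ => covCoord f c (Θ (e + σ • s)) z) 0
    - deriv (fun σ : ℝ => covCoord g c (Θ (e + σ • r)) z) 0
    + (covCoord f c (Θ e) z).comp (((fderiv ℝ (opCoord P c) (loopJet c (Θ e) z)).flip
        (covCoord g c (Θ e) z)).comp (ContinuousLinearMap.inl ℝ (Coord N) (Coord N)))
    - circDeriv (fun y => vertForm (covCoord f c (Θ e) y)
        (fderiv ℝ (opCoord P c) (loopJet c (Θ e) y)) (covCoord g c (Θ e) y)) z

/-- The variational derivative of the bracket at the loop `Θ e`, read off at each of its points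
in the chart around that point. -/
def gradCovector (P : MatrixOperator N M) (f g : CovectorField N M) (Θ : E → Loop N M) (r s : E)
    (e : E) (z : UnitAddCircle) : Cotan N (Θ e z) :=
  coordCovector (Θ e z) (Θ e z) (gradCoord P f g Θ r s (Θ e z) e z).toLinearMap

/-- At the parameter `e`, the derivative of the family `Θ` in the direction `r` is the Hamiltonian
vector field `P f`. -/
def IsHamiltonianDir (P : MatrixOperator N M) (f : CovectorField N M) (Θ : E → Loop N M) (r : E)
    (e : E) : Prop :=
  HasVariation Θ e r (Θ e) fun z => P (Θ e z) ((Θ e).vel z) (f (Θ e) z)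

variable [IsManifold (𝓡 N) ∞ M]
variable {P : MatrixOperator N M} {O : ∀ p : M, Set (Tan N p)} {f g : CovectorField N M}
  {V : Set (Loop N M)} {W : Set E} {Θ : E → Loop N M}

theorem IsHamiltonianDir.fderiv_eq {r e : E} (hr : IsHamiltonianDir P f Θ r e)
    (h : IsFamily W Θ) {c : M} {x : ℝ} (hq : (e, x) ∈ chartDom W Θ c) :
    fderiv ℝ (inCoord Θ c) (e, x) (r, 0) = opCoord P c (jet (inCoord Θ c) (0, 1) (e, x))
      (covCoord f c (Θ e) (x : UnitAddCircle)) := by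
  rw [hr.2 x c hq.2, h.jet_inCoord hq, loopJet]
  exact (opCoord_coframe P hq.2 _ _ _ (fun w => rfl)).symm

variable [FiniteDimensional ℝ E] {I J : Loop N M → ℝ}

theorem contDiffAt_defect (hP : IsSmoothSkewOn O P) (hI : HasVariationalDeriv V I f)
    (hJ : HasVariationalDeriv V J g) (h : IsFamily W Θ) (hV : ∀ e ∈ W, Θ e ∈ V)
    (hO : ∀ e ∈ W, ∀ z, (Θ e).vel z ∈ O (Θ e z)) (r s τ : E) (q : E × ℝ) (hq : q.1 ∈ W) :
    ContDiffAt ℝ ∞ (defect P f g Θ r s τ) q := by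
  have hf := fun v => hI.contDiffAt_pairing h hV v q hq
  have hg := fun v => hJ.contDiffAt_pairing h hV v q hq
  exact (((contDiffAt_fderiv_apply (contDiffAt_famDensity hP hI hJ h hV hO q hq) _).sub
    ((contDiffAt_fderiv_apply (hf s) _).sub (contDiffAt_fderiv_apply (hf τ) _))).add
    ((contDiffAt_fderiv_apply (hg r) _).sub (contDiffAt_fderiv_apply (hg τ) _))).sub
    (contDiffAt_fderiv_apply (contDiffAt_famVert hP hI hJ h hV hO τ q hq) _)

theorem IsSmoothSkewOn.circDeriv_vertForm_eq (hP : IsSmoothSkewOn O P)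
    (hI : HasVariationalDeriv V I f) (hJ : HasVariationalDeriv V J g) (h : IsFamily W Θ)
    (hV : ∀ e ∈ W, Θ e ∈ V) (hO : ∀ e ∈ W, ∀ z, (Θ e).vel z ∈ O (Θ e z)) {e : E} {x : ℝ} {c : M}
    (hq : (e, x) ∈ chartDom W Θ c) :
    circDeriv (fun y => vertForm (covCoord f c (Θ e) y)
        (fderiv ℝ (opCoord P c) (loopJet c (Θ e) y)) (covCoord g c (Θ e) y)) (x : UnitAddCircle)
      = fderiv ℝ (fun q : E × ℝ => vertForm (covCoord f c (Θ q.1) (q.2 : UnitAddCircle))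
        (fderiv ℝ (opCoord P c) (jet (inCoord Θ c) (0, 1) q))
        (covCoord g c (Θ q.1) (q.2 : UnitAddCircle))) (e, x) (0, 1) := by
  have hvert := contDiffAt_vertForm (hI.contDiffAt_covCoord h hV hq)
    (hJ.contDiffAt_covCoord h hV hq) (contDiffAt_jet (h.contDiffAt_inCoord hq) (0, 1))
    (hP.contDiffAt_opCoord h hO hq)
  rw [circDeriv_coe, ← deriv_slice_eq_fderiv (hvert.differentiableAt (by simp))]
  refine Filter.EventuallyEq.deriv_eq ?_
  have hslice : ContinuousAt (fun y : ℝ => (e, y)) x := by fun_prop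
  filter_upwards [hslice.eventually ((h.isOpen_chartDom c).mem_nhds hq)] with y hy
  rw [h.jet_inCoord hy]

theorem defect_eq_gradCoord (hP : IsSmoothSkewOn O P) (hI : HasVariationalDeriv V I f)
    (hJ : HasVariationalDeriv V J g) (h : IsFamily W Θ) (hV : ∀ e ∈ W, Θ e ∈ V)
    (hO : ∀ e ∈ W, ∀ z, (Θ e).vel z ∈ O (Θ e z)) {r s : E} (τ : E) {e : E} {x : ℝ} {c : M}
    (hr : IsHamiltonianDir P f Θ r e) (hs : IsHamiltonianDir P g Θ s e)
    (hq : (e, x) ∈ chartDom W Θ c) :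
    defect P f g Θ r s τ (e, x) = gradCoord P f g Θ r s c e (x : UnitAddCircle)
      (fderiv ℝ (inCoord Θ c) (e, x) (τ, 0)) := by
  have hf := hI.contDiffAt_covCoord h hV hq
  have hg := hJ.contDiffAt_covCoord h hV hq
  have hjet := h.jet_inCoord hq
  have hidentity := fderiv_bracket_density (0, 1) (r, 0) (s, 0) (τ, 0) (h.contDiffAt_inCoord hq)
    hf hg (hP.contDiffAt_opCoord h hO hq)
    (fun a b => by
      rw [hjet]
      exact opCoord_skew hq.2 (hP.skew _ _ (hO _ hq.1 _)) a b)
    (hr.fderiv_eq h hq) (hs.fderiv_eq h hq)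
  rw [defect, (famDensity_eventuallyEq P f g h hq).fderiv_eq,
    (pairing_eventuallyEq f h hq s).fderiv_eq, (pairing_eventuallyEq f h hq τ).fderiv_eq,
    (pairing_eventuallyEq g h hq r).fderiv_eq, (pairing_eventuallyEq g h hq τ).fderiv_eq,
    (famVert_eventuallyEq hP f g h hO τ hq).fderiv_eq, hidentity, gradCoord,
    hP.circDeriv_vertForm_eq hI hJ h hV hO hq,
    deriv_line_fst_eq_fderiv (hf.differentiableAt (by simp)) s,
    deriv_line_fst_eq_fderiv (hg.differentiableAt (by simp)) r, ← hjet]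
  rfl

theorem defect_eq_gradCoord_of_hasVariation (hP : IsSmoothSkewOn O P)
    (hI : HasVariationalDeriv V I f) (hJ : HasVariationalDeriv V J g) (h : IsFamily W Θ)
    (hV : ∀ e ∈ W, Θ e ∈ V) (hO : ∀ e ∈ W, ∀ z, (Θ e).vel z ∈ O (Θ e z)) {r s τ : E} {e : E}
    (he : e ∈ W) (hr : IsHamiltonianDir P f Θ r e) (hs : IsHamiltonianDir P g Θ s e)
    {γ : Loop N M} {Y : ∀ z : UnitAddCircle, Tan N (γ z)} (hτ : HasVariation Θ e τ γ Y) (x : ℝ) :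
    defect P f g Θ r s τ (e, x)
      = gradCoord P f g Θ r s (γ x) e (x : UnitAddCircle) (coframe (γ x) (γ x) (Y x)) := by
  obtain ⟨rfl, hτ⟩ := hτ
  rw [defect_eq_gradCoord hP hI hJ h hV hO τ hr hs ⟨he, mem_chart_source _ _⟩,
    hτ x _ (mem_chart_source _ _)]

theorem integral_defect_eq (hP : IsSmoothSkewOn O P) (hI : HasVariationalDeriv V I f)
    (hJ : HasVariationalDeriv V J g) (h : IsFamily W Θ) (hV : ∀ e ∈ W, Θ e ∈ V)
    (hO : ∀ e ∈ W, ∀ z, (Θ e).vel z ∈ O (Θ e z)) (r s τ : E) {e : E} (he : e ∈ W) :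
    ∫ x in (0 : ℝ)..1, defect P f g Θ r s τ (e, x)
      = ∫ x in (0 : ℝ)..1, fderiv ℝ (famDensity P f g Θ) (e, x) (τ, 0) := by
  have hdensity := contDiffAt_famDensity hP hI hJ h hV hO
  have hf := hI.contDiffAt_pairing h hV
  have hg := hJ.contDiffAt_pairing h hV
  have hvert := contDiffAt_famVert hP hI hJ h hV hO τ
  have hint : ∀ {b : E × ℝ → ℝ}, (∀ q : E × ℝ, q.1 ∈ W → ContDiffAt ℝ ∞ b q) → ∀ w : E × ℝ,
      IntervalIntegrable (fun x => fderiv ℝ b (e, x) w) MeasureTheory.volume 0 1 :=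
    fun hb w => (continuous_fderiv_slice hb he w).intervalIntegrable _ _
  have hperiodic : famVert P f g Θ τ (e, 1) = famVert P f g Θ τ (e, 0) := by
    have hcoe : ((1 : ℝ) : UnitAddCircle) = ((0 : ℝ) : UnitAddCircle) := by
      rw [AddCircle.coe_period, AddCircle.coe_zero]
    simp only [famVert]
    rw [hcoe]
  simp only [defect]
  rw [intervalIntegral.integral_sub (((hint hdensity _).sub ((hint (hf s) _).sub
      (hint (hf τ) _))).add ((hint (hg r) _).sub (hint (hg τ) _))) (hint hvert _),
    intervalIntegral.integral_add ((hint hdensity _).sub ((hint (hf s) _).sub (hint (hf τ) _)))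
      ((hint (hg r) _).sub (hint (hg τ) _)),
    intervalIntegral.integral_sub (hint hdensity _) ((hint (hf s) _).sub (hint (hf τ) _)),
    intervalIntegral.integral_sub (hint (hf s) _) (hint (hf τ) _),
    intervalIntegral.integral_sub (hint (hg r) _) (hint (hg τ) _),
    hI.second_variation_symm h hV he s τ, hJ.second_variation_symm h hV he r τ,
    integral_fderiv_circle_eq_zero hvert he hperiodic]
  ring

theorem hasDerivAt_bracket_defect (hP : IsSmoothSkewOn O P) (hI : HasVariationalDeriv V I f)
    (hJ : HasVariationalDeriv V J g) (h : IsFamily W Θ) (hV : ∀ e ∈ W, Θ e ∈ V)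
    (hO : ∀ e ∈ W, ∀ z, (Θ e).vel z ∈ O (Θ e z)) (r s τ : E) {e : E} (he : e ∈ W) :
    HasDerivAt (fun σ : ℝ => bracket P f g (Θ (e + σ • τ)))
      (∫ x in (0 : ℝ)..1, defect P f g Θ r s τ (e, x)) 0 := by
  rw [integral_defect_eq hP hI hJ h hV hO r s τ he]
  exact hasDerivAt_bracket_family hP hI hJ h hV hO he τ

end Gradient

section GradientUniqueness

theorem contDiff_smul_circle {F : Type*} [NormedAddCommGroup F] [NormedSpace ℝ F]
    {χ : UnitAddCircle → ℝ} (hχ : ContDiff ℝ ∞ fun x : ℝ => χ (x : UnitAddCircle)) {k : ℝ → F}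
    (hk : ∀ x : ℝ, (x : UnitAddCircle) ∈ tsupport χ → ContDiffAt ℝ ∞ k x) :
    ContDiff ℝ ∞ fun x : ℝ => χ (x : UnitAddCircle) • k x :=
  contDiff_iff_contDiffAt.mpr fun x =>
    (contDiffAt_of_mem_tsupport_circle hχ (k := fun q : ℝ × ℝ => k q.2) (q := (0, x))
      fun hx => (hk x hx).comp (0, x) contDiffAt_snd).comp x
        (contDiffAt_const.prodMk contDiffAt_id)

theorem eq_zero_of_forall_integral_mul_eq_zero_circle {U : Set UnitAddCircle} (hU : IsOpen U)
    {k : UnitAddCircle → ℝ}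
    (hk : ∀ x : ℝ, (x : UnitAddCircle) ∈ U → ContDiffAt ℝ ∞ (fun x : ℝ => k x) x)
    (hzero : ∀ φ : UnitAddCircle → ℝ, ContDiff ℝ ∞ (fun x : ℝ => φ x) → tsupport φ ⊆ U →
      ∫ x in (0 : ℝ)..1, φ x * k x = 0) {z : UnitAddCircle} (hz : z ∈ U) : k z = 0 := by
  by_contra hne
  obtain ⟨χ, hχ, hχU, hχ_nonneg, hχz⟩ := exists_smooth_bump_circle hU hz
  obtain ⟨x, hx, rfl⟩ := exists_mem_Icc_coe_eq z
  have hχk : ContDiff ℝ ∞ fun x : ℝ => χ x * k x :=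
    contDiff_smul_circle hχ fun x hx => hk x (hχU hx)
  have hχkk : ContDiff ℝ ∞ fun x : ℝ => χ x * (k x * k x) :=
    contDiff_smul_circle hχ fun x hx => (hk x (hχU hx)).mul (hk x (hχU hx))
  have hint := hzero (fun z => χ z * k z) hχk ((tsupport_mul_subset_left).trans hχU)
  simp only [mul_assoc] at hint
  refine (intervalIntegral.integral_pos zero_lt_one hχkk.continuous.continuousOn
    (fun x _ => mul_nonneg (hχ_nonneg _) (mul_self_nonneg _)) ⟨x, hx, ?_⟩).ne' hint
  exact mul_pos ((hχ_nonneg _).lt_of_ne' hχz) (mul_self_pos.mpr hne)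

variable {N : ℕ} {M : Type*} [TopologicalSpace M] [ChartedSpace (Coord N) M]

/-- A smooth vector field along the part of the loop `γ` over `K`, supported in the domain of the
chart around `c` and given by its components `b` there; these fields test the variational derivative
at `γ`. -/
structure IsTestField (c : M) (K : Set UnitAddCircle) (b : UnitAddCircle → Coord N)
    (γ : Loop N M) : Prop where
  isClosed : IsClosed K
  mem_source : ∀ z ∈ K, γ z ∈ (chartAt (Coord N) c).source
  contDiff : ContDiff ℝ ∞ fun x : ℝ => b (x : UnitAddCircle)
  eq_zero : ∀ z ∉ K, b z = 0

/-- For all small `τ` the loop `δ τ` arises from `γ` by adding `τ b` in the chart around `c`. -/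
def IsPerturbation (c : M) (K : Set UnitAddCircle) (b : UnitAddCircle → Coord N) (γ : Loop N M)
    (δ : ℝ → Loop N M) : Prop :=
  ∀ᶠ τ in 𝓝 (0 : ℝ), IsChartShift c K (τ • b) γ (δ τ)

theorem IsPerturbation.eventuallyEq {c : M} {K : Set UnitAddCircle} {b : UnitAddCircle → Coord N}
    {γ : Loop N M} {δ δ' : ℝ → Loop N M} (h : IsPerturbation c K b γ δ)
    (h' : IsPerturbation c K b γ δ') : δ =ᶠ[𝓝 0] δ' := by
  filter_upwards [h, h'] with τ hτ hτ' using hτ.unique hτ'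

/-- The covector field `h` along `γ` is smooth, and it is the variational derivative of `F` at `γ`
as far as perturbations in charts are concerned. -/
structure IsGradientAt (F : Loop N M → ℝ) (γ : Loop N M)
    (h : ∀ z : UnitAddCircle, Cotan N (γ z)) : Prop where
  smooth : ∀ (c : M) (w : Coord N) (x : ℝ), γ x ∈ (chartAt (Coord N) c).source →
    ContDiffAt ℝ ∞ (fun x : ℝ => h (x : UnitAddCircle) (frame c (γ (x : UnitAddCircle)) w)) x
  deriv : ∀ (c : M) (K : Set UnitAddCircle) (b : UnitAddCircle → Coord N), IsTestField c K b γ →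
    ∀ δ : ℝ → Loop N M, IsPerturbation c K b γ δ → HasDerivAt (fun τ => F (δ τ))
      (∫ x in (0 : ℝ)..1, h x (frame c (γ (x : UnitAddCircle)) (b x))) 0

theorem IsTestField.smul_const {γ : Loop N M} {c : M} {φ : UnitAddCircle → ℝ}
    (hφ : ContDiff ℝ ∞ fun x : ℝ => φ (x : UnitAddCircle))
    (hφγ : tsupport φ ⊆ γ.toFun ⁻¹' (chartAt (Coord N) c).source) (w : Coord N) :
    IsTestField c (tsupport φ) (fun z => φ z • w) γ where
  isClosed := isClosed_tsupport φ
  mem_source := fun _ hz => hφγ hz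
  contDiff := hφ.smul contDiff_const
  eq_zero := fun z hz => by rw [image_eq_zero_of_notMem_tsupport hz, zero_smul]

variable [IsManifold (𝓡 N) ∞ M]

theorem IsTestField.exists_isPerturbation {c : M} {K : Set UnitAddCircle}
    {b : UnitAddCircle → Coord N} {γ : Loop N M} (hb : IsTestField c K b γ) :
    ∃ δ, IsPerturbation c K b γ δ := by
  obtain ⟨W, δ, -, hW, hδ, -, hshift⟩ := (isFamily_const (E := ℝ) γ).exists_chartShift
    (e₀ := 0) trivial c hb.isClosed hb.mem_source (B := fun τ => τ • b)
    (ContDiff.contDiffOn (contDiff_fst.smul (hb.contDiff.comp contDiff_snd))) (zero_smul ℝ b)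
    (fun τ _ z hz => by rw [Pi.smul_apply, hb.eq_zero z hz, smul_zero])
  exact ⟨δ, Filter.mem_of_superset (hδ.isOpen.mem_nhds hW) hshift⟩

theorem IsGradientAt.unique {F : Loop N M → ℝ} {γ : Loop N M}
    {h h' : ∀ z : UnitAddCircle, Cotan N (γ z)} (hh : IsGradientAt F γ h)
    (hh' : IsGradientAt F γ h') : h = h' := by
  funext z
  let c : M := γ z
  have hz : γ z ∈ (chartAt (Coord N) c).source := mem_chart_source _ _
  suffices hdiff : ∀ w : Coord N, (h z - h' z) (frame c (γ z) w) = 0 by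
    refine LinearMap.ext fun ξ => sub_eq_zero.mp ?_
    rw [← LinearMap.sub_apply, ← frame_coframe hz ξ]
    exact hdiff _
  intro w
  refine eq_zero_of_forall_integral_mul_eq_zero_circle
    (k := fun z => (h z - h' z) (frame c (γ z) w))
    ((chartAt (Coord N) c).open_source.preimage γ.continuous)
    (fun x hx => (hh.smooth c w x hx).sub (hh'.smooth c w x hx)) (fun φ hφ hφγ => ?_) hz
  have htest := IsTestField.smul_const hφ hφγ w
  obtain ⟨δ, hδ⟩ := htest.exists_isPerturbation
  have hintegrable : ∀ u : ∀ z : UnitAddCircle, Cotan N (γ z), IsGradientAt F γ u →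
      IntervalIntegrable (fun x : ℝ => φ x * u x (frame c (γ (x : UnitAddCircle)) w))
        MeasureTheory.volume 0 1 := fun u hu =>
    (contDiff_smul_circle hφ fun x hx => hu.smooth c w x (hφγ hx)).continuous.intervalIntegrable _ _
  have heq := (hh.deriv c _ _ htest δ hδ).unique (hh'.deriv c _ _ htest δ hδ)
  simp only [map_smul, smul_eq_mul] at heq
  simp only [LinearMap.sub_apply, mul_sub]
  rw [intervalIntegral.integral_sub (hintegrable h hh) (hintegrable h' hh'), heq, sub_self]

end GradientUniqueness

section TestFamilies

variable {N : ℕ} {M : Type*} [TopologicalSpace M] [ChartedSpace (Coord N) M]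
variable {E : Type*} [NormedAddCommGroup E] [NormedSpace ℝ E]

theorem IsLoopOpen.isOpen_family [FiniteDimensional ℝ E] {V : Set (Loop N M)} (hV : IsLoopOpen V)
    {W : Set E} {Θ : E → Loop N M} (h : IsFamily W Θ) : IsOpen {e | e ∈ W ∧ Θ e ∈ V} := by
  let L : (Fin (Module.finrank ℝ E) → ℝ) ≃L[ℝ] E := ContinuousLinearEquiv.ofFinrankEq (by simp)
  have hcoord := hV _ (L ⁻¹' W) (Θ ∘ L) (isSmoothFamily_iff.mpr
    ⟨h.comp (h.isOpen.preimage L.continuous) L.contDiff (fun _ ht => ht), fun _ _ => trivial⟩)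
  convert hcoord.preimage L.symm.continuous using 1
  ext e
  simp

/-- The family of loops `Θ'`, with values in `V`, extends the family `Θ` by one more parameter `τ`,
in which it adds `τ b` in the chart around `c` to the loops of `Θ`. -/
structure IsTestFamily (V : Set (Loop N M)) (W : Set E) (Θ : E → Loop N M) (c : M)
    (K : Set UnitAddCircle) (b : UnitAddCircle → Coord N) (W' : Set (E × ℝ))
    (Θ' : E × ℝ → Loop N M) : Prop where
  isFamily : IsFamily W' Θ'
  mem : ∀ p ∈ W', Θ' p ∈ V
  fst_mem : ∀ p ∈ W', p.1 ∈ W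
  apply_zero : ∀ e, Θ' (e, 0) = Θ e
  isChartShift : ∀ p ∈ W', IsChartShift c K (p.2 • b) (Θ p.1) (Θ' p)

variable {V : Set (Loop N M)} {W : Set E} {Θ : E → Loop N M} {c : M} {K : Set UnitAddCircle}
  {b : UnitAddCircle → Coord N} {W' : Set (E × ℝ)} {Θ' : E × ℝ → Loop N M}

theorem IsTestFamily.isPerturbation (hΘ' : IsTestFamily V W Θ c K b W' Θ') {e : E}
    (he : (e, 0) ∈ W') : IsPerturbation c K b (Θ e) fun σ => Θ' ((e, 0) + σ • (0, 1)) := by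
  have hcont : Continuous fun σ : ℝ => ((e, 0) : E × ℝ) + σ • (0, 1) := by fun_prop
  filter_upwards [hcont.continuousAt.eventually (hΘ'.isFamily.isOpen.mem_nhds (by simpa using he))]
    with σ hσ
  simpa using hΘ'.isChartShift _ hσ

theorem gradCoord_prodMk_zero {F : Type*} [NormedAddCommGroup F] [NormedSpace ℝ F]
    {Θ' : E × F → Loop N M} (hΘ' : ∀ e, Θ' (e, 0) = Θ e) (P : MatrixOperator N M)
    (f g : CovectorField N M) (r s : E) (c : M) (e : E) (z : UnitAddCircle) :
    gradCoord P f g Θ' (r, 0) (s, 0) c (e, 0) z = gradCoord P f g Θ r s c e z := by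
  simp only [gradCoord, Prod.smul_mk, Prod.mk_add_mk, smul_zero, add_zero, hΘ']

variable [IsManifold (𝓡 N) ∞ M]

theorem HasVariation.congr_line {F : Type*} [NormedAddCommGroup F] [NormedSpace ℝ F] {e v : E}
    {γ : Loop N M} {X : ∀ z : UnitAddCircle, Tan N (γ z)} (hX : HasVariation Θ e v γ X)
    (hΘ : IsFamily W Θ) (he : e ∈ W) {W₁ : Set F} {Θ₁ : F → Loop N M} (hΘ₁ : IsFamily W₁ Θ₁)
    {e₁ v₁ : F} (he₁ : e₁ ∈ W₁) (hline : ∀ σ : ℝ, Θ₁ (e₁ + σ • v₁) = Θ (e + σ • v)) :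
    HasVariation Θ₁ e₁ v₁ γ X := by
  have hγ : Θ₁ e₁ = Θ e := by simpa using hline 0
  refine ⟨hγ.trans hX.1, fun x c hc => ?_⟩
  rw [← hX.2 x c hc]
  obtain ⟨rfl, -⟩ := hX
  refine (hΘ₁.hasDerivAt_inCoord ⟨he₁, by rwa [hγ]⟩ v₁).unique ?_
  simpa only [inCoord, hline] using hΘ.hasDerivAt_inCoord ⟨he, hc⟩ v

theorem IsFamily.hasVariation_mfderiv (h : IsFamily W Θ) {e : E} (he : e ∈ W) (v : E) :
    HasVariation Θ e v (Θ e) fun z => mfderiv 𝓘(ℝ, E) (𝓡 N) (fun e => Θ e z) e v :=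
  ⟨rfl, fun _ _ hc => (h.coframe_mfderiv_param ⟨he, hc⟩ v).symm⟩

theorem IsTestFamily.hasVariation (hΘ' : IsTestFamily V W Θ c K b W' Θ') (hΘ : IsFamily W Θ)
    (hbK : ∀ z ∉ K, b z = 0) {e : E} (he : (e, 0) ∈ W') :
    HasVariation Θ' (e, 0) (0, 1) (Θ e) fun z => frame c (Θ e z) (b z) := by
  have hfst : IsFamily (Prod.fst ⁻¹' W) (Θ ∘ (Prod.fst : E × ℝ → E)) :=
    hΘ.comp (hΘ.isOpen.preimage continuous_fst) contDiff_fst fun _ hp => hp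
  have he' : (e, (0 : ℝ)) ∈ Prod.fst ⁻¹' W := hΘ'.fst_mem _ he
  have hconst : HasVariation (Θ ∘ Prod.fst) (e, (0 : ℝ)) (0, 1) (Θ e) fun _ => 0 :=
    hfst.hasVariation_of_const_line he' fun σ => by simp
  have hshift := hconst.chartShift hfst hΘ'.isFamily hΘ'.isChartShift he' he (hΘ'.apply_zero e)
    (Y := fun z => frame c (Θ e z) (b z)) (fun x hx => ?_)
    (fun x hx => by simp only [hbK _ hx, map_zero])
  · simpa only [zero_add] using hshift
  · rw [coframe_frame ((hΘ'.isChartShift _ he).mem_source _ hx)]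
    simpa using (hasDerivAt_id (0 : ℝ)).smul_const (b x)

theorem IsTestFamily.isHamiltonianDir (hΘ' : IsTestFamily V W Θ c K b W' Θ') (hΘ : IsFamily W Θ)
    {P : MatrixOperator N M} {f : CovectorField N M} {r e : E} (hr : IsHamiltonianDir P f Θ r e)
    (he : (e, 0) ∈ W') : IsHamiltonianDir P f Θ' (r, 0) (e, 0) := by
  rw [IsHamiltonianDir, hΘ'.apply_zero]
  exact hr.congr_line hΘ (hΘ'.fst_mem _ he) hΘ'.isFamily he fun σ => by simp [hΘ'.apply_zero]

variable [FiniteDimensional ℝ E]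

theorem IsTestField.exists_isTestFamily {e₀ : E} (hb : IsTestField c K b (Θ e₀))
    (hVo : IsLoopOpen V) (h : IsFamily W Θ) (hV : ∀ e ∈ W, Θ e ∈ V) (he₀ : e₀ ∈ W) :
    ∃ W' Θ', IsTestFamily V W Θ c K b W' Θ' ∧ (e₀, 0) ∈ W' := by
  have hfst : IsFamily (Prod.fst ⁻¹' W) (Θ ∘ (Prod.fst : E × ℝ → E)) :=
    h.comp (h.isOpen.preimage continuous_fst) contDiff_fst fun _ hp => hp
  obtain ⟨W₁, Θ', hW₁, hmem, hΘ', hzero, hshift⟩ := hfst.exists_chartShift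
    (e₀ := (e₀, 0)) he₀ c hb.isClosed hb.mem_source (B := fun p => p.2 • b)
    (ContDiff.contDiffOn
      ((contDiff_snd.comp contDiff_fst).smul (hb.contDiff.comp contDiff_snd)))
    (zero_smul ℝ b) (fun p _ z hz => by rw [Pi.smul_apply, hb.eq_zero z hz, smul_zero])
  have hΘ'_zero : ∀ e, Θ' (e, 0) = Θ e := fun e => hzero (e, 0) (zero_smul ℝ b)
  exact ⟨{p | p ∈ W₁ ∧ Θ' p ∈ V}, Θ',
    { isFamily := hΘ'.mono (hVo.isOpen_family hΘ') fun _ hp => hp.1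
      mem := fun _ hp => hp.2
      fst_mem := fun _ hp => hW₁ hp.1
      apply_zero := hΘ'_zero
      isChartShift := fun p hp => hshift p hp.1 },
    hmem, by rw [hΘ'_zero]; exact hV e₀ he₀⟩

variable {P : MatrixOperator N M} {O : ∀ p : M, Set (Tan N p)} {f g : CovectorField N M}
  {I J : Loop N M → ℝ}

theorem IsTestFamily.defect_eq (hΘ' : IsTestFamily V W Θ c K b W' Θ') (hΘ : IsFamily W Θ)
    (hbK : ∀ z ∉ K, b z = 0) (hP : IsSmoothSkewOn O P) (hI : HasVariationalDeriv V I f)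
    (hJ : HasVariationalDeriv V J g) (hVO : ∀ γ ∈ V, ∀ z, γ.vel z ∈ O (γ z)) {r s e : E}
    (he : (e, 0) ∈ W') (hr : IsHamiltonianDir P f Θ r e) (hs : IsHamiltonianDir P g Θ s e)
    (x : ℝ) :
    defect P f g Θ' (r, 0) (s, 0) (0, 1) ((e, 0), x) = gradCovector P f g Θ r s e
      (x : UnitAddCircle) (frame c (Θ e (x : UnitAddCircle)) (b x)) := by
  rw [defect_eq_gradCoord_of_hasVariation hP hI hJ hΘ'.isFamily hΘ'.mem
    (fun p hp => hVO _ (hΘ'.mem p hp)) he (hΘ'.isHamiltonianDir hΘ hr he)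
    (hΘ'.isHamiltonianDir hΘ hs he) (hΘ'.hasVariation hΘ hbK he),
    gradCoord_prodMk_zero hΘ'.apply_zero]
  rfl

theorem hasDerivAt_bracket_isPerturbation (hP : IsSmoothSkewOn O P)
    (hI : HasVariationalDeriv V I f) (hJ : HasVariationalDeriv V J g) (hVo : IsLoopOpen V)
    (hVO : ∀ γ ∈ V, ∀ z, γ.vel z ∈ O (γ z)) (hΘ : IsFamily W Θ) (hV : ∀ e ∈ W, Θ e ∈ V)
    {r s e : E} (he : e ∈ W) (hr : IsHamiltonianDir P f Θ r e) (hs : IsHamiltonianDir P g Θ s e)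
    (hb : IsTestField c K b (Θ e)) {δ : ℝ → Loop N M} (hδ : IsPerturbation c K b (Θ e) δ) :
    HasDerivAt (fun τ => bracket P f g (δ τ))
      (∫ x in (0 : ℝ)..1, gradCovector P f g Θ r s e (x : UnitAddCircle)
        (frame c (Θ e (x : UnitAddCircle)) (b x))) 0 := by
  obtain ⟨W', Θ', hΘ', he'⟩ := hb.exists_isTestFamily hVo hΘ hV he
  have hderiv := hasDerivAt_bracket_defect hP hI hJ hΘ'.isFamily hΘ'.mem
    (fun p hp => hVO _ (hΘ'.mem p hp)) (r, 0) (s, 0) (0, 1) he'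
  simp only [hΘ'.defect_eq hΘ hb.eq_zero hP hI hJ hVO he' hr hs] at hderiv
  refine hderiv.congr_of_eventuallyEq ?_
  filter_upwards [hδ.eventuallyEq (hΘ'.isPerturbation he')] with σ hσ
  rw [hσ]

theorem exists_contDiffAt_eventually_gradCovector_eq (hP : IsSmoothSkewOn O P)
    (hI : HasVariationalDeriv V I f) (hJ : HasVariationalDeriv V J g) (hVo : IsLoopOpen V)
    (hVO : ∀ γ ∈ V, ∀ z, γ.vel z ∈ O (γ z)) (hΘ : IsFamily W Θ) (hV : ∀ e ∈ W, Θ e ∈ V)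
    (r s : E) (c : M) (w : Coord N) {q₀ : E × ℝ} (hq₀ : q₀ ∈ chartDom W Θ c) :
    ∃ D : E × ℝ → ℝ, ContDiffAt ℝ ∞ D q₀ ∧ ∀ᶠ q in 𝓝 q₀,
      IsHamiltonianDir P f Θ r q.1 → IsHamiltonianDir P g Θ s q.1 →
        gradCovector P f g Θ r s q.1 (q.2 : UnitAddCircle)
          (frame c (Θ q.1 (q.2 : UnitAddCircle)) w) = D q := by
  obtain ⟨χ, hχ, hχc, -, hχ₀⟩ := exists_smooth_bump_circle
    ((chartAt (Coord N) c).open_source.preimage (Θ q₀.1).continuous) hq₀.2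
  have htest := IsTestField.smul_const hχ hχc w
  obtain ⟨W', Θ', hΘ', hmem⟩ := htest.exists_isTestFamily hVo hΘ hV hq₀.1
  have hχ_snd : ContDiffAt ℝ ∞ (fun q : E × ℝ => χ (q.2 : UnitAddCircle)) q₀ :=
    (hχ.comp contDiff_snd).contDiffAt
  have hdefect : ContDiffAt ℝ ∞
      (fun q : E × ℝ => defect P f g Θ' (r, 0) (s, 0) (0, 1) ((q.1, 0), q.2)) q₀ :=
    (contDiffAt_defect hP hI hJ hΘ'.isFamily hΘ'.mem (fun p hp => hVO _ (hΘ'.mem p hp)) _ _ _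
      ((q₀.1, 0), q₀.2) hmem).comp q₀ (f := fun q : E × ℝ => ((q.1, (0 : ℝ)), q.2)) (by fun_prop)
  refine ⟨fun q => (χ (q.2 : UnitAddCircle))⁻¹
    * defect P f g Θ' (r, 0) (s, 0) (0, 1) ((q.1, 0), q.2), (hχ_snd.inv hχ₀).mul hdefect, ?_⟩
  have hzero : ContinuousAt (fun q : E × ℝ => (q.1, (0 : ℝ))) q₀ := by fun_prop
  filter_upwards [hzero.eventually (hΘ'.isFamily.isOpen.mem_nhds hmem),
    hχ_snd.continuousAt.eventually_ne hχ₀] with q hq hχq hr hs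
  rw [hΘ'.defect_eq hΘ htest.eq_zero hP hI hJ hVO hq hr hs, map_smul, map_smul, smul_eq_mul,
    inv_mul_cancel_left₀ hχq]

end TestFamilies

section LocalGradients

variable {N : ℕ} {M : Type*} [TopologicalSpace M] [ChartedSpace (Coord N) M]
variable {E : Type*} [NormedAddCommGroup E] [NormedSpace ℝ E]

/-- Over the set `U` of parameters the covector fields `h e` along the loops `Γ e` of a family are
the variational derivative of `F`, and they depend smoothly on the parameters. -/
structure IsLocalGradient (F : Loop N M → ℝ) (Γ : E → Loop N M) (U : Set E)
    (h : ∀ (e : E) (z : UnitAddCircle), Cotan N (Γ e z)) : Prop where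
  isOpen : IsOpen U
  isGradientAt : ∀ e ∈ U, IsGradientAt F (Γ e) (h e)
  hasDerivAt : ∀ e ∈ U, ∀ v : E, HasDerivAt (fun σ : ℝ => F (Γ (e + σ • v)))
    (∫ x in (0 : ℝ)..1, h e (x : UnitAddCircle)
      (mfderiv 𝓘(ℝ, E) (𝓡 N) (fun e => Γ e (x : UnitAddCircle)) e v)) 0
  contDiffAt : ∀ (c : M) (w : Coord N), ∀ q ∈ chartDom U Γ c, ContDiffAt ℝ ∞
    (fun q : E × ℝ => h q.1 (q.2 : UnitAddCircle) (frame c (Γ q.1 (q.2 : UnitAddCircle)) w)) q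

variable [IsManifold (𝓡 N) ∞ M]
variable {P : MatrixOperator N M} {O : ∀ p : M, Set (Tan N p)} {f g : CovectorField N M}
  {V : Set (Loop N M)} {W U : Set E} {Θ Γ : E → Loop N M} {I J : Loop N M → ℝ}

variable [FiniteDimensional ℝ E]

theorem contDiffOn_hamiltonian (hP : IsSmoothSkewOn O P) (hI : HasVariationalDeriv V I f)
    (h : IsFamily W Θ) (hV : ∀ e ∈ W, Θ e ∈ V) (hO : ∀ e ∈ W, ∀ z, (Θ e).vel z ∈ O (Θ e z))
    (c : M) : ContDiffOn ℝ ∞ (fun q : E × ℝ => coframe c (Θ q.1 (q.2 : UnitAddCircle))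
      (P (Θ q.1 (q.2 : UnitAddCircle)) ((Θ q.1).vel (q.2 : UnitAddCircle))
        (f (Θ q.1) (q.2 : UnitAddCircle)))) (chartDom W Θ c) := by
  intro q hq
  have hcoord := ((hP.contDiffAt_opCoord h hO hq).comp q
    (contDiffAt_jet (h.contDiffAt_inCoord hq) _)).clm_apply (hI.contDiffAt_covCoord h hV hq)
  refine (hcoord.congr_of_eventuallyEq ?_).contDiffWithinAt
  filter_upwards [(h.isOpen_chartDom c).mem_nhds hq] with q' hq'
  simp only [Function.comp]
  rw [h.jet_inCoord hq', loopJet]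
  exact (opCoord_coframe P hq'.2 _ _ _ (fun w => rfl)).symm

theorem isLocalGradient_gradCovector {G : Type*} [NormedAddCommGroup G] [NormedSpace ℝ G]
    [FiniteDimensional ℝ G] {W : Set (E × G)} {Θ : E × G → Loop N M} {r s : E × G}
    (hP : IsSmoothSkewOn O P) (hI : HasVariationalDeriv V I f) (hJ : HasVariationalDeriv V J g)
    (hVo : IsLoopOpen V) (hVO : ∀ γ ∈ V, ∀ z, γ.vel z ∈ O (γ z)) (hΘ : IsFamily W Θ)
    (hV : ∀ p ∈ W, Θ p ∈ V) (hr : ∀ e, (e, 0) ∈ W → IsHamiltonianDir P f Θ r (e, 0))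
    (hs : ∀ e, (e, 0) ∈ W → IsHamiltonianDir P g Θ s (e, 0)) :
    IsLocalGradient (bracket P f g) (fun e => Θ (e, 0)) {e | (e, 0) ∈ W}
      fun e => gradCovector P f g Θ r s (e, 0) := by
  have hO : ∀ p ∈ W, ∀ z, (Θ p).vel z ∈ O (Θ p z) := fun p hp => hVO _ (hV p hp)
  have hzero : Continuous fun e : E => (e, (0 : G)) := by fun_prop
  have hU : IsOpen {e : E | (e, (0 : G)) ∈ W} := hΘ.isOpen.preimage hzero
  have hΓ : IsFamily {e : E | (e, (0 : G)) ∈ W} fun e => Θ (e, 0) :=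
    hΘ.comp hU (L := fun e : E => (e, (0 : G))) (by fun_prop) fun _ he => he
  have hsmooth : ∀ (c : M) (w : Coord N), ∀ q ∈ chartDom {e : E | (e, (0 : G)) ∈ W}
      (fun e => Θ (e, 0)) c, ContDiffAt ℝ ∞ (fun q : E × ℝ =>
        gradCovector P f g Θ r s (q.1, 0) (q.2 : UnitAddCircle)
          (frame c (Θ (q.1, 0) (q.2 : UnitAddCircle)) w)) q := by
    rintro c w ⟨e, x⟩ hq
    have hslice : ContDiffAt ℝ ∞ (fun q : E × ℝ => ((q.1, (0 : G)), q.2)) (e, x) := by fun_prop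
    obtain ⟨D, hD, hDeq⟩ := exists_contDiffAt_eventually_gradCovector_eq hP hI hJ hVo hVO hΘ hV
      r s c w (q₀ := ((e, 0), x)) hq
    refine (hD.comp (e, x) hslice).congr_of_eventuallyEq ?_
    filter_upwards [hslice.continuousAt.eventually hDeq, continuousAt_fst.eventually
      (hU.mem_nhds hq.1)] with q hDq hq
    exact hDq (hr _ hq) (hs _ hq)
  refine ⟨hU, fun e he => ⟨fun c w x hx => ?_, fun c K b hb δ hδ => ?_⟩, fun e he v => ?_, hsmooth⟩
  · exact (hsmooth c w (e, x) ⟨he, hx⟩).comp x (f := fun x : ℝ => (e, x)) (by fun_prop)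
  · exact hasDerivAt_bracket_isPerturbation hP hI hJ hVo hVO hΘ hV he (hr e he) (hs e he) hb hδ
  · have hvariation : HasVariation Θ (e, 0) (v, 0) _ _ :=
      (hΓ.hasVariation_mfderiv he v).congr_line hΓ he hΘ he fun σ => by simp
    have hderiv := hasDerivAt_bracket_defect hP hI hJ hΘ hV hO r s (v, 0) he
    simp only [defect_eq_gradCoord_of_hasVariation hP hI hJ hΘ hV hO he (hr e he) (hs e he)
      hvariation, Prod.smul_mk, Prod.mk_add_mk, smul_zero, add_zero] at hderiv
    exact hderiv

theorem exists_isLocalGradient_bracket (hP : IsSmoothSkewOn O P) (hI : HasVariationalDeriv V I f)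
    (hJ : HasVariationalDeriv V J g) (hVo : IsLoopOpen V)
    (hVO : ∀ γ ∈ V, ∀ z, γ.vel z ∈ O (γ z)) (hΓ : IsFamily W Γ) (hV : ∀ e ∈ W, Γ e ∈ V) {e₀ : E}
    (he₀ : e₀ ∈ W) : ∃ U h, e₀ ∈ U ∧ IsLocalGradient (bracket P f g) Γ U h := by
  have hO : ∀ e ∈ W, ∀ z, (Γ e).vel z ∈ O (Γ e z) := fun e he => hVO _ (hV e he)
  obtain ⟨W', Θ, hΘ⟩ := hΓ.exists_extension he₀ (ι := Bool)
    (fun i e z => P (Γ e z) ((Γ e).vel z) (if i then g (Γ e) z else f (Γ e) z)) (fun i c => by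
      cases i
      · exact contDiffOn_hamiltonian hP hI hΓ hV hO c
      · exact contDiffOn_hamiltonian hP hJ hΓ hV hO c)
  obtain rfl : Γ = fun e => Θ (e, 0) := funext fun e => (hΘ.apply_zero e).symm
  exact ⟨{e | (e, 0) ∈ W' ∧ Θ (e, 0) ∈ V}, _, ⟨hΘ.mem, hV e₀ he₀⟩,
    isLocalGradient_gradCovector (r := (0, Pi.single false 1)) (s := (0, Pi.single true 1))
    (W := {p | p ∈ W' ∧ Θ p ∈ V}) hP hI hJ hVo hVO
    (hΘ.isFamily.mono (hVo.isOpen_family hΘ.isFamily) fun _ hp => hp.1) (fun _ hp => hp.2)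
    (fun e he => hΘ.hasVariation e he.1 false) (fun e he => hΘ.hasVariation e he.1 true)⟩

open Classical in
theorem exists_hasVariationalDeriv_bracket (hP : IsSmoothSkewOn O P)
    (hI : HasVariationalDeriv V I f) (hJ : HasVariationalDeriv V J g) (hVo : IsLoopOpen V)
    (hVO : ∀ γ ∈ V, ∀ z, γ.vel z ∈ O (γ z)) :
    ∃ dIJ : CovectorField N M, HasVariationalDeriv V (bracket P f g) dIJ := by
  let dIJ : CovectorField N M := fun γ =>
    if h : ∃ h, IsGradientAt (bracket P f g) γ h then h.choose else 0
  have hdIJ : ∀ γ h, IsGradientAt (bracket P f g) γ h → dIJ γ = h := by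
    intro γ h hh
    have hex : ∃ h, IsGradientAt (bracket P f g) γ h := ⟨h, hh⟩
    simp only [dIJ, dif_pos hex]
    exact hex.choose_spec.unique hh
  refine ⟨dIJ, ⟨fun k W Γ hΓ c w => ?_, fun k W Γ hΓ t ht v => ?_⟩⟩ <;>
    obtain ⟨hfamily, hV⟩ := isSmoothFamily_iff.mp hΓ
  · rintro ⟨t, x⟩ ⟨ht, hx⟩
    obtain ⟨U, h, htU, hU⟩ := exists_isLocalGradient_bracket hP hI hJ hVo hVO hfamily hV ht
    refine ((hU.contDiffAt c w (t, x) ⟨htU, hx⟩).congr_of_eventuallyEq ?_).contDiffWithinAt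
    filter_upwards [continuousAt_fst.eventually (hU.isOpen.mem_nhds htU)] with q hq
    rw [hdIJ _ _ (hU.isGradientAt q.1 hq)]
  · obtain ⟨U, h, htU, hU⟩ := exists_isLocalGradient_bracket hP hI hJ hVo hVO hfamily hV ht
    rw [hdIJ _ _ (hU.isGradientAt t htU)]
    exact hU.hasDerivAt t htU v

end LocalGradients

section Trilinear

set_option maxSynthPendingDepth 5

variable {C : Type*} [NormedAddCommGroup C] [NormedSpace ℝ C]

/-- Alternating trilinear forms as iterated linear maps. -/
def triCLM : (C [⋀^Fin 3]→L[ℝ] ℝ) →L[ℝ] (C →L[ℝ] C →L[ℝ] C →L[ℝ] ℝ) :=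
  let curryTwo : ContinuousMultilinearMap ℝ (fun _ : Fin 2 => C) ℝ →L[ℝ] (C →L[ℝ] C →L[ℝ] ℝ) :=
    (ContinuousLinearMap.compL ℝ C _ (C →L[ℝ] ℝ)
      (continuousMultilinearCurryFin1 ℝ C ℝ).toContinuousLinearEquiv.toContinuousLinearMap).comp
    (continuousMultilinearCurryLeftEquiv ℝ
      (fun _ : Fin 2 => C) ℝ).toContinuousLinearEquiv.toContinuousLinearMap
  (ContinuousLinearMap.compL ℝ C _ (C →L[ℝ] C →L[ℝ] ℝ) curryTwo).comp
    ((continuousMultilinearCurryLeftEquiv ℝ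
      (fun _ : Fin 3 => C) ℝ).toContinuousLinearEquiv.toContinuousLinearMap.comp
      (ContinuousAlternatingMap.toContinuousMultilinearMapCLM ℝ))

theorem triCLM_apply (A : C [⋀^Fin 3]→L[ℝ] ℝ) (a b c : C) : triCLM A a b c = A ![a, b, c] := by
  change A (Fin.cons a (Fin.cons b (fun _ => c))) = _
  congr 1
  ext i; fin_cases i <;> rfl

/-- The derivative of `A(X₀, X₁, X₂)` by the Leibniz rule, where `A'` and `X'` are the derivatives
of `A` and `X`. -/
def triDeriv (A A' : C →L[ℝ] C →L[ℝ] C →L[ℝ] ℝ) (X X' : Fin 3 → C) : ℝ :=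
  A' (X 0) (X 1) (X 2) + A (X' 0) (X 1) (X 2) + A (X 0) (X' 1) (X 2) + A (X 0) (X 1) (X' 2)

end Trilinear

section LocalJacobi

set_option maxSynthPendingDepth 5

variable {G C : Type*} [NormedAddCommGroup G] [NormedSpace ℝ G] [NormedAddCommGroup C]
  [NormedSpace ℝ C] {U : G → C} {q : G}

theorem fderiv_density {f g : G → C →L[ℝ] ℝ} {P : C × C → (C →L[ℝ] ℝ) →L[ℝ] C} (ξ τ : G)
    (hU : ContDiffAt ℝ ∞ U q) (hf : ContDiffAt ℝ ∞ f q) (hg : ContDiffAt ℝ ∞ g q)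
    (hP : ContDiffAt ℝ ∞ P (jet U ξ q))
    (hskew : ∀ a b : C →L[ℝ] ℝ, a (P (jet U ξ q) b) = -b (P (jet U ξ q) a)) :
    fderiv ℝ (fun q => f q (P (jet U ξ q) (g q))) q τ
      = fderiv ℝ f q τ (P (jet U ξ q) (g q)) - fderiv ℝ g q τ (P (jet U ξ q) (f q))
        + f q (fderiv ℝ P (jet U ξ q)
          (fderiv ℝ U q τ, fderiv ℝ (fun q => fderiv ℝ U q τ) q ξ) (g q)) := by
  have hj := contDiffAt_jet hU ξ
  have hPj : DifferentiableAt ℝ (fun q => P (jet U ξ q)) q :=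
    (hP.comp q hj).differentiableAt (by simp)
  have hchain : fderiv ℝ (fun q => P (jet U ξ q)) q τ
      = fderiv ℝ P (jet U ξ q) (fderiv ℝ (jet U ξ) q τ) :=
    congrArg (fun L => L τ)
      (fderiv_comp q (hP.differentiableAt (by simp)) (hj.differentiableAt (by simp)))
  have hdg := hg.differentiableAt (by simp)
  rw [fderiv_clm_apply_apply (hf.differentiableAt (by simp)) (hPj.clm_apply hdg),
    fderiv_clm_apply_apply hPj hdg, hchain, fderiv_jet hU, map_add,
    hskew (f q) (fderiv ℝ g q τ)]
  ring

theorem fderiv_antisymm {f : G → C →L[ℝ] ℝ} (v w : G) (hU : ContDiffAt ℝ ∞ U q)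
    (hf : ContDiffAt ℝ ∞ f q) :
    fderiv ℝ (fun q => f q (fderiv ℝ U q w)) q v - fderiv ℝ (fun q => f q (fderiv ℝ U q v)) q w
      = fderiv ℝ f q v (fderiv ℝ U q w) - fderiv ℝ f q w (fderiv ℝ U q v) := by
  have hdf := hf.differentiableAt (by simp)
  have hdU := fun a => (contDiffAt_fderiv_apply hU a).differentiableAt (by simp)
  rw [fderiv_clm_apply_apply hdf (hdU w), fderiv_clm_apply_apply hdf (hdU v),
    fderiv_fderiv_comm hU w v]
  ring

theorem fderiv_trilinear {T : C → C →L[ℝ] C →L[ℝ] C →L[ℝ] ℝ} (ξ : G) (x : Fin 3 → G)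
    (hU : ContDiffAt ℝ ∞ U q) (hT : ContDiffAt ℝ ∞ T (U q)) :
    fderiv ℝ (fun q => T (U q) (fderiv ℝ U q (x 0)) (fderiv ℝ U q (x 1)) (fderiv ℝ U q (x 2))) q ξ
      = triDeriv (T (U q)) (fderiv ℝ T (U q) (fderiv ℝ U q ξ)) (fun j => fderiv ℝ U q (x j))
        (fun j => fderiv ℝ (fun q => fderiv ℝ U q (x j)) q ξ) := by
  have hT' := hT.differentiableAt (by simp)
  have hU' := hU.differentiableAt (by simp)
  have hTU : DifferentiableAt ℝ (fun q => T (U q)) q := hT'.comp q hU'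
  have hchain : fderiv ℝ (fun q => T (U q)) q ξ = fderiv ℝ T (U q) (fderiv ℝ U q ξ) :=
    congrArg (fun L => L ξ) (fderiv_comp q hT' hU')
  have hdU := fun a => (contDiffAt_fderiv_apply hU a).differentiableAt (by simp)
  have hone := hTU.clm_apply (hdU (x 0))
  have htwo := hone.clm_apply (hdU (x 1))
  rw [fderiv_clm_apply_apply htwo (hdU _), fderiv_clm_apply_apply hone (hdU _),
    fderiv_clm_apply_apply hTU (hdU _), hchain, triDeriv]
  simp only [add_apply]

theorem fin_three_add_one_add_one (j : Fin 3) : j + 1 + 1 = j + 2 := by revert j; decide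

theorem fin_three_add_one_add_two (j : Fin 3) : j + 1 + 2 = j := by revert j; decide

/-- After the antisymmetrized derivatives are subtracted, what is left besides the derivatives of
`P` are the derivatives of the covectors, and these cancel after rotating `j` and swapping `p`. -/
theorem fderiv_density_cyclic {f : Fin 3 → G → C →L[ℝ] ℝ} {P : ℕ → C × C → (C →L[ℝ] ℝ) →L[ℝ] C}
    (ξ : G) (x : Fin 3 → ℕ → G) (S : Finset (ℕ × ℕ)) (hS : ∀ p ∈ S, p.swap ∈ S)
    (hU : ContDiffAt ℝ ∞ U q) (hf : ∀ j, ContDiffAt ℝ ∞ (f j) q)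
    (hP : ∀ n, ContDiffAt ℝ ∞ (P n) (jet U ξ q))
    (hskew : ∀ n, ∀ a b : C →L[ℝ] ℝ, a (P n (jet U ξ q) b) = -b (P n (jet U ξ q) a))
    (hx : ∀ p ∈ S, ∀ j, fderiv ℝ U q (x j p.2) = P p.2 (jet U ξ q) (f j q)) :
    ∑ p ∈ S, ∑ j,
        fderiv ℝ (fun q => f j q (P p.2 (jet U ξ q) (f (j + 1) q))) q (x (j + 2) p.1)
      = ∑ p ∈ S, ∑ j,
          (fderiv ℝ (fun q => f j q (fderiv ℝ U q (x (j + 1) p.2))) q (x (j + 2) p.1)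
            - fderiv ℝ (fun q => f j q (fderiv ℝ U q (x (j + 2) p.1))) q (x (j + 1) p.2))
        + ∑ p ∈ S, ∑ j, f j q (fderiv ℝ (P p.2) (jet U ξ q)
            (fderiv ℝ U q (x (j + 2) p.1), fderiv ℝ (fun q => fderiv ℝ U q (x (j + 2) p.1)) q ξ)
            (f (j + 1) q)) := by
  let F (p : ℕ × ℕ) (j : Fin 3) : ℝ :=
    fderiv ℝ (f j) q (x (j + 1) p.2) (fderiv ℝ U q (x (j + 2) p.1))
  have hcancel : ∑ p ∈ S, ∑ j, F p j = ∑ p ∈ S, ∑ j, F p.swap (j + 1) :=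
    calc ∑ p ∈ S, ∑ j, F p j = ∑ p ∈ S, ∑ j, F p.swap j :=
          Finset.sum_nbij' Prod.swap Prod.swap hS hS (fun p _ => p.swap_swap)
            (fun p _ => p.swap_swap) fun p _ => by rw [p.swap_swap]
      _ = ∑ p ∈ S, ∑ j, F p.swap (j + 1) := Finset.sum_congr rfl fun p _ =>
          (Equiv.sum_comp (Equiv.addRight (1 : Fin 3)) (F p.swap)).symm
  have hterm : ∀ p ∈ S, ∀ j : Fin 3,
      fderiv ℝ (fun q => f j q (P p.2 (jet U ξ q) (f (j + 1) q))) q (x (j + 2) p.1)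
      = (fderiv ℝ (fun q => f j q (fderiv ℝ U q (x (j + 1) p.2))) q (x (j + 2) p.1)
          - fderiv ℝ (fun q => f j q (fderiv ℝ U q (x (j + 2) p.1))) q (x (j + 1) p.2))
        + f j q (fderiv ℝ (P p.2) (jet U ξ q)
            (fderiv ℝ U q (x (j + 2) p.1), fderiv ℝ (fun q => fderiv ℝ U q (x (j + 2) p.1)) q ξ)
            (f (j + 1) q))
        + (F p j - F p.swap (j + 1)) := fun p hp j => by
    rw [fderiv_antisymm _ _ hU (hf j), fderiv_density ξ _ hU (hf j) (hf (j + 1)) (hP _) (hskew _),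
      ← hx p hp j, ← hx p hp (j + 1)]
    simp only [F, Prod.fst_swap, Prod.snd_swap, fin_three_add_one_add_one,
      fin_three_add_one_add_two]
    ring
  rw [Finset.sum_congr rfl fun p hp => Finset.sum_congr rfl fun j _ => hterm p hp j]
  simp only [Finset.sum_add_distrib, Finset.sum_sub_distrib, hcancel, sub_self, add_zero]

end LocalJacobi

section Jacobi

set_option maxSynthPendingDepth 5

variable {N : ℕ} {M : Type*} [TopologicalSpace M] [ChartedSpace (Coord N) M]

/-- A 3-form in the chart around `c`, as an iterated linear map. -/
def triForm (T : ThreeForm N M) (c : M) (y : Coord N) :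
    Coord N →L[ℝ] Coord N →L[ℝ] Coord N →L[ℝ] ℝ :=
  triCLM (T.inChart c y)

variable {E : Type*} [NormedAddCommGroup E] [NormedSpace ℝ E]

/-- The value of a 3-form on the derivatives of a family of loops in three directions. -/
def famTri (T : ThreeForm N M) (Θ : E → Loop N M) (x : Fin 3 → E) (q : E × ℝ) : ℝ :=
  let D := mfderiv 𝓘(ℝ, E) (𝓡 N) (fun e => Θ e (q.2 : UnitAddCircle)) q.1
  T (Θ q.1 (q.2 : UnitAddCircle)) ![D (x 0), D (x 1), D (x 2)]

theorem IsClosedThreeForm.contDiffAt_triForm {T : ThreeForm N M} (hT : IsClosedThreeForm T) {c : M}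
    {y : Coord N} (hy : y ∈ (chartAt (Coord N) c).target) : ContDiffAt ℝ ∞ (triForm T c) y :=
  (ContinuousLinearMap.contDiff (𝕜 := ℝ) (triCLM (C := Coord N))).contDiffAt.comp y
    ((hT.smooth c).contDiffAt ((chartAt (Coord N) c).open_target.mem_nhds hy))

/-- The identity in charts behind the Jacobi identity of the operators `P a`, `a ≤ m`, combined
over the pairs of indices in `S`: the cyclic sum of the derivatives of the operators along
Hamiltonian vector fields is a total `x`-derivative of values of `T`. Here `X j a` and `X' j a`
stand for the vector field of `P a` with covector `f j` and its `x`-derivative. -/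
structure IsJacobiFamily (T : ThreeForm N M) (O : ∀ p : M, Set (Tan N p))
    (P : ℕ → MatrixOperator N M) (m : ℕ) (S : Finset (ℕ × ℕ)) (S₃ : Finset (Fin 3 → ℕ)) (ε : ℝ) :
    Prop where
  swap_mem : ∀ p ∈ S, p.swap ∈ S
  snd_le : ∀ p ∈ S, p.2 ≤ m
  sum_eq : ∀ (c : M), ∀ w ∈ opDom O c, ∀ (f : Fin 3 → Coord N →L[ℝ] ℝ)
    (X X' : Fin 3 → ℕ → Coord N), (∀ j, ∀ a ≤ m, X j a = opCoord (P a) c w (f j)) →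
    ∑ p ∈ S, ∑ j,
        f j (fderiv ℝ (opCoord (P p.2) c) w (X (j + 2) p.1, X' (j + 2) p.1) (f (j + 1)))
      = ε * ∑ t ∈ S₃, triDeriv (triForm T c w.1) (fderiv ℝ (triForm T c) w.1 w.2)
        (fun j => X j (t j)) (fun j => X' j (t j))

variable {T : ThreeForm N M} {P : ℕ → MatrixOperator N M} {O : ∀ p : M, Set (Tan N p)} {m : ℕ}
  {S : Finset (ℕ × ℕ)} {S₃ : Finset (Fin 3 → ℕ)} {ε : ℝ}

theorem IsJacobiFamily.fst_le (hJac : IsJacobiFamily T O P m S S₃ ε) : ∀ p ∈ S, p.1 ≤ m :=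
  fun p hp => hJac.snd_le p.swap (hJac.swap_mem p hp)

variable [IsManifold (𝓡 N) ∞ M]

theorem triForm_coframe (T : ThreeForm N M) {c p : M} (hp : p ∈ (chartAt (Coord N) c).source)
    (ξ η ζ : Tan N p) :
    triForm T c (chartAt (Coord N) c p) (coframe c p ξ) (coframe c p η) (coframe c p ζ)
      = T p ![ξ, η, ζ] := by
  rw [triForm, triCLM_apply]
  change T ((chartAt (Coord N) c).symm (chartAt (Coord N) c p))
    (frame c ((chartAt (Coord N) c).symm (chartAt (Coord N) c p)) ∘ _) = _
  rw [(chartAt (Coord N) c).left_inv hp]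
  congr 1
  ext1 i
  fin_cases i
  · exact frame_coframe hp ξ
  · exact frame_coframe hp η
  · exact frame_coframe hp ζ

variable {V : Set (Loop N M)} {W : Set E} {Θ : E → Loop N M}

theorem famTri_eventuallyEq (T : ThreeForm N M) (h : IsFamily W Θ) (x : Fin 3 → E) {c : M}
    {q : E × ℝ} (hq : q ∈ chartDom W Θ c) :
    famTri T Θ x =ᶠ[𝓝 q] fun q => triForm T c (inCoord Θ c q) (fderiv ℝ (inCoord Θ c) q (x 0, 0))
      (fderiv ℝ (inCoord Θ c) q (x 1, 0)) (fderiv ℝ (inCoord Θ c) q (x 2, 0)) := by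
  filter_upwards [(h.isOpen_chartDom c).mem_nhds hq] with q' hq'
  rw [← h.coframe_mfderiv_param hq', ← h.coframe_mfderiv_param hq', ← h.coframe_mfderiv_param hq',
    inCoord, triForm_coframe T hq'.2]
  rfl

theorem contDiffAt_famTri (hT : IsClosedThreeForm T) (h : IsFamily W Θ) (x : Fin 3 → E) (q : E × ℝ)
    (hq : q.1 ∈ W) : ContDiffAt ℝ ∞ (famTri T Θ x) q := by
  have hc : q ∈ chartDom W Θ (Θ q.1 (q.2 : UnitAddCircle)) := ⟨hq, mem_chart_source _ _⟩
  refine ContDiffAt.congr_of_eventuallyEq ?_ (famTri_eventuallyEq T h x hc)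
  have hU := h.contDiffAt_inCoord hc
  have hTU := (hT.contDiffAt_triForm ((chartAt (Coord N) _).map_source hc.2)).comp q hU
  exact ((hTU.clm_apply (contDiffAt_fderiv_apply hU _)).clm_apply
    (contDiffAt_fderiv_apply hU _)).clm_apply (contDiffAt_fderiv_apply hU _)

theorem fderiv_famTri (hT : IsClosedThreeForm T) (h : IsFamily W Θ) (x : Fin 3 → E) {c : M}
    {q : E × ℝ} (hq : q ∈ chartDom W Θ c) :
    fderiv ℝ (famTri T Θ x) q (0, 1)
      = triDeriv (triForm T c (inCoord Θ c q))
        (fderiv ℝ (triForm T c) (inCoord Θ c q) (fderiv ℝ (inCoord Θ c) q (0, 1)))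
        (fun j => fderiv ℝ (inCoord Θ c) q (x j, 0))
        (fun j => fderiv ℝ (fun q => fderiv ℝ (inCoord Θ c) q (x j, 0)) q (0, 1)) := by
  rw [(famTri_eventuallyEq T h x hq).fderiv_eq]
  exact fderiv_trilinear (0, 1) (fun j => (x j, 0)) (h.contDiffAt_inCoord hq)
    (hT.contDiffAt_triForm ((chartAt (Coord N) c).map_source hq.2))

theorem integral_fderiv_famTri_eq_zero (hT : IsClosedThreeForm T) (h : IsFamily W Θ)
    (x : Fin 3 → E) {e : E} (he : e ∈ W) :
    ∫ y in (0 : ℝ)..1, fderiv ℝ (famTri T Θ x) (e, y) (0, 1) = 0 := by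
  refine integral_fderiv_circle_eq_zero (contDiffAt_famTri hT h x) he ?_
  have hperiod : ((1 : ℝ) : UnitAddCircle) = ((0 : ℝ) : UnitAddCircle) := by simp
  exact congrArg (fun z : UnitAddCircle =>
    let D := mfderiv 𝓘(ℝ, E) (𝓡 N) (fun e => Θ e z) e
    T (Θ e z) ![D (x 0), D (x 1), D (x 2)]) hperiod

variable [FiniteDimensional ℝ E] {f g k : CovectorField N M} {I J : Loop N M → ℝ}

theorem bracket_bracket_eq {Q R : MatrixOperator N M} (hR : IsSmoothSkewOn O R)
    (hI : HasVariationalDeriv V I f) (hJ : HasVariationalDeriv V J g) {d : CovectorField N M}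
    (hd : HasVariationalDeriv V (bracket R f g) d) (h : IsFamily W Θ) (hV : ∀ e ∈ W, Θ e ∈ V)
    (hO : ∀ e ∈ W, ∀ z, (Θ e).vel z ∈ O (Θ e z)) {r e : E} (he : e ∈ W)
    (hr : IsHamiltonianDir Q k Θ r e) :
    bracket Q d k (Θ e) = ∫ x in (0 : ℝ)..1, fderiv ℝ (famDensity R f g Θ) (e, x) (r, 0) := by
  rw [← (hd.hasDerivAt_family h hV he r).unique (hasDerivAt_bracket_family hR hI hJ h hV hO he r),
    bracket_eq_integral_density]
  refine intervalIntegral.integral_congr fun x _ => ?_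
  have hq : (e, x) ∈ chartDom W Θ (Θ e (x : UnitAddCircle)) := ⟨he, mem_chart_source _ _⟩
  simp only [density, pairing]
  congr 1
  exact coframe_injective (mem_chart_source _ _)
    ((h.coframe_mfderiv_param hq r).trans (hr.2 x _ hq.2)).symm

end Jacobi

section JacobiSum

set_option maxSynthPendingDepth 5

variable {N : ℕ} {M : Type*} [TopologicalSpace M] [ChartedSpace (Coord N) M]
  [IsManifold (𝓡 N) ∞ M] {E : Type*} [NormedAddCommGroup E] [NormedSpace ℝ E]
  [FiniteDimensional ℝ E] {T : ThreeForm N M} {P : ℕ → MatrixOperator N M}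
  {O : ∀ p : M, Set (Tan N p)} {m : ℕ} {S : Finset (ℕ × ℕ)} {S₃ : Finset (Fin 3 → ℕ)} {ε : ℝ}
  {V : Set (Loop N M)} {W : Set E} {Θ : E → Loop N M} {f : Fin 3 → CovectorField N M}
  {I : Fin 3 → Loop N M → ℝ}

theorem sum_fderiv_famDensity_eq (hT : IsClosedThreeForm T) (hP : ∀ n, IsSmoothSkewOn O (P n))
    (hJac : IsJacobiFamily T O P m S S₃ ε) (hI : ∀ j, HasVariationalDeriv V (I j) (f j))
    (h : IsFamily W Θ) (hV : ∀ e ∈ W, Θ e ∈ V) (hO : ∀ e ∈ W, ∀ z, (Θ e).vel z ∈ O (Θ e z))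
    {e : E} (he : e ∈ W) {r : Fin 3 → ℕ → E}
    (hr : ∀ j, ∀ a ≤ m, IsHamiltonianDir (P a) (f j) Θ (r j a) e) (x : ℝ) :
    ∑ p ∈ S, ∑ j, fderiv ℝ (famDensity (P p.2) (f j) (f (j + 1)) Θ) (e, x) (r (j + 2) p.1, 0)
      = ∑ p ∈ S, ∑ j, (fderiv ℝ (pairing (f j) Θ (r (j + 1) p.2)) (e, x) (r (j + 2) p.1, 0)
          - fderiv ℝ (pairing (f j) Θ (r (j + 2) p.1)) (e, x) (r (j + 1) p.2, 0))
        + ε * ∑ t ∈ S₃, fderiv ℝ (famTri T Θ fun j => r j (t j)) (e, x) (0, 1) := by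
  have hq : (e, x) ∈ chartDom W Θ (Θ e (x : UnitAddCircle)) := ⟨he, mem_chart_source _ _⟩
  set c : M := Θ e (x : UnitAddCircle)
  have hmem : jet (inCoord Θ c) (0, 1) (e, x) ∈ opDom O c := by
    rw [h.jet_inCoord hq]
    exact mem_opDom hq.2 (hO _ hq.1 _)
  have hskew : ∀ n, ∀ a b : Coord N →L[ℝ] ℝ,
      a (opCoord (P n) c (jet (inCoord Θ c) (0, 1) (e, x)) b)
        = -b (opCoord (P n) c (jet (inCoord Θ c) (0, 1) (e, x)) a) := fun n => by
    rw [h.jet_inCoord hq]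
    exact opCoord_skew hq.2 ((hP n).skew _ _ (hO _ hq.1 _))
  have hcoord := fun j a ha => (hr j a ha).fderiv_eq h hq
  simp only [fun Q g k => (famDensity_eventuallyEq Q g k h hq).fderiv_eq (𝕜 := ℝ),
    fun g v => (pairing_eventuallyEq g h hq v).fderiv_eq (𝕜 := ℝ), fderiv_famTri hT h _ hq]
  rw [fderiv_density_cyclic (0, 1) (fun j a => (r j a, 0)) S hJac.swap_mem
    (h.contDiffAt_inCoord hq) (fun j => (hI j).contDiffAt_covCoord h hV hq)
    (fun n => (hP n).contDiffAt_opCoord h hO hq) hskew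
    (fun p hp j => hcoord j p.2 (hJac.snd_le p hp))]
  congr 1
  exact hJac.sum_eq c _ hmem (fun j => covCoord (f j) c (Θ e) (x : UnitAddCircle))
    (fun j a => fderiv ℝ (inCoord Θ c) (e, x) (r j a, 0))
    (fun j a => fderiv ℝ (fun q => fderiv ℝ (inCoord Θ c) q (r j a, 0)) (e, x) (0, 1)) hcoord

theorem HasVariationalDeriv.integral_fderiv_pairing_antisymm {F : Loop N M → ℝ}
    {k : CovectorField N M} (hF : HasVariationalDeriv V F k) (h : IsFamily W Θ)
    (hV : ∀ e ∈ W, Θ e ∈ V) {e : E} (he : e ∈ W) (v w : E) :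
    ∫ x in (0 : ℝ)..1, (fderiv ℝ (pairing k Θ v) (e, x) (w, 0)
      - fderiv ℝ (pairing k Θ w) (e, x) (v, 0)) = 0 := by
  have hint := fun v w => (continuous_fderiv_slice (hF.contDiffAt_pairing h hV v) he
    w).intervalIntegrable (μ := MeasureTheory.volume) 0 1
  rw [intervalIntegral.integral_sub (hint _ _) (hint _ _), hF.second_variation_symm h hV he v w,
    sub_self]

theorem integral_sum_fderiv_famDensity_eq_zero (hT : IsClosedThreeForm T)
    (hP : ∀ n, IsSmoothSkewOn O (P n)) (hJac : IsJacobiFamily T O P m S S₃ ε)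
    (hI : ∀ j, HasVariationalDeriv V (I j) (f j)) (h : IsFamily W Θ) (hV : ∀ e ∈ W, Θ e ∈ V)
    (hO : ∀ e ∈ W, ∀ z, (Θ e).vel z ∈ O (Θ e z)) {e : E} (he : e ∈ W) {r : Fin 3 → ℕ → E}
    (hr : ∀ j, ∀ a ≤ m, IsHamiltonianDir (P a) (f j) Θ (r j a) e) :
    ∫ x in (0 : ℝ)..1, ∑ p ∈ S, ∑ j,
      fderiv ℝ (famDensity (P p.2) (f j) (f (j + 1)) Θ) (e, x) (r (j + 2) p.1, 0) = 0 := by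
  have hpair : ∀ j v w, Continuous fun x => fderiv ℝ (pairing (f j) Θ v) (e, x) w :=
    fun j v w => continuous_fderiv_slice ((hI j).contDiffAt_pairing h hV v) he w
  have hanti : ∀ j v w, Continuous fun x => fderiv ℝ (pairing (f j) Θ v) (e, x) (w, 0)
      - fderiv ℝ (pairing (f j) Θ w) (e, x) (v, 0) := fun j v w => (hpair j v _).sub (hpair j w _)
  have htri : ∀ t : Fin 3 → ℕ, Continuous fun x =>
      fderiv ℝ (famTri T Θ fun j => r j (t j)) (e, x) (0, 1) :=
    fun t => continuous_fderiv_slice (contDiffAt_famTri hT h _) he _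
  simp only [sum_fderiv_famDensity_eq hT hP hJac hI h hV hO he hr]
  rw [intervalIntegral.integral_add
      ((continuous_finsetSum _ fun p _ =>
        continuous_finsetSum _ fun j _ => hanti j _ _).intervalIntegrable _ _)
      (((continuous_finsetSum _ fun t _ => htri t).const_mul ε).intervalIntegrable _ _),
    intervalIntegral.integral_const_mul, intervalIntegral.integral_finsetSum
      fun t _ => (htri t).intervalIntegrable _ _,
    intervalIntegral.integral_finsetSum fun p _ =>
      (continuous_finsetSum _ fun j _ => hanti j _ _).intervalIntegrable _ _]
  simp only [intervalIntegral.integral_finsetSum fun j _ => (hanti j _ _).intervalIntegrable _ _,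
    (hI _).integral_fderiv_pairing_antisymm h hV he, integral_fderiv_famTri_eq_zero hT h _ he,
    Finset.sum_const_zero, mul_zero, add_zero]

theorem exists_isFamily_isHamiltonianDir (hP : ∀ n, IsSmoothSkewOn O (P n))
    (hI : ∀ j, HasVariationalDeriv V (I j) (f j)) (hVo : IsLoopOpen V)
    (hVO : ∀ γ ∈ V, ∀ z, γ.vel z ∈ O (γ z)) (m : ℕ) {γ : Loop N M} (hγ : γ ∈ V) :
    ∃ (W : Set (ℝ × (Fin 3 × Fin (m + 1) → ℝ))) (Θ : ℝ × (Fin 3 × Fin (m + 1) → ℝ) → Loop N M)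
      (r : Fin 3 → ℕ → ℝ × (Fin 3 × Fin (m + 1) → ℝ)),
      IsFamily W Θ ∧ (∀ e ∈ W, Θ e ∈ V) ∧ 0 ∈ W ∧ Θ 0 = γ ∧
        ∀ j, ∀ a ≤ m, IsHamiltonianDir (P a) (f j) Θ (r j a) 0 := by
  obtain ⟨W, Θ, hΘ⟩ := (isFamily_const (E := ℝ) γ).exists_extension (Set.mem_univ 0)
    (ι := Fin 3 × Fin (m + 1)) (fun i _ z => P i.2 (γ z) (γ.vel z) (f i.1 γ z))
    fun i c => contDiffOn_hamiltonian (hP i.2) (hI i.1) (isFamily_const γ) (fun _ _ => hγ)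
      (fun _ _ => hVO _ hγ) c
  have hΘ₀ : Θ 0 = γ := hΘ.apply_zero 0
  refine ⟨{p | p ∈ W ∧ Θ p ∈ V}, Θ, fun j a => (0, Pi.single (j, Fin.ofNat (m + 1) a) 1),
    hΘ.isFamily.mono (hVo.isOpen_family hΘ.isFamily) (fun _ hp => hp.1), fun _ hp => hp.2,
    ⟨hΘ.mem, by rwa [hΘ₀]⟩, hΘ₀, fun j a ha => ?_⟩
  have hvar := hΘ.hasVariation 0 hΘ.mem (j, Fin.ofNat (m + 1) a)
  rw [IsHamiltonianDir, hΘ₀]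
  simpa only [Prod.mk_zero_zero, Fin.val_ofNat, Nat.mod_eq_of_lt (Nat.lt_succ_of_le ha)] using hvar

theorem sum_bracket_bracket_eq_zero (hT : IsClosedThreeForm T) (hP : ∀ n, IsSmoothSkewOn O (P n))
    (hJac : IsJacobiFamily T O P m S S₃ ε) (hVo : IsLoopOpen V)
    (hVO : ∀ γ ∈ V, ∀ z, γ.vel z ∈ O (γ z)) (hI : ∀ j, HasVariationalDeriv V (I j) (f j))
    {d : Fin 3 → ℕ → CovectorField N M}
    (hd : ∀ j b, HasVariationalDeriv V (bracket (P b) (f j) (f (j + 1))) (d j b)) {γ : Loop N M}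
    (hγ : γ ∈ V) : ∑ p ∈ S, ∑ j, bracket (P p.1) (d j p.2) (f (j + 2)) γ = 0 := by
  obtain ⟨W, Θ, r, h, hV, h₀, rfl, hr⟩ := exists_isFamily_isHamiltonianDir hP hI hVo hVO m hγ
  have hO : ∀ e ∈ W, ∀ z, (Θ e).vel z ∈ O (Θ e z) := fun e he => hVO _ (hV e he)
  have hcont : ∀ (p : ℕ × ℕ) (j : Fin 3), Continuous fun x =>
      fderiv ℝ (famDensity (P p.2) (f j) (f (j + 1)) Θ) (0, x) (r (j + 2) p.1, 0) := fun p j =>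
    continuous_fderiv_slice (contDiffAt_famDensity (hP _) (hI j) (hI (j + 1)) h hV hO) h₀ _
  rw [← integral_sum_fderiv_famDensity_eq_zero hT hP hJac hI h hV hO h₀ hr,
    intervalIntegral.integral_finsetSum fun p _ =>
      (continuous_finsetSum _ fun j _ => hcont p j).intervalIntegrable _ _]
  refine Finset.sum_congr rfl fun p hp => ?_
  rw [intervalIntegral.integral_finsetSum fun j _ => (hcont p j).intervalIntegrable _ _]
  exact Finset.sum_congr rfl fun j _ => bracket_bracket_eq (hP p.2) (hI j) (hI (j + 1)) (hd j p.2)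
    h hV hO h₀ (hr (j + 2) p.1 (hJac.fst_le p hp))

end JacobiSum

section Skew

variable {R X Y : Type*} [CommRing R] [AddCommGroup X] [Module R X] [AddCommGroup Y] [Module R Y]

theorem map_sub_smul_eq {B : X →ₗ[R] Y} {a b : X} {r : R} {y : Y} (h : y + r • B b = B a) :
    B (a - r • b) = y := by
  rw [map_sub, map_smul, ← h, add_sub_cancel_right]

variable {B : Module.Dual R X →ₗ[R] X} {τ : X →ₗ[R] Module.Dual R X}

theorem skew_of_add_smul_eq {A : Module.Dual R X → X} {r : R}
    (hA : ∀ a, A a + r • B (τ (A a)) = B a) (hB : ∀ a b : Module.Dual R X, a (B b) = -b (B a))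
    (hτ : ∀ x y, τ x y = -τ y x) (f g : Module.Dual R X) : f (A g) = -g (A f) := by
  have hexpand : ∀ f g,
      f (A g) = (f - r • τ (A f)) (B (g - r • τ (A g))) + r * τ (A f) (A g) := fun f g => by
    rw [map_sub_smul_eq (hA g)]
    simp
  rw [hexpand f g, hexpand g f, hB, hτ]
  ring

theorem skew_comp_pow (hB : ∀ a b : Module.Dual R X, a (B b) = -b (B a))
    (hτ : ∀ x y, τ x y = -τ y x) (n : ℕ) (f g : Module.Dual R X) :
    f (B (((-(τ ∘ₗ B)) ^ n) g)) = -g (B (((-(τ ∘ₗ B)) ^ n) f)) := by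
  have hself : ∀ f g : Module.Dual R X, f (B ((-(τ ∘ₗ B)) g)) = ((-(τ ∘ₗ B)) f) (B g) :=
    fun f g => by
      rw [hB]
      simpa using hτ (B g) (B f)
  have hself_pow : ∀ f g : Module.Dual R X,
      f (B (((-(τ ∘ₗ B)) ^ n) g)) = (((-(τ ∘ₗ B)) ^ n) f) (B g) := by
    induction n with
    | zero => exact fun f g => rfl
    | succ n ih =>
      intro f g
      rw [pow_succ', Module.End.mul_apply, hself, ih, ← Module.End.mul_apply, ← pow_succ, pow_succ']
  rw [hself_pow, hB]

end Skew

section Algebra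

variable {H C : Type*} [NormedAddCommGroup C] [NormedSpace ℝ C]
  {B : H → (C →L[ℝ] ℝ) →L[ℝ] C} {τ : H → C →L[ℝ] C →L[ℝ] ℝ}

/-- The map `-τB` on covectors, in whose powers the operator `(1 + εBτ)⁻¹B` is expanded. -/
def ratioOp (B : H → (C →L[ℝ] ℝ) →L[ℝ] C) (τ : H → C →L[ℝ] C →L[ℝ] ℝ) (z : H) :
    (C →L[ℝ] ℝ) →L[ℝ] C →L[ℝ] ℝ :=
  -(τ z ∘L B z)

/-- The coefficient `B(-τB)ⁿ` of `εⁿ` in the expansion of `(1 + εBτ)⁻¹B`. -/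
def seriesOp (B : H → (C →L[ℝ] ℝ) →L[ℝ] C) (τ : H → C →L[ℝ] C →L[ℝ] ℝ) (n : ℕ) (z : H) :
    (C →L[ℝ] ℝ) →L[ℝ] C :=
  B z ∘L ratioOp B τ z ^ n

theorem seriesOp_apply (n : ℕ) (z : H) (a : C →L[ℝ] ℝ) :
    seriesOp B τ n z a = B z ((ratioOp B τ z ^ n) a) := rfl

theorem seriesOp_zero : seriesOp B τ 0 = B := by
  ext z a
  simp [seriesOp]

theorem map_seriesOp_apply (n : ℕ) (z : H) (a : C →L[ℝ] ℝ) :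
    τ z (seriesOp B τ n z a) = -(ratioOp B τ z ^ (n + 1)) a := by
  rw [pow_succ', mul_apply_eq_comp, ratioOp, neg_apply, neg_neg]
  rfl

theorem seriesOp_succ_apply (n : ℕ) (z : H) (a : C →L[ℝ] ℝ) :
    seriesOp B τ (n + 1) z a = -B z (τ z (seriesOp B τ n z a)) := by
  rw [map_seriesOp_apply, map_neg, neg_neg, seriesOp_apply]

variable [NormedAddCommGroup H] [NormedSpace ℝ H] {w : H}

theorem contDiffAt_seriesOp (hB : ContDiffAt ℝ ∞ B w) (hτ : ContDiffAt ℝ ∞ τ w) (n : ℕ) :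
    ContDiffAt ℝ ∞ (seriesOp B τ n) w :=
  hB.clm_comp ((hτ.clm_comp hB).neg.pow n)

theorem fderiv_clm_apply_const {G : Type*} [NormedAddCommGroup G] [NormedSpace ℝ G]
    {L : H → C →L[ℝ] G} (hL : DifferentiableAt ℝ L w) (η : H) (g : C) :
    fderiv ℝ (fun z => L z g) w η = fderiv ℝ L w η g := by
  rw [fderiv_clm_apply_apply hL (differentiableAt_const g), fderiv_fun_const]
  simp

theorem fderiv_comp_comp_apply {A : H → (C →L[ℝ] ℝ) →L[ℝ] C} (hB : DifferentiableAt ℝ B w)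
    (hτ : DifferentiableAt ℝ τ w) (hA : DifferentiableAt ℝ A w) (η : H) (g : C →L[ℝ] ℝ) :
    fderiv ℝ (fun z => B z (τ z (A z g))) w η = fderiv ℝ B w η (τ w (A w g))
      + B w (fderiv ℝ τ w η (A w g) + τ w (fderiv ℝ A w η g)) := by
  have hAg := hA.clm_apply (differentiableAt_const g)
  rw [fderiv_clm_apply_apply hB (hτ.clm_apply hAg), fderiv_clm_apply_apply hτ hAg,
    fderiv_clm_apply_const hA]

theorem fderiv_apply_of_add_smul_eq {A : H → (C →L[ℝ] ℝ) →L[ℝ] C} {ε : ℝ}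
    (hB : DifferentiableAt ℝ B w) (hτ : DifferentiableAt ℝ τ w) (hA : DifferentiableAt ℝ A w)
    (hAB : ∀ᶠ z in 𝓝 w, ∀ a, A z a + ε • B z (τ z (A z a)) = B z a)
    (hBs : ∀ a b : C →L[ℝ] ℝ, a (B w b) = -b (B w a)) (hτs : ∀ x y, τ w x y = -τ w y x) (η : H)
    (f g : C →L[ℝ] ℝ) :
    f (fderiv ℝ A w η g)
      = (f - ε • τ w (A w f)) (fderiv ℝ B w η (g - ε • τ w (A w g)))
        + ε * fderiv ℝ τ w η (A w g) (A w f) := by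
  have hAg := hA.clm_apply (differentiableAt_const g)
  have hBτA := hB.clm_apply (hτ.clm_apply hAg)
  have hdiff : fderiv ℝ A w η g + ε • (fderiv ℝ B w η (τ w (A w g))
      + B w (fderiv ℝ τ w η (A w g) + τ w (fderiv ℝ A w η g))) = fderiv ℝ B w η g := by
    have hABg : (fun z => A z g + ε • B z (τ z (A z g))) =ᶠ[𝓝 w] fun z => B z g :=
      hAB.mono fun z hz => hz g
    rw [← fderiv_clm_apply_const hB η g, ← hABg.fderiv_eq, fderiv_fun_add hAg
      (hBτA.fun_const_smul ε), fderiv_fun_const_smul hBτA, add_apply, smul_apply,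
      fderiv_comp_comp_apply hB hτ hA, fderiv_clm_apply_const hA]
  have hAf : B w (f - ε • τ w (A w f)) = A w f :=
    map_sub_smul_eq (B := (B w).toLinearMap) (hAB.self_of_nhds f)
  -- The transpose of `1 + εBτ` is `1 + ετB`, which takes `f - ετAf` to `f`.
  have htranspose : ∀ u, f u = (f - ε • τ w (A w f)) (u + ε • B w (τ w u)) := fun u => by
    rw [map_add, map_smul, hBs _ (τ w u), hAf, hτs u]
    simp
  have hsolve : fderiv ℝ A w η g + ε • B w (τ w (fderiv ℝ A w η g))
      = fderiv ℝ B w η (g - ε • τ w (A w g)) - ε • B w (fderiv ℝ τ w η (A w g)) := by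
    rw [map_sub, map_smul, ← hdiff, map_add]
    module
  rw [htranspose, hsolve, map_sub, map_smul, hBs _ (fderiv ℝ τ w η (A w g)), hAf]
  simp

theorem fderiv_seriesOp_succ_apply (hB : ContDiffAt ℝ ∞ B w) (hτ : ContDiffAt ℝ ∞ τ w) (η : H)
    (n : ℕ) (g : C →L[ℝ] ℝ) :
    fderiv ℝ (seriesOp B τ (n + 1)) w η g
      = -(fderiv ℝ B w η (τ w (seriesOp B τ n w g)) + B w (fderiv ℝ τ w η (seriesOp B τ n w g)
        + τ w (fderiv ℝ (seriesOp B τ n) w η g))) := by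
  have hS := fun n => (contDiffAt_seriesOp hB hτ n).differentiableAt (by simp)
  rw [← fderiv_clm_apply_const (hS (n + 1))]
  simp only [seriesOp_succ_apply]
  rw [fderiv_fun_neg, neg_apply, fderiv_comp_comp_apply (hB.differentiableAt (by simp))
    (hτ.differentiableAt (by simp)) (hS n)]

theorem fderiv_seriesOp_apply (hB : ContDiffAt ℝ ∞ B w) (hτ : ContDiffAt ℝ ∞ τ w)
    (hBs : ∀ a b : C →L[ℝ] ℝ, a (B w b) = -b (B w a)) (hτs : ∀ x y, τ w x y = -τ w y x) (η : H)
    (n : ℕ) (f g : C →L[ℝ] ℝ) :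
    f (fderiv ℝ (seriesOp B τ n) w η g)
      = ∑ i ∈ Finset.range (n + 1),
          ((ratioOp B τ w ^ i) f) (fderiv ℝ B w η ((ratioOp B τ w ^ (n - i)) g))
        + ∑ i ∈ Finset.range n,
          fderiv ℝ τ w η (seriesOp B τ (n - 1 - i) w g) (seriesOp B τ i w f) := by
  induction n generalizing f with
  | zero => simp [seriesOp_zero]
  | succ n ih =>
    have htranspose : ∀ u, f (B w (τ w u)) = -(ratioOp B τ w f) u := fun u => by
      rw [hBs, hτs u, ratioOp]
      simp
    have hpow : ∀ i, (ratioOp B τ w ^ i) (ratioOp B τ w f) = (ratioOp B τ w ^ (i + 1)) f :=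
      fun i => by rw [pow_succ, mul_apply_eq_comp]
    have hseries : ∀ i, seriesOp B τ i w (ratioOp B τ w f) = seriesOp B τ (i + 1) w f :=
      fun i => by rw [seriesOp_apply, seriesOp_apply, hpow]
    rw [fderiv_seriesOp_succ_apply hB hτ, map_neg, map_add, map_add, map_add, htranspose, ih,
      map_seriesOp_apply, map_neg, map_neg, hBs f (fderiv ℝ τ w η _)]
    conv_rhs => rw [Finset.sum_range_succ' _ n, Finset.sum_range_succ' _ (n + 1)]
    simp only [hpow, hseries, Nat.add_sub_add_right, Nat.sub_zero, pow_zero,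
      one_apply_eq_self, seriesOp_zero, Nat.add_sub_cancel, Nat.sub_sub,
      Nat.add_comm 1]
    ring

end Algebra

section Triples

/-- The triples of natural numbers whose sum increased by `e` is `n`. -/
def triples (n e : ℕ) : Finset (Fin 3 → ℕ) :=
  {t ∈ Fintype.piFinset fun _ => Finset.range (n + 1) | t 0 + t 1 + t 2 + e = n}

theorem mem_triples {n e : ℕ} {t : Fin 3 → ℕ} : t ∈ triples n e ↔ t 0 + t 1 + t 2 + e = n := by
  simp only [triples, Finset.mem_filter, Fintype.mem_piFinset, Finset.mem_range,
    Fin.forall_fin_succ, Fin.succ_zero_eq_one, Fin.succ_one_eq_two, IsEmpty.forall_iff, and_true]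
  omega

theorem le_of_mem_triples {n e : ℕ} {t : Fin 3 → ℕ} (ht : t ∈ triples n e) (j : Fin 3) :
    t j ≤ n :=
  Nat.le_of_lt_succ (Finset.mem_range.mp
    (Fintype.mem_piFinset.mp (Finset.mem_filter.mp ht).1 j))

theorem comp_add_mem_triples {n e : ℕ} {t : Fin 3 → ℕ} (ht : t ∈ triples n e) (j : Fin 3) :
    (fun i => t (j + i)) ∈ triples n e := by
  rw [mem_triples, ← Fin.sum_univ_three] at ht
  rw [mem_triples, ← Fin.sum_univ_three fun i => t (j + i)]
  exact (congrArg (· + e) (Equiv.sum_comp (Equiv.addLeft j) t)).trans ht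

theorem sum_triples_comp_add (n e : ℕ) (F : (Fin 3 → ℕ) → ℝ) (j : Fin 3) :
    ∑ t ∈ triples n e, F (fun i => t (j + i)) = ∑ t ∈ triples n e, F t :=
  Finset.sum_nbij' (fun t i => t (j + i)) (fun t i => t (-j + i))
    (fun _ ht => comp_add_mem_triples ht j)
    (fun _ ht => comp_add_mem_triples ht (-j))
    (fun t _ => by simp) (fun t _ => by simp) fun _ _ => rfl

theorem sum_sum_triples_comp_add (n e : ℕ) (F : Fin 3 → (Fin 3 → ℕ) → ℝ) :
    ∑ j, ∑ t ∈ triples n e, F j t = ∑ t ∈ triples n e, ∑ j, F j (fun i => t (j + i)) := by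
  rw [Finset.sum_comm (s := triples n e)]
  exact Finset.sum_congr rfl fun j _ => (sum_triples_comp_add n e (F j) j).symm

theorem sum_antidiagonal_range (n e : ℕ) (F : (Fin 3 → ℕ) → ℝ) :
    ∑ p ∈ Finset.HasAntidiagonal.antidiagonal n, ∑ i ∈ Finset.range (p.2 + 1 - e),
        F ![i, p.2 - e - i, p.1]
      = ∑ t ∈ triples n e, F t := by
  rw [Finset.sum_sigma']
  refine Finset.sum_nbij' (fun s => ![s.2, s.1.2 - e - s.2, s.1.1])
    (fun t => ⟨(t 2, n - t 2), t 0⟩) ?_ ?_ ?_ ?_ ?_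
  · rintro ⟨⟨a, b⟩, i⟩ h
    simp only [Finset.mem_sigma, Finset.HasAntidiagonal.mem_antidiagonal, Finset.mem_range] at h
    rw [mem_triples]
    simp only [Matrix.cons_val]
    omega
  · intro t h
    rw [mem_triples] at h
    simp only [Finset.mem_sigma, Finset.HasAntidiagonal.mem_antidiagonal, Finset.mem_range]
    omega
  · rintro ⟨⟨a, b⟩, i⟩ h
    simp only [Finset.mem_sigma, Finset.HasAntidiagonal.mem_antidiagonal, Finset.mem_range] at h
    obtain rfl : n - a = b := by omega
    rfl
  · intro t h
    rw [mem_triples] at h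
    have hsnd : n - t 2 - e - t 0 = t 1 := by omega
    ext j
    fin_cases j
    exacts [rfl, hsnd, rfl]
  · intro s _
    rfl

theorem sum_antidiagonal_fderiv_seriesOp {H C : Type*} [NormedAddCommGroup C] [NormedSpace ℝ C]
    [NormedAddCommGroup H] [NormedSpace ℝ H] {B : H → (C →L[ℝ] ℝ) →L[ℝ] C}
    {τ : H → C →L[ℝ] C →L[ℝ] ℝ} {w : H} (hB : ContDiffAt ℝ ∞ B w) (hτ : ContDiffAt ℝ ∞ τ w)
    (hBs : ∀ a b : C →L[ℝ] ℝ, a (B w b) = -b (B w a)) (hτs : ∀ x y, τ w x y = -τ w y x)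
    (u : ℕ → H) (n : ℕ) (f g : C →L[ℝ] ℝ) :
    ∑ p ∈ Finset.HasAntidiagonal.antidiagonal n, f (fderiv ℝ (seriesOp B τ p.2) w (u p.1) g)
      = ∑ t ∈ triples n 0,
          ((ratioOp B τ w ^ t 0) f) (fderiv ℝ B w (u (t 2)) ((ratioOp B τ w ^ t 1) g))
        + ∑ t ∈ triples n 1,
          fderiv ℝ τ w (u (t 2)) (seriesOp B τ (t 1) w g) (seriesOp B τ (t 0) w f) := by
  rw [← sum_antidiagonal_range n 0, ← sum_antidiagonal_range n 1, ← Finset.sum_add_distrib]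
  exact Finset.sum_congr rfl fun p _ => fderiv_seriesOp_apply hB hτ hBs hτs _ _ f g

end Triples

section Alternating

variable {R V W : Type*} [CommRing R] [AddCommGroup V] [Module R V] [AddCommGroup W] [Module R W]

theorem alternating_swap₁₂ (A : V [⋀^Fin 3]→ₗ[R] W) (a b c : V) :
    A ![a, b, c] = -A ![b, a, c] := by
  refine Eq.trans ?_ (A.map_swap ![b, a, c] (i := 0) (j := 1) (by decide))
  congr 1
  ext i; fin_cases i <;> rfl

theorem alternating_swap₂₃ (A : V [⋀^Fin 3]→ₗ[R] W) (a b c : V) :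
    A ![a, b, c] = -A ![a, c, b] := by
  refine Eq.trans ?_ (A.map_swap ![a, c, b] (i := 1) (j := 2) (by decide))
  congr 1
  ext i; fin_cases i <;> rfl

end Alternating

section ThreeForms

set_option maxSynthPendingDepth 5

variable {C : Type*} [NormedAddCommGroup C] [NormedSpace ℝ C]

theorem triCLM_swap₁₂ (A : C [⋀^Fin 3]→L[ℝ] ℝ) (a b c : C) :
    triCLM A a b c = -triCLM A b a c := by
  rw [triCLM_apply, triCLM_apply]
  exact alternating_swap₁₂ A.toAlternatingMap a b c

theorem triCLM_swap₂₃ (A : C [⋀^Fin 3]→L[ℝ] ℝ) (a b c : C) :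
    triCLM A a b c = -triCLM A a c b := by
  rw [triCLM_apply, triCLM_apply]
  exact alternating_swap₂₃ A.toAlternatingMap a b c

theorem fderiv_triCLM_comp {τ : C → C [⋀^Fin 3]→L[ℝ] ℝ} {y : C} (hτ : DifferentiableAt ℝ τ y)
    (d : C) : fderiv ℝ (fun y => triCLM (τ y)) y d = triCLM (fderiv ℝ τ y d) :=
  congrArg (fun L => L d) (triCLM.hasFDerivAt.comp y hτ.hasFDerivAt).fderiv

theorem fderiv_triCLM_comp_closed {τ : C → C [⋀^Fin 3]→L[ℝ] ℝ} {y : C}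
    (hτ : DifferentiableAt ℝ τ y) (hclosed : extDeriv τ y = 0) (d a b e : C) :
    fderiv ℝ (fun y => triCLM (τ y)) y d a b e = fderiv ℝ (fun y => triCLM (τ y)) y a d b e
      - fderiv ℝ (fun y => triCLM (τ y)) y b d a e
      + fderiv ℝ (fun y => triCLM (τ y)) y e d a b := by
  have happly : ∀ v : Fin 3 → C, fderiv ℝ (fun y => τ y v) y
      = (ContinuousAlternatingMap.apply ℝ C ℝ v).comp (fderiv ℝ τ y) := fun v =>
    ((ContinuousAlternatingMap.apply ℝ C ℝ v).hasFDerivAt.comp y hτ.hasFDerivAt).fderiv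
  have hext : ∑ i : Fin 4, (-1 : ℤ) ^ i.val •
      fderiv ℝ (fun y => τ y (Fin.removeNth i ![d, a, b, e])) y (![d, a, b, e] i) = 0 :=
    (extDeriv_apply hτ ![d, a, b, e]).symm.trans (by rw [hclosed]; rfl)
  have hremove₁ : Fin.removeNth (1 : Fin 4) ![d, a, b, e] = ![d, b, e] := by
    ext i; fin_cases i <;> rfl
  have hremove₂ : Fin.removeNth (2 : Fin 4) ![d, a, b, e] = ![d, a, e] := by
    ext i; fin_cases i <;> rfl
  have hremove₃ : Fin.removeNth (3 : Fin 4) ![d, a, b, e] = ![d, a, b] := by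
    ext i; fin_cases i <;> rfl
  have hsum : fderiv ℝ τ y d ![a, b, e] - fderiv ℝ τ y a ![d, b, e] + fderiv ℝ τ y b ![d, a, e]
      - fderiv ℝ τ y e ![d, a, b] = 0 := by
    simpa [Fin.sum_univ_four, happly, hremove₁, hremove₂, hremove₃, sub_eq_add_neg, pow_succ]
      using hext
  simp only [fderiv_triCLM_comp hτ, triCLM_apply]
  linarith

variable {N : ℕ} {M : Type*} [TopologicalSpace M] [ChartedSpace (Coord N) M] {T : ThreeForm N M}
  {c : M} {z : Coord N × Coord N}

theorem IsClosedThreeForm.differentiableAt_inChart (hT : IsClosedThreeForm T) {y : Coord N}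
    (hy : y ∈ (chartAt (Coord N) c).target) : DifferentiableAt ℝ (T.inChart c) y :=
  ((hT.smooth c).contDiffAt ((chartAt (Coord N) c).open_target.mem_nhds hy)).differentiableAt
    (by simp)

/-- The covector-valued map `ξ ↦ T_{pjk} ξ^j v^k` in the chart around `c`, at the point with
coordinates `z.1` and for the velocity `v` with components `z.2`. -/
def contractCoord (T : ThreeForm N M) (c : M) (z : Coord N × Coord N) :
    Coord N →L[ℝ] Coord N →L[ℝ] ℝ :=
  (triForm T c z.1).flip z.2

theorem contractCoord_skew (T : ThreeForm N M) (c : M) (z : Coord N × Coord N) (ξ η : Coord N) :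
    contractCoord T c z ξ η = -contractCoord T c z η ξ := by
  simp only [contractCoord, ContinuousLinearMap.flip_apply, triForm]
  rw [triCLM_swap₁₂, triCLM_swap₂₃, triCLM_swap₁₂]
  ring

theorem IsClosedThreeForm.contDiffAt_contractCoord (hT : IsClosedThreeForm T)
    (hz : z.1 ∈ (chartAt (Coord N) c).target) : ContDiffAt ℝ ∞ (contractCoord T c) z := by
  have htri : ContDiffAt ℝ ∞ (fun z : Coord N × Coord N => triForm T c z.1) z :=
    (hT.contDiffAt_triForm hz).comp z contDiffAt_fst
  have hflip : ContDiff ℝ ∞ fun L : Coord N →L[ℝ] Coord N →L[ℝ] Coord N →L[ℝ] ℝ => L.flip :=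
    (ContinuousLinearMap.flipₗᵢ ℝ (Coord N) (Coord N)
      (Coord N →L[ℝ] ℝ)).toContinuousLinearEquiv.contDiff
  exact (hflip.contDiffAt.comp z htri).clm_apply contDiffAt_snd

theorem IsClosedThreeForm.fderiv_contractCoord_apply (hT : IsClosedThreeForm T)
    (hz : z.1 ∈ (chartAt (Coord N) c).target) (d : Coord N × Coord N) (ξ η : Coord N) :
    fderiv ℝ (contractCoord T c) z d ξ η
      = fderiv ℝ (triForm T c) z.1 d.1 ξ z.2 η + triForm T c z.1 ξ d.2 η := by
  have htri := (hT.contDiffAt_triForm hz).differentiableAt (by simp)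
  have htri_fst : DifferentiableAt ℝ (fun z : Coord N × Coord N => triForm T c z.1) z :=
    htri.comp z differentiableAt_fst
  have hchain : fderiv ℝ (fun z : Coord N × Coord N => triForm T c z.1) z d
      = fderiv ℝ (triForm T c) z.1 d.1 :=
    congrArg (fun L => L d) (htri.hasFDerivAt.comp z hasFDerivAt_fst).fderiv
  have hξ := htri_fst.clm_apply (differentiableAt_const ξ)
  have hcontract := (hT.contDiffAt_contractCoord hz).differentiableAt (by simp)
  rw [← fderiv_clm_apply_const hcontract,
    ← fderiv_clm_apply_const (hcontract.clm_apply (differentiableAt_const ξ))]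
  change fderiv ℝ (fun z : Coord N × Coord N => triForm T c z.1 ξ z.2 η) z d = _
  rw [fderiv_clm_apply_const (hξ.clm_apply differentiableAt_snd),
    fderiv_clm_apply_apply hξ differentiableAt_snd, fderiv_clm_apply_const htri_fst, hchain,
    fderiv_snd]
  rfl

theorem IsClosedThreeForm.sum_fderiv_contractCoord (hT : IsClosedThreeForm T)
    (hz : z.1 ∈ (chartAt (Coord N) c).target) (X X' : Fin 3 → Coord N) :
    ∑ j, fderiv ℝ (contractCoord T c) z (X (j + 2), X' (j + 2)) (X (j + 1)) (X j)
      = triDeriv (triForm T c z.1) (fderiv ℝ (triForm T c) z.1 z.2) X X' := by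
  have hdiff := hT.differentiableAt_inChart hz
  have hfderiv : fderiv ℝ (triForm T c) z.1 = fderiv ℝ (fun y => triCLM (T.inChart c y)) z.1 := rfl
  simp only [hT.fderiv_contractCoord_apply hz, Fin.sum_univ_three, triDeriv, Fin.isValue,
    zero_add, Fin.reduceAdd, hfderiv]
  rw [fderiv_triCLM_comp_closed hdiff (hT.closed c z.1 hz) z.2]
  simp only [fderiv_triCLM_comp hdiff, triForm]
  rw [triCLM_swap₁₂ _ (X 1) z.2 (X 0), triCLM_swap₂₃ _ z.2 (X 1) (X 0),
    triCLM_swap₁₂ _ (X 2) z.2 (X 1), triCLM_swap₂₃ _ z.2 (X 2) (X 1),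
    triCLM_swap₁₂ _ (X 0) z.2 (X 2), triCLM_swap₁₂ _ (X 1) (X' 2) (X 0),
    triCLM_swap₂₃ _ (X' 2) (X 1) (X 0), triCLM_swap₁₂ _ (X' 2) (X 0) (X 1),
    triCLM_swap₂₃ _ (X 0) (X' 2) (X 1), triCLM_swap₁₂ _ (X 2) (X' 0) (X 1),
    triCLM_swap₂₃ _ (X' 0) (X 2) (X 1)]
  ring

end ThreeForms

section Bivectors

set_option maxSynthPendingDepth 5

variable {N : ℕ} {M : Type*} [TopologicalSpace M] [ChartedSpace (Coord N) M] {ω₀ : TwoTensor N M}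
  {c : M} {z : Coord N × Coord N}

/-- The matrix `ω^{ij}` in the chart around `c`. It does not depend on `z.2`, which stands for the
velocity as in the matrices of other operators. -/
def tensorCoord (ω₀ : TwoTensor N M) (c : M) (z : Coord N × Coord N) :
    (Coord N →L[ℝ] ℝ) →L[ℝ] Coord N :=
  opCoord (fun p _ => ω₀ p) c z

theorem IsPoissonStructure.contDiffAt_tensorCoord (hω₀ : IsPoissonStructure ω₀)
    (hz : z.1 ∈ (chartAt (Coord N) c).target) : ContDiffAt ℝ ∞ (tensorCoord ω₀ c) z := by
  have hsmooth : ContDiffOn ℝ ∞ (tensorCoord ω₀ c) ((chartAt (Coord N) c).target ×ˢ Set.univ) := by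
    rw [contDiffOn_clm_apply]
    exact fun a => (hω₀.smooth c a.toLinearMap).comp contDiffOn_fst fun z hz => hz.1
  exact hsmooth.contDiffAt
    (((chartAt (Coord N) c).open_target.prod isOpen_univ).mem_nhds ⟨hz, trivial⟩)

theorem IsPoissonStructure.apply_fderiv_tensorCoord (hω₀ : IsPoissonStructure ω₀)
    (hz : z.1 ∈ (chartAt (Coord N) c).target) (a b : Coord N →L[ℝ] ℝ) (d : Coord N × Coord N) :
    a (fderiv ℝ (tensorCoord ω₀ c) z d b)
      = fderiv ℝ (fun y => a (ω₀.inChart c b.toLinearMap y)) z.1 d.1 := by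
  have hω : DifferentiableAt ℝ (ω₀.inChart c b.toLinearMap) z.1 :=
    ((hω₀.smooth c b.toLinearMap).contDiffAt
      ((chartAt (Coord N) c).open_target.mem_nhds hz)).differentiableAt (by simp)
  have hchain : fderiv ℝ (fun z => tensorCoord ω₀ c z b) z d
      = fderiv ℝ (ω₀.inChart c b.toLinearMap) z.1 d.1 :=
    congrArg (fun L => L d) (hω.hasFDerivAt.comp z hasFDerivAt_fst).fderiv
  rw [← fderiv_clm_apply_const ((hω₀.contDiffAt_tensorCoord hz).differentiableAt (by simp)), hchain]
  exact (congrArg (fun L => L d.1) (a.hasFDerivAt.comp z.1 hω.hasFDerivAt).fderiv).symm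

theorem IsPoissonStructure.sum_fderiv_tensorCoord (hω₀ : IsPoissonStructure ω₀)
    (hz : z.1 ∈ (chartAt (Coord N) c).target) (a : Fin 3 → Coord N →L[ℝ] ℝ)
    (X' : Fin 3 → Coord N) :
    ∑ j, a j (fderiv ℝ (tensorCoord ω₀ c) z (tensorCoord ω₀ c z (a (j + 2)), X' (j + 2))
      (a (j + 1))) = 0 := by
  simp only [hω₀.apply_fderiv_tensorCoord hz, Fin.sum_univ_three]
  exact hω₀.jacobi c (a 0).toLinearMap (a 1).toLinearMap (a 2).toLinearMap z.1 hz

end Bivectors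

section Coordinates

set_option maxSynthPendingDepth 5

variable {N : ℕ} {M : Type*} [TopologicalSpace M] [ChartedSpace (Coord N) M]
  {ω₀ : TwoTensor N M} {T : ThreeForm N M} {ε : ℝ} {c p : M} {z : Coord N × Coord N}

theorem contract_apply (T : ThreeForm N M) (p : M) (v ξ η : Tan N p) :
    contract T p v ξ η = T p ![η, ξ, v] := rfl

theorem contract_skew (T : ThreeForm N M) (p : M) (v ξ η : Tan N p) :
    contract T p v ξ η = -contract T p v η ξ :=
  alternating_swap₁₂ (T p).toAlternatingMap η ξ v

/-- The matrix `δ^s_j + ε ω^{sp} T_{pjk} v^k` in the chart around `c`. -/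
def deformCoord (ω₀ : TwoTensor N M) (T : ThreeForm N M) (ε : ℝ) (c : M)
    (z : Coord N × Coord N) : Coord N →L[ℝ] Coord N :=
  1 + ε • (tensorCoord ω₀ c z ∘L contractCoord T c z)

theorem contDiffAt_deformCoord (hω₀ : IsPoissonStructure ω₀) (hT : IsClosedThreeForm T) (ε : ℝ)
    (hz : z.1 ∈ (chartAt (Coord N) c).target) : ContDiffAt ℝ ∞ (deformCoord ω₀ T ε c) z :=
  contDiffAt_const.add (((hω₀.contDiffAt_tensorCoord hz).clm_comp
    (hT.contDiffAt_contractCoord hz)).const_smul ε)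

/-- The velocities at `p` for which the matrix `δ^s_j + ε ω^{sp} T_{pjk} v^k` is invertible. -/
def invertibleSet (ω₀ : TwoTensor N M) (T : ThreeForm N M) (ε : ℝ) (p : M) : Set (Tan N p) :=
  {v | IsUnit (deformationMatrix ω₀ T ε p v)}

theorem deformedOperator_apply {v : Tan N p} (hv : v ∈ invertibleSet ω₀ T ε p) (α : Cotan N p) :
    deformedOperator ω₀ T ε p v α + ε • ω₀ p (contract T p v (deformedOperator ω₀ T ε p v α))
      = ω₀ p α :=
  congrArg (fun L : Module.End ℝ (Tan N p) => L (ω₀ p α)) (Ring.mul_inverse_cancel _ hv)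

/-- The operator `ω(-Tω)ⁿ`, the coefficient of `εⁿ` in the expansion of the deformed operator. -/
def coeffOperator (ω₀ : TwoTensor N M) (T : ThreeForm N M) (n : ℕ) : MatrixOperator N M :=
  fun p v => ω₀ p ∘ₗ (-(contract T p v ∘ₗ ω₀ p)) ^ n

theorem coeffOperator_succ_apply (n : ℕ) (p : M) (v : Tan N p) (α : Cotan N p) :
    coeffOperator ω₀ T (n + 1) p v α = -ω₀ p (contract T p v (coeffOperator ω₀ T n p v α)) := by
  rw [coeffOperator, pow_succ', LinearMap.comp_apply, Module.End.mul_apply, LinearMap.neg_apply,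
    map_neg]
  rfl

theorem opDom_univ (c : M) : opDom (fun p : M => (Set.univ : Set (Tan N p))) c
    = (chartAt (Coord N) c).target ×ˢ Set.univ := by
  ext z
  simp [opDom]

variable [IsManifold (𝓡 N) ∞ M]

theorem exists_eq_coframe (hz : z.1 ∈ (chartAt (Coord N) c).target) :
    ∃ p ∈ (chartAt (Coord N) c).source, ∃ v : Tan N p,
      z = (chartAt (Coord N) c p, coframe c p v) := by
  have hp := (chartAt (Coord N) c).map_target hz
  refine ⟨(chartAt (Coord N) c).symm z.1, hp, frame c _ z.2, ?_⟩
  rw [coframe_frame hp, (chartAt (Coord N) c).right_inv hz]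

theorem opCoord_apply (P : MatrixOperator N M) (hp : p ∈ (chartAt (Coord N) c).source)
    (v : Tan N p) (a : Coord N →L[ℝ] ℝ) :
    opCoord P c (chartAt (Coord N) c p, coframe c p v) a
      = coframe c p (P p v (coordCovector c p a.toLinearMap)) :=
  opCoord_coframe P hp v _ a fun w => by
    change a w = a (coframe c p (frame c p w))
    rw [coframe_frame hp]

theorem tensorCoord_apply (ω₀ : TwoTensor N M) (hp : p ∈ (chartAt (Coord N) c).source)
    (v : Tan N p) (a : Coord N →L[ℝ] ℝ) :
    tensorCoord ω₀ c (chartAt (Coord N) c p, coframe c p v) a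
      = coframe c p (ω₀ p (coordCovector c p a.toLinearMap)) :=
  opCoord_apply _ hp v a

theorem IsPoissonStructure.tensorCoord_skew (hω₀ : IsPoissonStructure ω₀)
    (hz : z.1 ∈ (chartAt (Coord N) c).target) (a b : Coord N →L[ℝ] ℝ) :
    a (tensorCoord ω₀ c z b) = -b (tensorCoord ω₀ c z a) := by
  obtain ⟨p, hp, v, rfl⟩ := exists_eq_coframe hz
  exact opCoord_skew hp (hω₀.skew p) a b

theorem coordCovector_contractCoord (T : ThreeForm N M) (hp : p ∈ (chartAt (Coord N) c).source)
    (v ξ : Tan N p) :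
    coordCovector c p
      (contractCoord T c (chartAt (Coord N) c p, coframe c p v) (coframe c p ξ)).toLinearMap
      = contract T p v ξ := by
  ext η
  change triForm T c _ (coframe c p ξ) (coframe c p v) (coframe c p η) = _
  rw [triForm_coframe T hp, contract_apply]
  refine (alternating_swap₂₃ (T p).toAlternatingMap ξ v η).trans ?_
  rw [alternating_swap₁₂ (T p).toAlternatingMap ξ η v, neg_neg]
  rfl

theorem deformCoord_coframe (ω₀ : TwoTensor N M) (T : ThreeForm N M) (ε : ℝ)
    (hp : p ∈ (chartAt (Coord N) c).source) (v ξ : Tan N p) :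
    deformCoord ω₀ T ε c (chartAt (Coord N) c p, coframe c p v) (coframe c p ξ)
      = coframe c p (deformationMatrix ω₀ T ε p v ξ) := by
  change coframe c p ξ + ε • tensorCoord ω₀ c _ (contractCoord T c _ (coframe c p ξ))
    = coframe c p (ξ + ε • ω₀ p (contract T p v ξ))
  rw [tensorCoord_apply ω₀ hp, coordCovector_contractCoord T hp, map_add, map_smul]

theorem isUnit_deformCoord_iff (ω₀ : TwoTensor N M) (T : ThreeForm N M) (ε : ℝ)
    (hp : p ∈ (chartAt (Coord N) c).source) (v : Tan N p) :
    IsUnit (deformCoord ω₀ T ε c (chartAt (Coord N) c p, coframe c p v))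
      ↔ IsUnit (deformationMatrix ω₀ T ε p v) := by
  rw [ContinuousLinearMap.isUnit_iff_bijective, Module.End.isUnit_iff]
  obtain ⟨e, he, -⟩ := exists_coframe_equiv (N := N) hp
  have hconj : deformCoord ω₀ T ε c (chartAt (Coord N) c p, coframe c p v) ∘ e
      = e ∘ deformationMatrix ω₀ T ε p v := by
    funext ξ
    have hξ := deformCoord_coframe ω₀ T ε hp v ξ
    rw [he] at hξ ⊢
    exact hξ
  rw [← Function.Bijective.of_comp_iff _ e.bijective, hconj,
    Function.Bijective.of_comp_iff' e.bijective]

theorem mem_opDom_invertibleSet_iff :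
    z ∈ opDom (invertibleSet ω₀ T ε) c
      ↔ z.1 ∈ (chartAt (Coord N) c).target ∧ IsUnit (deformCoord ω₀ T ε c z) := by
  refine and_congr_right fun hz => ?_
  have hp := (chartAt (Coord N) c).map_target hz
  rw [invertibleSet, Set.mem_ofPred_eq, ← isUnit_deformCoord_iff ω₀ T ε hp, coframe_frame hp,
    (chartAt (Coord N) c).right_inv hz]

theorem opCoord_deformedOperator (hz : z ∈ opDom (invertibleSet ω₀ T ε) c) (a : Coord N →L[ℝ] ℝ) :
    opCoord (deformedOperator ω₀ T ε) c z a
      + ε • tensorCoord ω₀ c z (contractCoord T c z (opCoord (deformedOperator ω₀ T ε) c z a))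
      = tensorCoord ω₀ c z a := by
  obtain ⟨htarget, hunit⟩ := mem_opDom_invertibleSet_iff.mp hz
  obtain ⟨p, hp, v, rfl⟩ := exists_eq_coframe htarget
  rw [isUnit_deformCoord_iff ω₀ T ε hp] at hunit
  rw [opCoord_apply _ hp, tensorCoord_apply ω₀ hp, tensorCoord_apply ω₀ hp,
    coordCovector_contractCoord T hp, ← map_smul, ← map_add, deformedOperator_apply hunit]

theorem opCoord_deformedOperator_eq (hz : z ∈ opDom (invertibleSet ω₀ T ε) c) :
    opCoord (deformedOperator ω₀ T ε) c z
      = Ring.inverse (deformCoord ω₀ T ε c z) ∘L tensorCoord ω₀ c z := by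
  ext1 a
  rw [ContinuousLinearMap.comp_apply, ← opCoord_deformedOperator hz]
  exact (congrArg (fun L : Coord N →L[ℝ] Coord N => L (opCoord (deformedOperator ω₀ T ε) c z a))
    (Ring.inverse_mul_cancel _ (mem_opDom_invertibleSet_iff.mp hz).2)).symm

theorem isSmoothSkewOn_deformedOperator (hω₀ : IsPoissonStructure ω₀) (hT : IsClosedThreeForm T)
    (ε : ℝ) : IsSmoothSkewOn (invertibleSet ω₀ T ε) (deformedOperator ω₀ T ε) where
  skew p v hv := skew_of_add_smul_eq (deformedOperator_apply hv) (hω₀.skew p) (contract_skew T p v)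
  isOpen c := by
    have hcont : ContinuousOn (deformCoord ω₀ T ε c) ((chartAt (Coord N) c).target ×ˢ Set.univ) :=
      fun z hz => (contDiffAt_deformCoord hω₀ hT ε hz.1).continuousAt.continuousWithinAt
    convert hcont.isOpen_inter_preimage ((chartAt (Coord N) c).open_target.prod isOpen_univ)
      Units.isOpen using 1
    ext z
    simp [mem_opDom_invertibleSet_iff]
  smooth c z hz := by
    obtain ⟨htarget, u, hu⟩ := mem_opDom_invertibleSet_iff.mp hz
    have hinverse : ContDiffAt ℝ ∞ (fun z => Ring.inverse (deformCoord ω₀ T ε c z)) z :=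
      ContDiffAt.comp (g := Ring.inverse) z (by rw [← hu]; exact contDiffAt_ringInverse ℝ u)
        (contDiffAt_deformCoord hω₀ hT ε htarget)
    exact (hinverse.clm_comp (hω₀.contDiffAt_tensorCoord htarget)).contDiffWithinAt.congr
      (fun y hy => opCoord_deformedOperator_eq hy) (opCoord_deformedOperator_eq hz)

theorem opCoord_coeffOperator (n : ℕ) (hz : z.1 ∈ (chartAt (Coord N) c).target) :
    opCoord (coeffOperator ω₀ T n) c z = seriesOp (tensorCoord ω₀ c) (contractCoord T c) n z := by
  obtain ⟨p, hp, v, rfl⟩ := exists_eq_coframe hz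
  ext1 a
  induction n with
  | zero =>
    rw [opCoord_apply _ hp, seriesOp_zero, tensorCoord_apply ω₀ hp]
    rfl
  | succ n ih =>
    rw [seriesOp_succ_apply, ← ih, opCoord_apply _ hp, opCoord_apply _ hp,
      tensorCoord_apply ω₀ hp, coordCovector_contractCoord T hp, coeffOperator_succ_apply, map_neg]

theorem isSmoothSkewOn_coeffOperator (hω₀ : IsPoissonStructure ω₀) (hT : IsClosedThreeForm T)
    (n : ℕ) : IsSmoothSkewOn (fun _ => Set.univ) (coeffOperator ω₀ T n) where
  skew p v _ := skew_comp_pow (hω₀.skew p) (contract_skew T p v) n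
  isOpen c := by
    rw [opDom_univ]
    exact (chartAt (Coord N) c).open_target.prod isOpen_univ
  smooth c z hz := by
    rw [opDom_univ] at hz ⊢
    exact (contDiffAt_seriesOp (hω₀.contDiffAt_tensorCoord hz.1)
      (hT.contDiffAt_contractCoord hz.1) n).contDiffWithinAt.congr
      (fun y hy => opCoord_coeffOperator n hy.1) (opCoord_coeffOperator n hz.1)

theorem isJacobiFamily_deformedOperator (hω₀ : IsPoissonStructure ω₀) (hT : IsClosedThreeForm T)
    (ε : ℝ) :
    IsJacobiFamily T (invertibleSet ω₀ T ε) (fun _ => deformedOperator ω₀ T ε) 0 {0} {0} ε where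
  swap_mem := by simp
  snd_le := by simp
  sum_eq c w hw f X X' hX := by
    have hP := isSmoothSkewOn_deformedOperator hω₀ hT ε
    have hw_nhds := (hP.isOpen c).mem_nhds hw
    let A := opCoord (deformedOperator ω₀ T ε) c
    let a (j : Fin 3) := f j - ε • contractCoord T c w (A w (f j))
    have hA : ∀ᶠ z in 𝓝 w, ∀ a, A z a + ε • tensorCoord ω₀ c z (contractCoord T c z (A z a))
        = tensorCoord ω₀ c z a := by
      filter_upwards [hw_nhds] with z hz a using opCoord_deformedOperator hz a
    have ha : ∀ j, tensorCoord ω₀ c w (a j) = X j 0 := fun j =>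
      (map_sub_smul_eq (B := (tensorCoord ω₀ c w).toLinearMap) (hA.self_of_nhds (f j))).trans
        (hX j 0 le_rfl).symm
    have hfderiv : ∀ j, f j (fderiv ℝ A w (X (j + 2) 0, X' (j + 2) 0) (f (j + 1)))
        = a j (fderiv ℝ (tensorCoord ω₀ c) w (tensorCoord ω₀ c w (a (j + 2)), X' (j + 2) 0)
            (a (j + 1)))
          + ε * fderiv ℝ (contractCoord T c) w (X (j + 2) 0, X' (j + 2) 0) (X (j + 1) 0)
            (X j 0) := fun j => by
      rw [fderiv_apply_of_add_smul_eq ((hω₀.contDiffAt_tensorCoord hw.1).differentiableAt (by simp))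
        ((hT.contDiffAt_contractCoord hw.1).differentiableAt (by simp))
        (((hP.smooth c).contDiffAt hw_nhds).differentiableAt (by simp)) hA
        (hω₀.tensorCoord_skew hw.1) (contractCoord_skew T c w), ha, hX j 0 le_rfl,
        hX (j + 1) 0 le_rfl]
    simp only [Finset.sum_singleton, Prod.fst_zero, Pi.zero_apply]
    rw [Finset.sum_congr rfl fun j _ => hfderiv j, Finset.sum_add_distrib, ← Finset.mul_sum,
      hω₀.sum_fderiv_tensorCoord hw.1 a fun j => X' j 0, zero_add,
      hT.sum_fderiv_contractCoord hw.1 (fun j => X j 0) fun j => X' j 0]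

theorem sum_antidiagonal_fderiv_coeffOperator (hω₀ : IsPoissonStructure ω₀)
    (hT : IsClosedThreeForm T) (hz : z.1 ∈ (chartAt (Coord N) c).target) (n : ℕ)
    (f : Fin 3 → Coord N →L[ℝ] ℝ) (u : Fin 3 → ℕ → Coord N × Coord N) :
    let B := tensorCoord ω₀ c
    let τ := contractCoord T c
    ∑ p ∈ Finset.HasAntidiagonal.antidiagonal n, ∑ j,
        f j (fderiv ℝ (opCoord (coeffOperator ω₀ T p.2) c) z (u (j + 2) p.1) (f (j + 1)))
      = ∑ t ∈ triples n 0, ∑ j, ((ratioOp B τ z ^ t j) (f j))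
          (fderiv ℝ B z (u (j + 2) (t (j + 2))) ((ratioOp B τ z ^ t (j + 1)) (f (j + 1))))
        + ∑ t ∈ triples n 1, ∑ j, fderiv ℝ τ z (u (j + 2) (t (j + 2)))
          (seriesOp B τ (t (j + 1)) z (f (j + 1))) (seriesOp B τ (t j) z (f j)) := by
  intro B τ
  have hP : ∀ b, opCoord (coeffOperator ω₀ T b) c =ᶠ[𝓝 z] seriesOp B τ b := fun b => by
    filter_upwards [((chartAt (Coord N) c).open_target.prod isOpen_univ).mem_nhds ⟨hz, trivial⟩]
      with y hy using opCoord_coeffOperator b hy.1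
  simp only [(hP _).fderiv_eq]
  rw [Finset.sum_comm, Finset.sum_congr rfl fun j _ => sum_antidiagonal_fderiv_seriesOp
      (hω₀.contDiffAt_tensorCoord hz) (hT.contDiffAt_contractCoord hz) (hω₀.tensorCoord_skew hz)
      (contractCoord_skew T c z) (u (j + 2)) n (f j) (f (j + 1)),
    Finset.sum_add_distrib, sum_sum_triples_comp_add, sum_sum_triples_comp_add]
  simp only [add_zero, B, τ]

theorem isJacobiFamily_coeffOperator (hω₀ : IsPoissonStructure ω₀) (hT : IsClosedThreeForm T)
    (n : ℕ) : IsJacobiFamily T (fun _ => Set.univ) (coeffOperator ω₀ T) n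
      (Finset.HasAntidiagonal.antidiagonal n) (triples n 1) 1 where
  swap_mem p hp := by
    rw [Finset.HasAntidiagonal.mem_antidiagonal] at hp ⊢
    rwa [Prod.fst_swap, Prod.snd_swap, add_comm]
  snd_le p hp := by
    rw [Finset.HasAntidiagonal.mem_antidiagonal] at hp
    omega
  sum_eq c w hw f X X' hX := by
    have hX_series : ∀ j, ∀ a ≤ n,
        seriesOp (tensorCoord ω₀ c) (contractCoord T c) a w (f j) = X j a := fun j a ha => by
      rw [hX j a ha, opCoord_coeffOperator a hw.1]
    rw [sum_antidiagonal_fderiv_coeffOperator hω₀ hT hw.1 n f fun j a => (X j a, X' j a), one_mul]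
    refine (congrArg₂ (· + ·) (Finset.sum_eq_zero fun t ht => ?_)
      (Finset.sum_congr rfl fun t ht => ?_)).trans (zero_add _)
    · simp only [← hX_series _ _ (le_of_mem_triples ht _), seriesOp_apply]
      exact hω₀.sum_fderiv_tensorCoord hw.1
        (fun j => (ratioOp (tensorCoord ω₀ c) (contractCoord T c) w ^ t j) (f j))
        fun j => X' j (t j)
    · simp only [hX_series _ _ (le_of_mem_triples ht _)]
      exact hT.sum_fderiv_contractCoord hw.1 (fun j => X j (t j)) fun j => X' j (t j)

end Coordinates

section Domain

variable {N : ℕ} {M : Type*} [TopologicalSpace M] [ChartedSpace (Coord N) M]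
  {ω₀ : TwoTensor N M} {T : ThreeForm N M}

theorem mem_deformationDomain {ε : ℝ} {γ : Loop N M} :
    γ ∈ deformationDomain ω₀ T ε ↔ ∀ z, γ.vel z ∈ invertibleSet ω₀ T ε (γ z) := by
  refine ⟨fun hγ z => ?_, fun hγ x => ?_⟩
  · obtain ⟨x, -, rfl⟩ := exists_mem_Icc_coe_eq z
    rw [Loop.vel_coe]
    exact hγ x
  · have hx := hγ (x : UnitAddCircle)
    rwa [Loop.vel_coe] at hx

variable [IsManifold (𝓡 N) ∞ M]

theorem vel_mem_invertibleSet_iff (ε : ℝ) {c : M} {γ : Loop N M} {z : UnitAddCircle}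
    (hz : γ z ∈ (chartAt (Coord N) c).source) :
    γ.vel z ∈ invertibleSet ω₀ T ε (γ z) ↔ IsUnit (deformCoord ω₀ T ε c (loopJet c γ z)) :=
  (isUnit_deformCoord_iff ω₀ T ε hz _).symm

variable {E : Type*} [NormedAddCommGroup E] [NormedSpace ℝ E]

theorem IsFamily.eventually_mem_deformationDomain (hω₀ : IsPoissonStructure ω₀)
    (hT : IsClosedThreeForm T) {W : Set E} {Θ : E → Loop N M} (h : IsFamily W Θ) {e : E}
    (he : e ∈ W) {ε : E → ℝ} (hε : Continuous ε) (hmem : Θ e ∈ deformationDomain ω₀ T (ε e)) :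
    ∀ᶠ e' in 𝓝 e, Θ e' ∈ deformationDomain ω₀ T (ε e') := by
  have hlocal : ∀ x : ℝ, ∀ᶠ q : E × ℝ in 𝓝 (e, x),
      (Θ q.1).vel q.2 ∈ invertibleSet ω₀ T (ε q.1) (Θ q.1 q.2) := fun x => by
    set c : M := Θ e (x : UnitAddCircle)
    have hq : (e, x) ∈ chartDom W Θ c := ⟨he, mem_chart_source _ _⟩
    have htarget := (chartAt (Coord N) c).map_source hq.2
    have hmatrix : ContinuousAt (fun q : E × ℝ =>
        deformCoord ω₀ T (ε q.1) c (jet (inCoord Θ c) (0, 1) q)) (e, x) :=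
      continuousAt_const.add ((hε.comp continuous_fst).continuousAt.smul
        (((hω₀.contDiffAt_tensorCoord htarget).clm_comp
          (hT.contDiffAt_contractCoord htarget)).continuousAt.comp
            (contDiffAt_jet (h.contDiffAt_inCoord hq) (0, 1)).continuousAt))
    have hunit : IsUnit (deformCoord ω₀ T (ε e) c (jet (inCoord Θ c) (0, 1) (e, x))) := by
      rw [h.jet_inCoord hq]
      exact (vel_mem_invertibleSet_iff (ε e) hq.2).mp (mem_deformationDomain.mp hmem x)
    filter_upwards [hmatrix.eventually (Units.isOpen.mem_nhds hunit),
      (h.isOpen_chartDom c).mem_nhds hq] with q hq_unit hq_dom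
    rw [vel_mem_invertibleSet_iff (ε q.1) hq_dom.2, ← h.jet_inCoord hq_dom]
    exact hq_unit
  filter_upwards [isCompact_Icc.eventually_forall_of_forall_eventually
    (K := Set.Icc (0 : ℝ) 1)
    (P := fun e x => (Θ e).vel (x : UnitAddCircle) ∈ invertibleSet ω₀ T (ε e) (Θ e x))
    fun x _ => hlocal x] with e' he'
  refine mem_deformationDomain.mpr fun z => ?_
  obtain ⟨x, hx, rfl⟩ := exists_mem_Icc_coe_eq z
  exact he' x hx

theorem isLoopOpen_deformationDomain (hω₀ : IsPoissonStructure ω₀) (hT : IsClosedThreeForm T)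
    (ε : ℝ) : IsLoopOpen (deformationDomain ω₀ T ε) := by
  intro k W Γ hΓ
  rw [isOpen_iff_mem_nhds]
  rintro t ⟨ht, hmem⟩
  exact (hΓ.isOpen.eventually_mem ht).and ((isSmoothFamily_iff.mp hΓ).1
    |>.eventually_mem_deformationDomain hω₀ hT ht continuous_const hmem)

theorem eventually_mem_deformationDomain (hω₀ : IsPoissonStructure ω₀) (hT : IsClosedThreeForm T)
    (γ : Loop N M) : ∀ᶠ ε in 𝓝 (0 : ℝ), γ ∈ deformationDomain ω₀ T ε :=
  (isFamily_const γ).eventually_mem_deformationDomain hω₀ hT trivial continuous_id fun x => by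
    simp [deformationMatrix]

end Domain

section Poisson

variable {N : ℕ} {M : Type*} [TopologicalSpace M] [ChartedSpace (Coord N) M]
  {ω₀ : TwoTensor N M} {T : ThreeForm N M}

theorem IsSmoothSkewOn.bracket_skew {P : MatrixOperator N M} {O : ∀ p : M, Set (Tan N p)}
    (hP : IsSmoothSkewOn O P) {γ : Loop N M} (hγ : ∀ z, γ.vel z ∈ O (γ z))
    (f g : CovectorField N M) : bracket P f g γ = -bracket P g f γ := by
  rw [bracket_eq_integral_density, bracket_eq_integral_density, ← intervalIntegral.integral_neg]
  exact intervalIntegral.integral_congr fun x _ => hP.skew _ _ (hγ x) _ _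

variable [IsManifold (𝓡 N) ∞ M]

theorem isLoopPoisson_deformedOperator (hω₀ : IsPoissonStructure ω₀) (hT : IsClosedThreeForm T)
    (ε : ℝ) : IsLoopPoisson (deformationDomain ω₀ T ε) (deformedOperator ω₀ T ε) := by
  have hP := isSmoothSkewOn_deformedOperator hω₀ hT ε
  have hVO : ∀ V ⊆ deformationDomain ω₀ T ε, ∀ γ ∈ V, ∀ z,
      γ.vel z ∈ invertibleSet ω₀ T ε (γ z) := fun V hV γ hγ => mem_deformationDomain.mp (hV hγ)
  refine ⟨fun V hV _ I J dI dJ _ _ γ hγ => hP.bracket_skew (hVO V hV γ hγ) dI dJ,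
    fun V hV hVo I J dI dJ hI hJ => exists_hasVariationalDeriv_bracket hP hI hJ hVo (hVO V hV),
    fun V hV hVo I J K dI dJ dK dIJ dJK dKI hI hJ hK hIJ hJK hKI γ hγ => ?_⟩
  have hjacobi := sum_bracket_bracket_eq_zero (I := ![I, J, K]) (f := ![dI, dJ, dK])
    (d := ![fun _ => dIJ, fun _ => dJK, fun _ => dKI]) hT (fun _ => hP)
    (isJacobiFamily_deformedOperator hω₀ hT ε) hVo (hVO V hV)
    (fun j => by fin_cases j <;> assumption) (fun j _ => by fin_cases j <;> assumption) hγ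
  rw [Finset.sum_singleton, Fin.sum_univ_three] at hjacobi
  exact hjacobi

theorem isFormalLoopPoisson_coeffOperator (hω₀ : IsPoissonStructure ω₀) (hT : IsClosedThreeForm T) :
    IsFormalLoopPoisson (coeffOperator ω₀ T) := by
  have hP := isSmoothSkewOn_coeffOperator hω₀ hT
  refine ⟨fun V _ I J dI dJ _ _ n γ _ => (hP n).bracket_skew (fun _ => trivial) dI dJ,
    fun V hVo I J dI dJ hI hJ n =>
      exists_hasVariationalDeriv_bracket (hP n) hI hJ hVo fun _ _ _ => trivial,
    fun V hVo I J K dI dJ dK dIJ dJK dKI hI hJ hK hIJ hJK hKI n γ hγ => ?_⟩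
  have hjacobi := sum_bracket_bracket_eq_zero (I := ![I, J, K]) (f := ![dI, dJ, dK])
    (d := ![dIJ, dJK, dKI]) hT hP (isJacobiFamily_coeffOperator hω₀ hT n) hVo
    (fun _ _ _ => trivial) (fun j => by fin_cases j <;> assumption)
    (fun j b => by fin_cases j <;> apply_assumption) hγ
  simp only [Fin.sum_univ_three] at hjacobi
  exact hjacobi

end Poisson

section Expansion

theorem eventually_hasSum_inverse_one_add_smul {A : Type*} [NormedRing A] [NormedAlgebra ℝ A]
    [HasSummableGeomSeries A] (a : A) : ∀ᶠ ε in 𝓝 (0 : ℝ), IsUnit (1 + ε • a) ∧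
      HasSum (fun n => ε ^ n • (-a) ^ n) (Ring.inverse (1 + ε • a)) := by
  have hnorm : Tendsto (fun ε : ℝ => ‖ε • -a‖) (𝓝 0) (𝓝 0) :=
    Continuous.tendsto' (by fun_prop) 0 0 (by simp)
  filter_upwards [hnorm.eventually_lt_const one_pos] with ε hε
  have hsub : 1 + ε • a = 1 - ε • -a := by rw [smul_neg, sub_neg_eq_add]
  simp only [hsub, ← smul_pow]
  exact ⟨isUnit_one_sub_of_norm_lt_one hε, hasSum_geom_series_inverse _ hε⟩

theorem eventually_hasSum_inverse_one_add_smul_apply {E : Type*} [NormedAddCommGroup E]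
    [NormedSpace ℝ E] [FiniteDimensional ℝ E] (L : Module.End ℝ E) :
    ∀ᶠ ε in 𝓝 (0 : ℝ), IsUnit (1 + ε • L) ∧ ∀ (a : Module.Dual ℝ E) (x : E),
      HasSum (fun n => ε ^ n * a (((-L) ^ n) x)) (a (Ring.inverse (1 + ε • L) x)) := by
  have : CompleteSpace E := FiniteDimensional.complete ℝ E
  let Φ : Module.End ℝ E ≃ₐ[ℝ] (E →L[ℝ] E) := Module.End.toContinuousLinearMap E
  filter_upwards [eventually_hasSum_inverse_one_add_smul (Φ L)] with ε ⟨hunit, hsum⟩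
  have hΦ : 1 + ε • Φ L = Φ (1 + ε • L) := by rw [map_add, map_one, map_smul]
  rw [hΦ, MulEquiv.isUnit_map] at hunit
  refine ⟨hunit, fun a x => ?_⟩
  have hinverse : Ring.inverse (Φ (1 + ε • L)) = Φ (Ring.inverse (1 + ε • L)) := by
    obtain ⟨u, hu⟩ := hunit
    rw [← hu, Ring.inverse_unit]
    exact Ring.inverse_unit (Units.map Φ.toMonoidHom u)
  have hterm : ∀ n, ε ^ n • (-Φ L) ^ n = Φ (ε ^ n • (-L) ^ n) := fun n => by
    rw [map_smul, map_pow, map_neg]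
  rw [hΦ, hinverse] at hsum
  simp only [hterm] at hsum
  have hsum_apply := hsum.mapL ((LinearMap.toContinuousLinearMap a).comp
    (ContinuousLinearMap.apply ℝ E x))
  have hterm_apply : ∀ n, a (Φ (ε ^ n • (-L) ^ n) x) = ε ^ n * a (((-L) ^ n) x) := fun n =>
    map_smul a (ε ^ n) (((-L) ^ n) x)
  simp only [← hterm_apply]
  exact hsum_apply

variable {N : ℕ} {M : Type*} [TopologicalSpace M] [ChartedSpace (Coord N) M]
  {ω₀ : TwoTensor N M} {T : ThreeForm N M}

theorem coeffOperator_eq_pow (n : ℕ) (p : M) (v : Tan N p) (α : Cotan N p) :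
    coeffOperator ω₀ T n p v α = ((-(ω₀ p ∘ₗ contract T p v)) ^ n) (ω₀ p α) := by
  induction n with
  | zero => rfl
  | succ n ih =>
    rw [coeffOperator_succ_apply, ih, pow_succ', Module.End.mul_apply]
    rfl

theorem eventually_hasSum_deformedOperator (ω₀ : TwoTensor N M) (T : ThreeForm N M) (p : M)
    (v : Tan N p) : ∀ᶠ ε in 𝓝 (0 : ℝ), IsUnit (deformationMatrix ω₀ T ε p v) ∧
      ∀ α β : Cotan N p, HasSum (fun n => ε ^ n * α (coeffOperator ω₀ T n p v β))
        (α (deformedOperator ω₀ T ε p v β)) := by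
  filter_upwards [eventually_hasSum_inverse_one_add_smul_apply (E := Coord N)
    (ω₀ p ∘ₗ contract T p v : Module.End ℝ (Tan N p))] with ε ⟨hunit, hsum⟩
  refine ⟨hunit, fun α β => ?_⟩
  simp only [coeffOperator_eq_pow]
  exact hsum α (ω₀ p β)

theorem isLinearMap_contract (T : ThreeForm N M) (p : M) : IsLinearMap ℝ (contract T p) := by
  have hupdate (ξ η v : Tan N p) : ![η, ξ, v] = Function.update ![η, ξ, 0] 2 v := by
    ext i; fin_cases i <;> rfl
  refine ⟨fun v w => ?_, fun r v => ?_⟩ <;> ext ξ η : 2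
  · rw [contract_apply, hupdate, (T p).map_update_add, ← hupdate, ← hupdate]
    rfl
  · rw [contract_apply, hupdate, (T p).map_update_smul, ← hupdate]
    rfl

theorem coeffOperator_homogeneous (n : ℕ) (p : M) (α β : Cotan N p) :
    ∃ L : MultilinearMap ℝ (fun _ : Fin n => Tan N p) ℝ,
      ∀ v, α (coeffOperator ω₀ T n p v β) = L (fun _ => v) := by
  let ratio : Tan N p →ₗ[ℝ] Module.End ℝ (Cotan N p) :=
    IsLinearMap.mk' (fun v => -(contract T p v ∘ₗ ω₀ p))
      ⟨fun v w => by
        rw [(isLinearMap_contract T p).map_add, LinearMap.add_comp]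
        exact neg_add (α := Module.End ℝ (Cotan N p)) _ _, fun r v => by
        rw [(isLinearMap_contract T p).map_smul, LinearMap.smul_comp]
        exact (smul_neg (A := Module.End ℝ (Cotan N p)) r _).symm⟩
  let entry : Module.End ℝ (Cotan N p) →ₗ[ℝ] ℝ := (α ∘ₗ ω₀ p) ∘ₗ LinearMap.applyₗ β
  refine ⟨entry.compMultilinearMap ((MultilinearMap.mkPiAlgebraFin ℝ n
    (Module.End ℝ (Cotan N p))).compLinearMap fun _ => ratio), fun v => ?_⟩
  rw [LinearMap.compMultilinearMap_apply, MultilinearMap.compLinearMap_apply,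
    MultilinearMap.mkPiAlgebraFin_apply_const]
  rfl

variable [IsManifold (𝓡 N) ∞ M]

theorem isGradedDeformation_coeffOperator (hω₀ : IsPoissonStructure ω₀)
    (hT : IsClosedThreeForm T) : IsGradedDeformation ω₀ (coeffOperator ω₀ T) where
  zero p v := rfl
  homogeneous := coeffOperator_homogeneous
  smooth n c a := by
    have hsmooth := (isSmoothSkewOn_coeffOperator hω₀ hT n).smooth c
    rw [opDom_univ] at hsmooth
    exact hsmooth.clm_apply (contDiffOn_const (c := LinearMap.toContinuousLinearMap a))
  poisson := isFormalLoopPoisson_coeffOperator hω₀ hT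

end Expansion

end

end LoopPoisson

theorem mainTheorem3_general {N : ℕ} {M : Type*} [TopologicalSpace M]
    [ChartedSpace (LoopPoisson.Coord N) M] [IsManifold (𝓡 N) ∞ M]
    (ω₀ : LoopPoisson.TwoTensor N M) (hω₀ : LoopPoisson.IsPoissonStructure ω₀)
    (T : LoopPoisson.ThreeForm N M) (hT : LoopPoisson.IsClosedThreeForm T) :
    (∀ ε : ℝ, LoopPoisson.IsLoopOpen (LoopPoisson.deformationDomain ω₀ T ε) ∧
      LoopPoisson.IsLoopPoisson (LoopPoisson.deformationDomain ω₀ T ε)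
        (LoopPoisson.deformedOperator ω₀ T ε)) ∧
    (∀ γ : LoopPoisson.Loop N M, ∀ᶠ ε in 𝓝 (0 : ℝ), γ ∈ LoopPoisson.deformationDomain ω₀ T ε) ∧
    ∃ P : ℕ → LoopPoisson.MatrixOperator N M,
      LoopPoisson.IsGradedDeformation ω₀ P ∧
      (∀ (p : M) (v : LoopPoisson.Tan N p),
        P 1 p v = -(ω₀ p ∘ₗ LoopPoisson.contract T p v ∘ₗ ω₀ p)) ∧
      (∀ (p : M) (v : LoopPoisson.Tan N p), ∀ᶠ ε in 𝓝 (0 : ℝ),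
        IsUnit (LoopPoisson.deformationMatrix ω₀ T ε p v) ∧
        ∀ α β : LoopPoisson.Cotan N p,
          HasSum (fun n => ε ^ n * α (P n p v β))
            (α (LoopPoisson.deformedOperator ω₀ T ε p v β))) :=
  ⟨fun ε => ⟨LoopPoisson.isLoopOpen_deformationDomain hω₀ hT ε,
      LoopPoisson.isLoopPoisson_deformedOperator hω₀ hT ε⟩,
    LoopPoisson.eventually_mem_deformationDomain hω₀ hT,
    LoopPoisson.coeffOperator ω₀ T,
    LoopPoisson.isGradedDeformation_coeffOperator hω₀ hT,
    fun p v => LinearMap.ext fun α => LoopPoisson.coeffOperator_succ_apply 0 p v α,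
    LoopPoisson.eventually_hasSum_deformedOperator ω₀ T⟩

theorem mainTheorem3 {N : ℕ} {M : Type*} [TopologicalSpace M] [T2Space M]
    [SecondCountableTopology M] [ChartedSpace (LoopPoisson.Coord N) M] [IsManifold (𝓡 N) ∞ M]
    (ω₀ : LoopPoisson.TwoTensor N M) (hω₀ : LoopPoisson.IsPoissonStructure ω₀)
    (T : LoopPoisson.ThreeForm N M) (hT : LoopPoisson.IsClosedThreeForm T) :
    (∀ ε : ℝ, LoopPoisson.IsLoopOpen (LoopPoisson.deformationDomain ω₀ T ε) ∧
      LoopPoisson.IsLoopPoisson (LoopPoisson.deformationDomain ω₀ T ε)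
        (LoopPoisson.deformedOperator ω₀ T ε)) ∧
    (∀ γ : LoopPoisson.Loop N M, ∀ᶠ ε in 𝓝 (0 : ℝ), γ ∈ LoopPoisson.deformationDomain ω₀ T ε) ∧
    ∃ P : ℕ → LoopPoisson.MatrixOperator N M,
      LoopPoisson.IsGradedDeformation ω₀ P ∧
      (∀ (p : M) (v : LoopPoisson.Tan N p),
        P 1 p v = -(ω₀ p ∘ₗ LoopPoisson.contract T p v ∘ₗ ω₀ p)) ∧
      (∀ (p : M) (v : LoopPoisson.Tan N p), ∀ᶠ ε in 𝓝 (0 : ℝ),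
        IsUnit (LoopPoisson.deformationMatrix ω₀ T ε p v) ∧
        ∀ α β : LoopPoisson.Cotan N p,
          HasSum (fun n => ε ^ n * α (P n p v β))
            (α (LoopPoisson.deformedOperator ω₀ T ε p v β))) :=
  mainTheorem3_general ω₀ hω₀ T hT
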